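/- **Theorem 5.14.** Let $(C,\oplus,e)$ be a permutative category, i.e. a symmetric monoidal category whose associativity and unit isomorphisms are identities. Then the diagrams $$Q_j\big(C^{(-)}\big)\circ\wedge \qquad\text{and}\qquad K_{adj}(\Sigma C)\;:\;\mathscr F\times\Delta^{op}\longrightarrow \mathrm{Cat}$$ are connected by a zigzag of levelwise equivalences, i.e. by a finite chain of strictly natural transformations, pointing in either direction, between functors $\mathscr F\times\Delta^{op}\to\mathrm{Cat}$, each of whose components is an equivalence of categories. Here the notation is as follows. * $\mathscr F$ is the category of finite pointed sets $\underline n_+=\{*,1,\dots,n\}$, $n\ge 0$, and pointed maps. The functor $\wedge:\mathscr F\times\Delta^{op}\to\mathscr F$ sends $(\underline n_+,[p])$ to $\underline n_+\wedge\underline p_+=\underline{np}_+$ (regarded as $p$ consecutive blocks of size $n$), where $\Delta^{op}\to\mathscr F$ is the simplicial circle: $[p]\mapsto\underline p_+$, and a monotone map $\alpha:[q]\to[p]$ induces the map $\underline p_+\to\underline q_+$ that sends $j$ to $i$ if $\alpha(i-1)<j\le\alpha(i)$, and to $*$ if there is no such $i$. * $C^{(-)}:\mathscr F\to\mathrm{Cat}$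 is the pseudofunctor $\underline m_+\mapsto C^m$ for which $\varphi:\underline m_+\to\underline n_+$ acts by $\varphi_*(x)_j=\bigoplus_{i\in\varphi^{-1}(j)}x_i$, the sum being taken in increasing order and being $e$ if $\varphi^{-1}(j)$ is empty; its structure isomorphisms are the ones given by the symmetry of $C$. * For a small category $A$, $Q_j$ is the left 2-adjoint of the inclusion of the 2-category $[A,\mathrm{Cat}]$ of functors and strict natural transformations into the 2-category $\mathrm{Bicat}(A,\mathrm{Cat})$ of pseudofunctors and pseudonatural transformations; it is applied with $A=\mathscr F$. * $\Sigma C$ is the 2-category with one object, with the objects and morphisms of $C$ as 1-cells and 2-cells, and with $\oplus$ as horizontal composition. $(\Sigma C)^{(-)}$ is the pseudofunctor $\underline m_+\mapsto(\Sigma C)^m=\Sigma(C^m)$ from $\mathscr F$ to the 2-category $\mathrm{2Cat}_{p,i}$ of 2-categories, pseudofunctors and icons; it is given by $C^{(-)}$, whose functors $\varphi_*$ are strong monoidal and whose structure isomorphisms are monoidal by the symmetry of $C$. * $Q$ is the left 2-adjoint of the inclusion $[\mathscr F,\mathrm{2Cat}_{2,i}]\hookrightarrow\mathrm{Bicat}(\mathscr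 F,\mathrm{2Cat}_{p,i})$, where $\mathrm{2Cat}_{2,i}$ is the 2-category of 2-categories, strict 2-functors and icons. * For a 2-category $\mathcal A$, the nerve $N\mathcal A:\Delta^{op}\to\mathrm{Cat}$ sends $[p]$ to the category of strict 2-functors $[p]\to\mathcal A$ and icons. * $K_{adj}(\Sigma C)$ is the functor $(\underline n_+,[p])\mapsto N\big(Q((\Sigma C)^{(-)})(\underline n_+)\big)_p$. -/

import Mathlib

open CategoryTheory MonoidalCategory

universe v u w' w

namespace SigmaK

set_option linter.unusedSectionVars false
set_option linter.unusedSimpArgs false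
set_option linter.unusedVariables false
set_option linter.checkUnivs false

section

/-- A strict monoidal category: the associator and the unitors are identities. A permutative
category is a symmetric monoidal category with this property. -/
class StrictMonoidal (C : Type u) [Category.{v} C] [MonoidalCategory C] : Prop where
  tensor_assoc (X Y Z : C) : (X ⊗ Y) ⊗ Z = X ⊗ (Y ⊗ Z)
  unit_tensor (X : C) : 𝟙_ C ⊗ X = X
  tensor_unit (X : C) : X ⊗ 𝟙_ C = X
  associator_hom (X Y Z : C) : (α_ X Y Z).hom = eqToHom (tensor_assoc X Y Z)
  leftUnitor_hom (X : C) : (λ_ X).hom = eqToHom (unit_tensor X)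
  rightUnitor_hom (X : C) : (ρ_ X).hom = eqToHom (tensor_unit X)

section Tens

variable {ι : Type*} {C : Type u} [Category.{v} C] [MonoidalCategory C]

/-- The tensor product of the `x i`, `i ∈ l`, in the order of the list; the unit if `l` is empty. -/
@[reducible] def tens (x : ι → C) : List ι → C
  | [] => 𝟙_ C
  | i :: l => x i ⊗ tens x l

/-- The tensor product of a family of morphisms. -/
def tensMap {x y : ι → C} (f : ∀ i, x i ⟶ y i) : ∀ l : List ι, tens x l ⟶ tens y l
  | [] => 𝟙 (𝟙_ C)
  | i :: l => f i ⊗ₘ tensMap f l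

/-- The associativity isomorphism for the product over a concatenated list. -/
def appIso (x : ι → C) : ∀ a b : List ι, tens x (a ++ b) ≅ tens x a ⊗ tens x b
  | [], b => (λ_ (tens x b)).symm
  | i :: a, b => whiskerLeftIso (x i) (appIso x a b) ≪≫ (α_ (x i) (tens x a) (tens x b)).symm

theorem tensMap_id (x : ι → C) (l : List ι) : tensMap (fun i => 𝟙 (x i)) l = 𝟙 _ := by
  induction l with
  | nil => rfl
  | cons i l ih => simp [tensMap, ih, tens]

theorem tensMap_comp {x y z : ι → C} (f : ∀ i, x i ⟶ y i) (g : ∀ i, y i ⟶ z i) (l : List ι) :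
    tensMap (fun i => f i ≫ g i) l = tensMap f l ≫ tensMap g l := by
  induction l with
  | nil => simp [tensMap, tens]
  | cons i l ih => simp [tensMap, ih, tens]

theorem appIso_natural {x y : ι → C} (f : ∀ i, x i ⟶ y i) (a b : List ι) :
    tensMap f (a ++ b) ≫ (appIso y a b).hom = (appIso x a b).hom ≫ (tensMap f a ⊗ₘ tensMap f b) := by
  induction a with
  | nil => simp [tensMap, appIso, tens]
  | cons i a ih =>
    simp only [List.cons_append, tensMap, tens, appIso, Iso.trans_hom, whiskerLeftIso_hom,
      Iso.symm_hom, Category.assoc]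
    rw [MonoidalCategory.tensorHom_def, Category.assoc, ← whiskerLeft_comp_assoc, ih,
      ← associator_inv_naturality, MonoidalCategory.tensorHom_def (f i), whiskerLeft_comp,
      Category.assoc, Category.assoc, ← whisker_exchange_assoc]

variable (x : ι → C)

theorem whiskerLeft_eqToHom' (X : C) {Y Z : C} (h : Y = Z) :
    X ◁ eqToHom h = eqToHom (by rw [h]) := by subst h; simp

theorem appIso_assoc (a b c : List ι) :
    (appIso x (a ++ b) c).hom ≫ (appIso x a b).hom ▷ tens x c ≫ (α_ _ _ _).hom =
      eqToHom (by rw [List.append_assoc]) ≫ (appIso x a (b ++ c)).hom ≫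
        tens x a ◁ (appIso x b c).hom := by
  induction a with
  | nil => simp [appIso, tens]
  | cons i a ih =>
    have := congrArg (fun f => x i ◁ f ≫ (α_ _ _ _).inv) ih
    simp only [whiskerLeft_comp, Category.assoc, whiskerLeft_eqToHom'] at this
    simp only [List.cons_append, tens, appIso, Iso.trans_hom, whiskerLeftIso_hom,
      Iso.symm_hom, Category.assoc, comp_whiskerRight]
    trans
    swap
    · refine Eq.trans this ?_
      simp
    · simp

theorem eqToHom_appIso (a b c : List ι) (h : tens x (a ++ (b ++ c)) = tens x (a ++ b ++ c)) :
    eqToHom h ≫ (appIso x (a ++ b) c).hom = (appIso x a (b ++ c)).hom ≫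
      tens x a ◁ (appIso x b c).hom ≫ (α_ _ _ _).inv ≫ (appIso x a b).inv ▷ tens x c := by
  have := appIso_assoc x a b c
  rw [← cancel_mono ((appIso x a b).hom ▷ tens x c), ← cancel_mono (α_ _ _ _).hom]
  simp only [Category.assoc, this]
  simp

theorem appIso_inv_eqToHom (a b c : List ι) (h : tens x (a ++ b ++ c) = tens x (a ++ (b ++ c))) :
    (appIso x (a ++ b) c).inv ≫ eqToHom h = (appIso x a b).hom ▷ tens x c ≫ (α_ _ _ _).hom ≫
      tens x a ◁ (appIso x b c).inv ≫ (appIso x a (b ++ c)).inv := by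
  rw [Iso.inv_comp_eq, reassoc_of% appIso_assoc x a b c]
  simp

theorem appIso_inv_congr (a : List ι) {b b' : List ι} (hb : b = b')
    (h : tens x (a ++ b) = tens x (a ++ b')) :
    (appIso x a b).inv ≫ eqToHom h = tens x a ◁ eqToHom (by rw [hb]) ≫ (appIso x a b').inv := by
  subst hb
  simp

theorem appIso_nil (a : List ι) :
    (appIso x a []).hom = eqToHom (by simp) ≫ (ρ_ (tens x a)).inv := by
  induction a with
  | nil =>
    simp only [appIso, tens, Iso.symm_hom, unitors_inv_equal]
    exact (Category.id_comp _).symm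
  | cons i a ih =>
    have : (appIso x (i :: a) []).hom = x i ◁ (appIso x a []).hom ≫ (α_ _ _ _).inv := rfl
    rw [this, ih, whiskerLeft_comp, whiskerLeft_eqToHom', Category.assoc]
    simp [tens]

end Tens

variable {ι : Type*} {C : Type u} [Category.{v} C] [MonoidalCategory C] [SymmetricCategory C]

/-- Exchange of the first two factors by the symmetry. -/
def sw (X Y Z : C) : X ⊗ (Y ⊗ Z) ⟶ Y ⊗ (X ⊗ Z) :=
  (α_ X Y Z).inv ≫ (β_ X Y).hom ▷ Z ≫ (α_ Y X Z).hom

/-- `Ins i l l'`: a way to obtain `l'` from `l` by inserting `i`. -/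
inductive Ins (i : ι) : List ι → List ι → Type _
  | head (l : List ι) : Ins i l (i :: l)
  | tail (k : ι) {l l' : List ι} (p : Ins i l l') : Ins i (k :: l) (k :: l')

/-- `Code l l'`: a permutation from `l` to `l'`, as a sequence of insertions. -/
inductive Code : List ι → List ι → Type _
  | nil : Code [] []
  | cons {i : ι} {l l' l'' : List ι} (p : Ins i l' l'') (q : Code l l') : Code (i :: l) l''

/-- The composite of symmetries that moves the first factor to the place of insertion. -/
def Ins.hom (x : ι → C) {i : ι} : ∀ {l l' : List ι}, Ins i l l' → (x i ⊗ tens x l ⟶ tens x l')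
  | _, _, .head l => 𝟙 (x i ⊗ tens x l)
  | _, _, .tail k p => sw (x i) (x k) _ ≫ x k ◁ p.hom x

/-- The composite of symmetries that permutes the factors of a tensor product. -/
def Code.hom (x : ι → C) : ∀ {l l' : List ι}, Code l l' → (tens x l ⟶ tens x l')
  | _, _, .nil => 𝟙 (𝟙_ C)
  | _, _, .cons (i := i) p q => x i ◁ q.hom x ≫ p.hom x

theorem sw_sw (X Y Z : C) : sw X Y Z ≫ sw Y X Z = 𝟙 _ := by
  simp [sw, ← comp_whiskerRight_assoc]

theorem sw_natural {X X' Y Y' Z Z' : C} (f : X ⟶ X') (g : Y ⟶ Y') (h : Z ⟶ Z') :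
    (f ⊗ₘ (g ⊗ₘ h)) ≫ sw X' Y' Z' = sw X Y Z ≫ (g ⊗ₘ (f ⊗ₘ h)) := by
  simp only [sw, associator_inv_naturality_assoc, Category.assoc, ← associator_naturality]
  simp only [← tensorHom_id, tensorHom_comp_tensorHom_assoc, BraidedCategory.braiding_naturality]
  simp

theorem sw_natural_right (X Y : C) {Z Z' : C} (f : Z ⟶ Z') :
    X ◁ Y ◁ f ≫ sw X Y Z' = sw X Y Z ≫ Y ◁ X ◁ f := by
  simpa using sw_natural (𝟙 X) (𝟙 Y) f

theorem sw_yb (X Y Z W : C) :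
    X ◁ sw Y Z W ≫ sw X Z _ ≫ Z ◁ sw X Y W = sw X Y _ ≫ Y ◁ sw X Z W ≫ sw Y Z _ := by
  have h := congrArg (fun f => (α_ X Y (Z ⊗ W)).inv ≫ (α_ (X ⊗ Y) Z W).inv ≫ (α_ X Y Z).hom ▷ W ≫
    f ▷ W ≫ (α_ Z (Y ⊗ X) W).hom ≫ Z ◁ (α_ Y X W).hom) (BraidedCategory.yang_baxter X Y Z).symm
  simp only [comp_whiskerRight, Category.assoc] at h
  refine Eq.trans ?_ (h.trans ?_) <;> simp only [sw] <;> monoidal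

/-- The identity permutation. -/
def Code.refl : ∀ l : List ι, Code l l
  | [] => .nil
  | _ :: l => .cons (.head _) (refl l)

theorem Code.refl_hom (x : ι → C) (l : List ι) : (Code.refl l).hom x = 𝟙 _ := by
  induction l with
  | nil => rfl
  | cons i l ih => simp [Code.refl, Code.hom, ih, Ins.hom, tens]

theorem code_of_eq {l l' : List ι} (h : l = l') :
    ∃ r : Code l l', ∀ x : ι → C, r.hom x = eqToHom (by rw [h]) := by
  subst h
  exact ⟨.refl l, fun x => by simp [Code.refl_hom]⟩

theorem ins_ins {i k : ι} {m m' l : List ι} (q : Ins k m l) (p : Ins i m' m) :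
    ∃ (n : List ι) (q' : Ins k m' n) (p' : Ins i n l), ∀ (x : ι → C),
      x i ◁ q'.hom x ≫ p'.hom x = sw (x i) (x k) _ ≫ x k ◁ p.hom x ≫ q.hom x := by
  induction q generalizing m' with
  | head m => exact ⟨_, .head _, .tail _ p, fun x => by simp [Ins.hom, tens]⟩
  | tail j q ih =>
    cases p with
    | head => exact ⟨_, q, .head _, fun x => by simp [Ins.hom, tens, reassoc_of% sw_sw]⟩
    | tail _ p =>
      obtain ⟨n, q', p', h⟩ := ih p
      refine ⟨_, .tail _ q', .tail _ p', fun x => ?_⟩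
      have := h x
      simp only [Ins.hom, tens, whiskerLeft_comp, Category.assoc]
      rw [reassoc_of% sw_natural_right, ← whiskerLeft_comp, h,
        reassoc_of% sw_natural_right]
      simp only [whiskerLeft_comp, reassoc_of% sw_yb]

theorem ins_code {i : ι} {l l' l'' : List ι} (p : Ins i l l') (q : Code l' l'') :
    ∃ (m : List ι) (q' : Code l m) (p' : Ins i m l''), ∀ (x : ι → C),
      p.hom x ≫ q.hom x = x i ◁ q'.hom x ≫ p'.hom x := by
  induction p generalizing l'' with
  | head l =>
    cases q with
    | cons p' q' => exact ⟨_, q', p', fun x => by simp [Ins.hom, Code.hom, tens]⟩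
  | tail k p ih =>
    cases q with
    | cons p' q' =>
      obtain ⟨m, r, s, h⟩ := ih q'
      obtain ⟨n, t, w, h'⟩ := ins_ins (C := C) p' s
      refine ⟨_, .cons t r, w, fun x => ?_⟩
      simp only [Ins.hom, Code.hom, tens, whiskerLeft_comp, Category.assoc, h']
      rw [← whiskerLeft_comp_assoc, h]
      simp [reassoc_of% sw_natural_right]

theorem code_comp {l l' l'' : List ι} (p : Code l l') (q : Code l' l'') :
    ∃ r : Code l l'', ∀ (x : ι → C), r.hom x = p.hom x ≫ q.hom x := by
  induction p generalizing l'' with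
  | nil => cases q; exact ⟨.nil, fun x => by simp [Code.hom, tens]⟩
  | cons p q' ih =>
    obtain ⟨m, r, s, h⟩ := ins_code (C := C) p q
    obtain ⟨t, ht⟩ := ih r
    refine ⟨.cons s t, fun x => ?_⟩
    simp only [Code.hom, tens, ht, Category.assoc, h, whiskerLeft_comp]

theorem ins_unique {i : ι} {m m' l : List ι} (p : Ins i m l) (q : Ins i m' l) (h : l.Nodup) :
    m = m' ∧ HEq p q := by
  induction p generalizing m' with
  | head l =>
    cases q with
    | head => exact ⟨rfl, HEq.rfl⟩
    | tail _ q =>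
      exfalso
      have : i ∈ l := by
        clear h
        induction q with
        | head => simp
        | tail k p ih => simp [ih]
      simp_all
  | @tail k m l p ih =>
    cases q with
    | head =>
      exfalso
      have : i ∈ l := by
        clear h ih
        induction p with
        | head => simp
        | tail k p ih => simp [ih]
      simp_all
    | tail _ q =>
      obtain ⟨rfl, h⟩ := ih q (List.nodup_cons.1 h).2
      cases h
      exact ⟨rfl, HEq.rfl⟩

theorem ins_perm {i : ι} {m l : List ι} (p : Ins i m l) : (i :: m).Perm l := by
  induction p with
  | head => exact .refl _
  | tail k p ih => exact (List.Perm.swap _ _ _).trans (ih.cons k)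

theorem code_unique {l l' : List ι} (p q : Code l l') (h : l'.Nodup) : p = q := by
  induction p with
  | nil => cases q; rfl
  | cons p p' ih =>
    cases q with
    | cons q q' =>
      obtain ⟨rfl, h'⟩ := ins_unique p q h
      cases h'
      rw [ih q' (List.nodup_cons.1 ((ins_perm p).nodup_iff.2 h)).2]

theorem exists_ins {i : ι} {l : List ι} (h : i ∈ l) : ∃ m, Nonempty (Ins i m l) := by
  induction l with
  | nil => simp at h
  | cons k l ih =>
    rcases List.mem_cons.1 h with rfl | h
    · exact ⟨_, ⟨.head _⟩⟩
    · obtain ⟨m, ⟨p⟩⟩ := ih h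
      exact ⟨_, ⟨.tail _ p⟩⟩

theorem exists_code {l l' : List ι} (h : l.Perm l') : Nonempty (Code l l') := by
  induction l generalizing l' with
  | nil => cases h.nil_eq; exact ⟨.nil⟩
  | cons i l ih =>
    obtain ⟨m, ⟨p⟩⟩ := exists_ins (h.mem_iff.1 (List.mem_cons_self (a := i)))
    obtain ⟨q⟩ := ih (l' := m) ((List.perm_cons i).1 (h.trans (ins_perm p).symm))
    exact ⟨.cons p q⟩

/-- A permutation from `l` to `l'`; it is unique if `l'` has no repetitions (`code_unique`). -/
noncomputable def Code.ofPerm {l l' : List ι} (h : l.Perm l') : Code l l' :=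
  (exists_code h).some

theorem ins_append {i : ι} {l l' : List ι} (p : Ins i l l') (b : List ι) :
    ∃ r : Ins i (l ++ b) (l' ++ b), ∀ x : ι → C, r.hom x ≫ (appIso x l' b).hom =
      x i ◁ (appIso x l b).hom ≫ (α_ _ _ _).inv ≫ p.hom x ▷ tens x b := by
  induction p with
  | head l => exact ⟨.head _, fun x => by simp [Ins.hom, appIso, tens]⟩
  | tail k p ih =>
    obtain ⟨r, hr⟩ := ih
    refine ⟨.tail _ r, fun x => ?_⟩
    simp only [Ins.hom, appIso, tens, List.cons_append, Iso.trans_hom, whiskerLeftIso_hom,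
      Iso.symm_hom, Category.assoc]
    rw [← whiskerLeft_comp_assoc, hr]
    simp only [whiskerLeft_comp, Category.assoc, ← reassoc_of% sw_natural_right]
    simp only [sw]
    monoidal

theorem code_append {a a' b b' : List ι} (p : Code a a') (q : Code b b') :
    ∃ r : Code (a ++ b) (a' ++ b'), ∀ x : ι → C, r.hom x ≫ (appIso x a' b').hom =
      (appIso x a b).hom ≫ (p.hom x ⊗ₘ q.hom x) := by
  induction p with
  | nil => exact ⟨q, fun x => by simp [Code.hom, appIso, tens]⟩
  | cons p p' ih =>
    obtain ⟨r, hr⟩ := ih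
    obtain ⟨s, hs⟩ := ins_append (C := C) p b'
    refine ⟨.cons s r, fun x => ?_⟩
    simp only [Code.hom, appIso, tens, List.cons_append, Iso.trans_hom, whiskerLeftIso_hom,
      Iso.symm_hom, Category.assoc, hs]
    rw [← whiskerLeft_comp_assoc, hr]
    simp only [MonoidalCategory.tensorHom_def, whiskerLeft_comp, comp_whiskerRight, Category.assoc]
    rw [← whisker_exchange]
    monoidal

theorem sw_tensor_mid (X Y Z W : C) :
    X ◁ (α_ Y Z W).inv ≫ sw X (Y ⊗ Z) W = sw X Y (Z ⊗ W) ≫ Y ◁ sw X Z W ≫ (α_ _ _ _).inv := by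
  simp only [sw, BraidedCategory.braiding_tensor_right_hom]
  monoidal

theorem ins_mid (i : ι) (b a : List ι) :
    ∃ r : Ins i (b ++ a) (b ++ i :: a), ∀ x : ι → C, r.hom x ≫ (appIso x b (i :: a)).hom =
      x i ◁ (appIso x b a).hom ≫ sw (x i) (tens x b) (tens x a) := by
  induction b with
  | nil => exact ⟨.head _, fun x => by simp [Ins.hom, appIso, tens, sw]⟩
  | cons k b ih =>
    obtain ⟨r, hr⟩ := ih
    refine ⟨.tail _ r, fun x => ?_⟩
    have h1 : (appIso x (k :: b) a).hom = x k ◁ (appIso x b a).hom ≫ (α_ _ _ _).inv := rfl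
    have h2 : (appIso x (k :: b) (i :: a)).hom =
      x k ◁ (appIso x b (i :: a)).hom ≫ (α_ _ _ _).inv := rfl
    simp only [h1, h2, Ins.hom, tens, List.cons_append, Category.assoc] at hr ⊢
    rw [← whiskerLeft_comp_assoc, hr, whiskerLeft_comp, whiskerLeft_comp, Category.assoc,
      Category.assoc, sw_tensor_mid, reassoc_of% sw_natural_right]
    rfl

theorem code_swap (a b : List ι) :
    ∃ r : Code (a ++ b) (b ++ a), ∀ x : ι → C, r.hom x ≫ (appIso x b a).hom =
      (appIso x a b).hom ≫ (β_ _ _).hom := by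
  induction a with
  | nil =>
    obtain ⟨r, hr⟩ := code_of_eq (C := C) (List.append_nil b).symm
    refine ⟨r, fun x => ?_⟩
    rw [hr, appIso_nil]
    simp [appIso]
  | cons i a ih =>
    obtain ⟨r, hr⟩ := ih
    obtain ⟨s, hs⟩ := ins_mid (C := C) i b a
    refine ⟨.cons s r, fun x => ?_⟩
    have h1 : (appIso x (i :: a) b).hom = x i ◁ (appIso x a b).hom ≫ (α_ _ _ _).inv := rfl
    simp only [Code.hom, h1, Category.assoc, hs, tens, List.cons_append]
    rw [← whiskerLeft_comp_assoc, hr]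
    simp only [sw, BraidedCategory.braiding_tensor_left_hom]
    monoidal

/-- Concatenation of the lists `f j`, `j ∈ l`. -/
@[reducible] def flat {κ : Type*} (f : κ → List ι) : List κ → List ι
  | [] => []
  | j :: l => f j ++ flat f l

theorem flat_append {κ : Type*} (f : κ → List ι) (a b : List κ) :
    flat f (a ++ b) = flat f a ++ flat f b := by
  induction a with
  | nil => rfl
  | cons j a ih => simp [flat, ih]

theorem flat_flat {κ μ : Type*} (f : κ → List ι) (g : μ → List κ) (l : List μ) :
    flat f (flat g l) = flat (fun k => flat f (g k)) l := by
  induction l with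
  | nil => rfl
  | cons j a ih => simp [flat, ih, flat_append]

/-- The associativity isomorphism from an iterated product to the product over the
concatenation. -/
def bindIso {κ : Type*} {C : Type u} [Category.{v} C] [MonoidalCategory C] (x : ι → C)
    (f : κ → List ι) : ∀ l : List κ, tens (fun j => tens x (f j)) l ≅ tens x (flat f l)
  | [] => Iso.refl _
  | j :: l => whiskerLeftIso _ (bindIso x f l) ≪≫ (appIso x (f j) (flat f l)).symm

variable {κ : Type*}

theorem bindIso_natural {x y : ι → C} (g : ∀ i, x i ⟶ y i) (f : κ → List ι) (l : List κ) :
    tensMap (fun j => tensMap g (f j)) l ≫ (bindIso y f l).hom =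
      (bindIso x f l).hom ≫ tensMap g (flat f l) := by
  induction l with
  | nil => simp [bindIso, tensMap]
  | cons j l ih =>
    have h := appIso_natural g (f j) (flat f l)
    have h1 : ∀ z : ι → C, (bindIso z f (j :: l)).hom =
      _ ◁ (bindIso z f l).hom ≫ (appIso z (f j) (flat f l)).inv := fun z => rfl
    rw [h1, h1, Category.assoc, ← cancel_mono (appIso y (f j) (flat f l)).hom]
    simp only [Category.assoc, Iso.inv_hom_id, Category.comp_id]
    erw [h]
    simp only [tensMap, Iso.inv_hom_id_assoc, MonoidalCategory.tensorHom_def, Category.assoc]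
    rw [← whiskerLeft_comp, ih, whiskerLeft_comp, whisker_exchange_assoc]

theorem code_bind_map {f f' : κ → List ι} (g : ∀ j, Code (f j) (f' j)) (l : List κ) :
    ∃ r : Code (flat f l) (flat f' l), ∀ x : ι → C,
      (bindIso x f l).hom ≫ r.hom x =
        tensMap (fun j => (g j).hom x) l ≫ (bindIso x f' l).hom := by
  induction l with
  | nil => exact ⟨.nil, fun x => by simp [bindIso, tensMap, Code.hom]⟩
  | cons j l ih =>
    obtain ⟨r, hr⟩ := ih
    obtain ⟨s, hs⟩ := code_append (C := C) (g j) r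
    refine ⟨s, fun x => ?_⟩
    have h1 : ∀ f : κ → List ι, (bindIso x f (j :: l)).hom =
      _ ◁ (bindIso x f l).hom ≫ (appIso x (f j) (flat f l)).inv := fun z => rfl
    rw [h1, h1, Category.assoc, ← cancel_mono (appIso x (f' j) (flat f' l)).hom]
    simp only [Category.assoc, Iso.inv_hom_id, Category.comp_id]
    erw [hs]
    simp only [tensMap, Iso.inv_hom_id_assoc, MonoidalCategory.tensorHom_def, Category.assoc]
    rw [← whiskerLeft_comp, ← hr, whiskerLeft_comp, whisker_exchange_assoc]

theorem ins_bind (f : κ → List ι) {j : κ} {l l' : List κ} (p : Ins j l l') :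
    ∃ r : Code (f j ++ flat f l) (flat f l'), ∀ x : ι → C,
      p.hom (fun j => tens x (f j)) ≫ (bindIso x f l').hom =
        tens x (f j) ◁ (bindIso x f l).hom ≫ (appIso x (f j) (flat f l)).inv ≫ r.hom x := by
  induction p with
  | head l => exact ⟨.refl _, fun x => by rw [Code.refl_hom]; simp [Ins.hom, bindIso]⟩
  | @tail k l l' p ih =>
    obtain ⟨r, hr⟩ := ih
    obtain ⟨a, ha⟩ := code_of_eq (C := C) (List.append_assoc (f j) (f k) (flat f l)).symm
    obtain ⟨b, hb⟩ := code_swap (C := C) (f j) (f k)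
    obtain ⟨c, hc⟩ := code_append (C := C) b (.refl (flat f l))
    obtain ⟨d, hd⟩ := code_of_eq (C := C) (List.append_assoc (f k) (f j) (flat f l))
    obtain ⟨e, he⟩ := code_append (C := C) (.refl (f k)) r
    obtain ⟨ac, hac⟩ := code_comp (C := C) a c
    obtain ⟨acd, hacd⟩ := code_comp (C := C) ac d
    obtain ⟨t, ht⟩ := code_comp (C := C) acd e
    refine ⟨t, fun x => ?_⟩
    have h1 : ∀ l, (bindIso x f (k :: l)).hom =
      _ ◁ (bindIso x f l).hom ≫ (appIso x (f k) (flat f l)).inv := fun z => rfl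
    have hb' := hb x
    have hc' := hc x
    have he' := he x
    rw [← Iso.eq_comp_inv, Category.assoc] at hb' hc' he'
    rw [Code.refl_hom] at hc' he'
    have ht' := ht x
    rw [hacd, hac, ha, hc', hd, he', hb'] at ht'
    simp only [tensorHom_id, id_tensorHom, comp_whiskerRight, Category.assoc,
      reassoc_of% eqToHom_appIso, reassoc_of% appIso_inv_eqToHom] at ht'
    rw [ht']
    simp only [Ins.hom, h1, Category.assoc]
    rw [← whiskerLeft_comp_assoc, hr]
    simp only [whiskerLeft_comp, Category.assoc, whiskerLeft_inv_hom_assoc, Iso.inv_hom_id_assoc,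
      inv_hom_whiskerRight_assoc]
    rw [← reassoc_of% sw_natural_right]
    simp only [sw, Category.assoc]

theorem code_bind (f : κ → List ι) {l l' : List κ} (p : Code l l') :
    ∃ r : Code (flat f l) (flat f l'), ∀ x : ι → C,
      (bindIso x f l).hom ≫ r.hom x = p.hom (fun j => tens x (f j)) ≫ (bindIso x f l').hom := by
  induction p with
  | nil => exact ⟨.nil, fun x => by simp [bindIso, Code.hom]⟩
  | @cons j l l' l'' p q ih =>
    obtain ⟨r, hr⟩ := ih
    obtain ⟨s, hs⟩ := ins_bind (C := C) f p
    obtain ⟨t, ht⟩ := code_append (C := C) (.refl (f j)) r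
    obtain ⟨w, hw⟩ := code_comp (C := C) t s
    refine ⟨w, fun x => ?_⟩
    have h1 : (bindIso x f (j :: l)).hom =
      _ ◁ (bindIso x f l).hom ≫ (appIso x (f j) (flat f l)).inv := rfl
    have h2 := ht x
    rw [← Iso.eq_comp_inv, Category.assoc, Code.refl_hom, id_tensorHom] at h2
    simp only [h1, Code.hom, Category.assoc, hs]
    rw [← whiskerLeft_comp_assoc, ← hr, whiskerLeft_comp_assoc]
    erw [hw, h2]
    simp

theorem bindIso_append (x : ι → C) (f : κ → List ι) (a b : List κ)
    (h : tens x (flat f (a ++ b)) = tens x (flat f a ++ flat f b)) :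
    (appIso (fun j => tens x (f j)) a b).hom ≫ ((bindIso x f a).hom ⊗ₘ (bindIso x f b).hom) =
      (bindIso x f (a ++ b)).hom ≫ eqToHom h ≫ (appIso x (flat f a) (flat f b)).hom := by
  induction a with
  | nil => simp [appIso, bindIso]
  | cons j a ih =>
    have h1 : ∀ l, (bindIso x f (j :: l)).hom =
      _ ◁ (bindIso x f l).hom ≫ (appIso x (f j) (flat f l)).inv := fun z => rfl
    have h2 : (appIso (fun j => tens x (f j)) (j :: a) b).hom =
      _ ◁ (appIso (fun j => tens x (f j)) a b).hom ≫ (α_ _ _ _).inv := rfl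
    have h3 : eqToHom h = eqToHom (congrArg (fun l => tens x (f j ++ l)) (flat_append _ _ _)) ≫
      eqToHom (congrArg (tens x) (List.append_assoc _ _ _).symm) := by
      rw [eqToHom_trans]
    have h4 := congrArg (fun t => tens x (f j) ◁ t) (ih (by rw [flat_append]))
    simp only [whiskerLeft_comp] at h4
    have h6 : (bindIso x f (j :: a ++ b)).hom = _ := h1 (a ++ b)
    rw [h3]
    simp only [h6, h1, h2, Category.assoc]
    rw [eqToHom_appIso, reassoc_of% appIso_inv_congr x (f j) (flat_append f (a) (b)), Iso.inv_hom_id_assoc, ← reassoc_of% h4]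
    simp only [MonoidalCategory.tensorHom_def, comp_whiskerRight, Category.assoc, whiskerLeft_comp]
    rw [← whisker_exchange]
    monoidal

theorem bindIso_assoc {μ : Type*} (x : ι → C) (f : κ → List ι) (g : μ → List κ) (l : List μ)
    (h : tens x (flat (fun k => flat f (g k)) l) = tens x (flat f (flat g l))) :
    (bindIso (fun j => tens x (f j)) g l).hom ≫ (bindIso x f (flat g l)).hom =
      tensMap (fun k => (bindIso x f (g k)).hom) l ≫
        (bindIso x (fun k => flat f (g k)) l).hom ≫ eqToHom h := by
  induction l with
  | nil => simp [bindIso, tensMap]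
  | cons k l ih =>
    have h1 : (bindIso x (fun k => flat f (g k)) (k :: l)).hom =
      _ ◁ (bindIso x (fun k => flat f (g k)) l).hom ≫ (appIso x _ _).inv := rfl
    have h2 : (bindIso (fun j => tens x (f j)) g (k :: l)).hom =
      _ ◁ (bindIso (fun j => tens x (f j)) g l).hom ≫ (appIso _ _ _).inv := rfl
    have h3 := bindIso_append x f (g k) (flat g l) (by rw [flat_append])
    have h5 : eqToHom h = eqToHom (congrArg (fun l => tens x (flat f (g k) ++ l))
        (flat_flat _ _ _).symm) ≫ eqToHom (congrArg (tens x) (flat_append _ _ _).symm) := by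
      rw [eqToHom_trans]
    have h4 := congrArg (fun t => tens x (flat f (g k)) ◁ t) (ih (by rw [flat_flat]))
    simp only [whiskerLeft_comp] at h4
    rw [← Iso.eq_inv_comp, ← cancel_mono (appIso x _ _).inv, Category.assoc, Category.assoc,
      Category.assoc, Iso.hom_inv_id, Category.comp_id, ← cancel_mono (eqToHom (congrArg (tens x)
        (flat_append f (g k) (flat g l)).symm))] at h3
    simp only [Category.assoc, eqToHom_trans, eqToHom_refl, Category.comp_id] at h3
    rw [h5]
    simp only [h1, h2, Category.assoc, ← h3]
    rw [reassoc_of% appIso_inv_congr x (flat f (g k)) (flat_flat f g l).symm]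
    simp only [tensMap, MonoidalCategory.tensorHom_def, Category.assoc, ← reassoc_of% h4]
    simp [whisker_exchange_assoc]

end

section

variable {ι : Type*} {C : Type u} [Category.{v} C] [MonoidalCategory C] [SymmetricCategory C]

/-- The functor sending a family `x` to the tensor product of the `x i`, `i ∈ l`. -/
@[simps]
def tensF (C : Type u) [Category.{v} C] [MonoidalCategory C] (l : List ι) : (ι → C) ⥤ C where
  obj x := tens x l
  map f := tensMap f l
  map_id x := tensMap_id x l
  map_comp f g := tensMap_comp f g l

/-- The interchange isomorphism `⊗ x ⊗ ⊗ y ≅ ⊗ (x ⊗ y)`. -/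
def tensMu (x y : ι → C) : ∀ l : List ι, tens x l ⊗ tens y l ⟶ tens (fun i => x i ⊗ y i) l
  | [] => (λ_ (𝟙_ C)).hom
  | i :: l => tensorμ (x i) (tens x l) (y i) (tens y l) ≫ (x i ⊗ y i) ◁ tensMu x y l

/-- The inverse of `tensMu`. -/
def tensDelta (x y : ι → C) : ∀ l : List ι, tens (fun i => x i ⊗ y i) l ⟶ tens x l ⊗ tens y l
  | [] => (λ_ (𝟙_ C)).inv
  | i :: l => (x i ⊗ y i) ◁ tensDelta x y l ≫ tensorδ (x i) (tens x l) (y i) (tens y l)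

/-- The isomorphism from the unit to a product of units. -/
def tensEps : ∀ l : List ι, 𝟙_ C ⟶ tens (fun _ => 𝟙_ C) l
  | [] => 𝟙 (𝟙_ C)
  | _ :: l => tensEps l ≫ (λ_ _).inv

/-- The inverse of `tensEps`. -/
def tensEta : ∀ l : List ι, tens (fun _ => 𝟙_ C) l ⟶ 𝟙_ C
  | [] => 𝟙 (𝟙_ C)
  | _ :: l => (λ_ _).hom ≫ tensEta l

theorem tensMu_delta (x y : ι → C) (l : List ι) : tensMu x y l ≫ tensDelta x y l = 𝟙 _ := by
  induction l with
  | nil => simp [tensMu, tensDelta]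
  | cons i l ih =>
    simp only [tensMu, tensDelta, Category.assoc]
    rw [← whiskerLeft_comp_assoc, ih]
    simp

theorem tensDelta_mu (x y : ι → C) (l : List ι) : tensDelta x y l ≫ tensMu x y l = 𝟙 _ := by
  induction l with
  | nil => simp [tensMu, tensDelta]
  | cons i l ih =>
    simp only [tensMu, tensDelta, Category.assoc, tensorδ_tensorμ_assoc]
    rw [← whiskerLeft_comp, ih]
    simp

theorem tensEps_eta (l : List ι) : tensEps l ≫ tensEta l = 𝟙 (𝟙_ C) := by
  induction l with
  | nil => simp [tensEps, tensEta]
  | cons i l ih => simp [tensEps, tensEta, ih]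

theorem tensEta_eps (l : List ι) : tensEta l ≫ tensEps l = 𝟙 (tens (fun _ => 𝟙_ C) l) := by
  induction l with
  | nil => simp [tensEps, tensEta]
  | cons i l ih => simp [tensEps, tensEta, reassoc_of% ih]

theorem tensMu_natural {x x' y y' : ι → C} (f : ∀ i, x i ⟶ x' i) (g : ∀ i, y i ⟶ y' i)
    (l : List ι) : (tensMap f l ⊗ₘ tensMap g l) ≫ tensMu x' y' l =
      tensMu x y l ≫ tensMap (fun i => f i ⊗ₘ g i) l := by
  induction l with
  | nil => simp [tensMu, tensMap]
  | cons i l ih =>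
    simp only [tensMu, tensMap, tensorμ_natural_assoc, Category.assoc]
    rw [← id_tensorHom, ← id_tensorHom, tensorHom_comp_tensorHom, tensorHom_comp_tensorHom, ih]
    simp

theorem tensMu_assoc (x y z : ι → C) (l : List ι) :
    tensMu x y l ▷ tens z l ≫ tensMu (fun i => x i ⊗ y i) z l ≫
      tensMap (fun i => (α_ (x i) (y i) (z i)).hom) l =
    (α_ _ _ _).hom ≫ tens x l ◁ tensMu y z l ≫ tensMu x (fun i => y i ⊗ z i) l := by
  induction l with
  | nil => simp [tensMu, tensMap]; monoidal
  | cons i l ih =>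
    have h := tensor_associativity (x i) (tens x l) (y i) (tens y l) (z i) (tens z l)
    simp only [tensMu, tensMap, Category.assoc, comp_whiskerRight, whiskerLeft_comp]
    have e1 := tensorμ_natural_left (𝟙 (x i ⊗ y i)) (tensMu x y l) (z i) (tens z l)
    have e2 := tensorμ_natural_right (x i) (tens x l) (𝟙 (y i ⊗ z i)) (tensMu y z l)
    rw [id_tensorHom] at e1 e2
    rw [reassoc_of% e1, reassoc_of% e2, ← reassoc_of% h]
    simp only [id_whiskerRight, whiskerLeft_id, ← id_tensorHom, tensorHom_comp_tensorHom,
      tensorHom_comp_tensorHom_assoc, id_tensorHom_id, Category.id_comp, Category.comp_id] at ih ⊢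
    rw [← ih]

theorem tensMu_left (x : ι → C) (l : List ι) :
    (λ_ (tens x l)).hom = tensEps l ▷ tens x l ≫ tensMu (fun _ => 𝟙_ C) x l ≫
      tensMap (fun i => (λ_ (x i)).hom) l := by
  induction l with
  | nil => simp [tensMu, tensMap, tensEps]
  | cons i l ih =>
    have h := tensor_left_unitality (x i) (tens x l)
    simp only [tensMu, tensMap, tensEps, Category.assoc, comp_whiskerRight] at h ⊢
    have e1 := tensorμ_natural_left (𝟙 (𝟙_ C)) (tensEps (C := C) l) (x i) (tens x l)
    rw [id_tensorHom] at e1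
    have e3 : tensEps l ▷ (x i ⊗ tens x l) ≫ (λ_ (tens (fun _ => 𝟙_ C) l)).inv ▷ (x i ⊗ tens x l) =
      (λ_ _).inv ▷ _ ≫ (𝟙_ C ◁ tensEps l) ▷ (x i ⊗ tens x l) := by
      rw [← comp_whiskerRight, ← comp_whiskerRight, leftUnitor_inv_naturality]
    rw [reassoc_of% e3, reassoc_of% e1, h, ih]
    simp only [id_whiskerRight, whiskerLeft_id, ← id_tensorHom, tensorHom_comp_tensorHom,
      tensorHom_comp_tensorHom_assoc, id_tensorHom_id, Category.id_comp, Category.comp_id, Category.assoc]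

theorem tensMu_right (x : ι → C) (l : List ι) :
    (ρ_ (tens x l)).hom = tens x l ◁ tensEps l ≫ tensMu x (fun _ => 𝟙_ C) l ≫
      tensMap (fun i => (ρ_ (x i)).hom) l := by
  induction l with
  | nil => simp [tensMu, tensMap, tensEps]; monoidal
  | cons i l ih =>
    have h := tensor_right_unitality (x i) (tens x l)
    simp only [tensMu, tensMap, tensEps, Category.assoc, whiskerLeft_comp] at h ⊢
    have e1 := tensorμ_natural_right (x i) (tens x l) (𝟙 (𝟙_ C)) (tensEps (C := C) l)
    rw [id_tensorHom] at e1
    have e3 : (x i ⊗ tens x l) ◁ tensEps l ≫ (x i ⊗ tens x l) ◁ (λ_ (tens (fun _ => 𝟙_ C) l)).inv =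
      _ ◁ (λ_ _).inv ≫ (x i ⊗ tens x l) ◁ (𝟙_ C ◁ tensEps l) := by
      rw [← whiskerLeft_comp, ← whiskerLeft_comp, leftUnitor_inv_naturality]
    rw [reassoc_of% e3, reassoc_of% e1, h, ih]
    simp only [id_whiskerRight, whiskerLeft_id, ← id_tensorHom, tensorHom_comp_tensorHom,
      tensorHom_comp_tensorHom_assoc, id_tensorHom_id, Category.id_comp, Category.comp_id, Category.assoc]

/-- In a symmetric monoidal category, `x ↦ ⊗ x i` is a strong monoidal functor. -/
instance tensMonoidal (l : List ι) : (tensF C l).Monoidal :=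
  Functor.CoreMonoidal.toMonoidal
    { εIso := ⟨tensEps l, tensEta l, tensEps_eta l, tensEta_eps l⟩
      μIso := fun x y => ⟨tensMu x y l, tensDelta x y l, tensMu_delta x y l, tensDelta_mu x y l⟩
      μIso_hom_natural_left := fun {x y} f z => by
        have := tensMu_natural f (fun i => 𝟙 (z i)) l
        rw [tensMap_id, tensorHom_id] at this
        simp only [tensorHom_id] at this
        exact this
      μIso_hom_natural_right := fun {x y} z f => by
        have := tensMu_natural (fun i => 𝟙 (z i)) f l
        rw [tensMap_id, id_tensorHom] at this
        simp only [id_tensorHom] at this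
        exact this
      associativity := fun x y z => tensMu_assoc x y z l
      left_unitality := fun x => tensMu_left x l
      right_unitality := fun x => tensMu_right x l }

theorem tensF_mu (l : List ι) (x y : ι → C) :
    Functor.LaxMonoidal.μ (tensF C l) x y = tensMu x y l := rfl

theorem tensF_eps (l : List ι) : Functor.LaxMonoidal.ε (tensF C l) = tensEps l := rfl

theorem braid_mu (X Y X' Y' : C) :
    tensorμ X Y X' Y' ≫ (β_ (X ⊗ X') (Y ⊗ Y')).hom =
      ((β_ X Y).hom ⊗ₘ (β_ X' Y').hom) ≫ tensorμ Y X Y' X' := by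
  simp [tensorμ, SymmetricCategory.braiding_swap_eq_inv_braiding Y X', MonoidalCategory.tensorHom_def]

theorem assoc_inv_mu (X Y Z X' Y' Z' : C) :
    tensorμ X (Y ⊗ Z) X' (Y' ⊗ Z') ≫ (X ⊗ X') ◁ tensorμ Y Z Y' Z' ≫ (α_ _ _ _).inv =
      ((α_ _ _ _).inv ⊗ₘ (α_ _ _ _).inv) ≫ tensorμ (X ⊗ Y) Z (X' ⊗ Y') Z' ≫
        tensorμ X Y X' Y' ▷ (Z ⊗ Z') := by
  have h1 := associator_monoidal X Y Z X' Y' Z'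
  rw [← cancel_mono (α_ _ _ _).hom]
  simp only [Category.assoc, Iso.inv_hom_id, Category.comp_id, h1, tensorHom_comp_tensorHom_assoc,
    id_tensorHom_id, Category.id_comp]

theorem sw_mu (X Y Z X' Y' Z' : C) :
    tensorμ X (Y ⊗ Z) X' (Y' ⊗ Z') ≫ (X ⊗ X') ◁ tensorμ Y Z Y' Z' ≫
      sw (X ⊗ X') (Y ⊗ Y') (Z ⊗ Z') =
    (sw X Y Z ⊗ₘ sw X' Y' Z') ≫ tensorμ Y (X ⊗ Z) Y' (X' ⊗ Z') ≫
      (Y ⊗ Y') ◁ tensorμ X Z X' Z' := by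
  have h2 := associator_monoidal Y X Z Y' X' Z'
  have h3 := braid_mu X Y X' Y'
  have h4 := tensorμ_natural (β_ X Y).hom (𝟙 Z) (β_ X' Y').hom (𝟙 Z')
  have h5 := assoc_inv_mu X Y Z X' Y' Z'
  simp only [sw, ← tensorHom_comp_tensorHom, Category.assoc, ← h2]
  rw [reassoc_of% h5]
  simp only [tensorHom_id, id_tensorHom, Category.assoc, ← comp_whiskerRight_assoc, h3] at h4 ⊢
  rw [reassoc_of% h4]
  simp

theorem ins_mu {i : ι} {l l' : List ι} (p : Ins i l l') (x y : ι → C) :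
    (p.hom x ⊗ₘ p.hom y) ≫ tensMu x y l' = tensMu x y (i :: l) ≫ p.hom (fun i => x i ⊗ y i) := by
  induction p with
  | head => simp [Ins.hom]
  | @tail k l l' p ih =>
    have h := sw_mu (x i) (x k) (tens x l) (y i) (y k) (tens y l)
    simp only [Ins.hom, tensMu, Category.assoc, ← tensorHom_comp_tensorHom, whiskerLeft_comp] at ih ⊢
    have e := sw_natural_right (x i ⊗ y i) (x k ⊗ y k) (tensMu x y l)
    rw [reassoc_of% e, reassoc_of% h, ← whiskerLeft_comp, ← whiskerLeft_comp,
      ← ih]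
    have e' := tensorμ_natural (𝟙 (x k)) (p.hom x) (𝟙 (y k)) (p.hom y)
    rw [id_tensorHom, id_tensorHom] at e'
    rw [reassoc_of% e']
    simp

theorem code_mu {l l' : List ι} (p : Code l l') (x y : ι → C) :
    (p.hom x ⊗ₘ p.hom y) ≫ tensMu x y l' = tensMu x y l ≫ p.hom (fun i => x i ⊗ y i) := by
  induction p with
  | nil => simp [Code.hom]
  | @cons i l l' l'' p q ih =>
    simp only [Code.hom, ← tensorHom_comp_tensorHom, Category.assoc, ins_mu, tensMu]
    have e' := tensorμ_natural (𝟙 (x i)) (q.hom x) (𝟙 (y i)) (q.hom y)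
    rw [id_tensorHom, id_tensorHom] at e'
    rw [reassoc_of% e']
    simp only [id_tensorHom, tensorHom_id, id_whiskerRight, ← whiskerLeft_comp_assoc, ih]

theorem sw_unit (Z : C) : sw (𝟙_ C) (𝟙_ C) Z = 𝟙 _ := by
  simp [sw, unitors_equal]

theorem ins_eps {i : ι} {l l' : List ι} (p : Ins i l l') :
    tensEps (i :: l) ≫ p.hom (fun _ => 𝟙_ C) = tensEps l' := by
  induction p with
  | head => simp [Ins.hom]
  | @tail k l l' p ih =>
    simp only [Ins.hom, tensEps, sw_unit, Category.assoc, Category.id_comp] at ih ⊢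
    rw [← leftUnitor_inv_naturality, ← ih]
    simp

theorem code_eps {l l' : List ι} (p : Code l l') :
    tensEps l ≫ p.hom (fun _ => 𝟙_ C) = tensEps l' := by
  induction p with
  | nil => simp [Code.hom]
  | @cons i l l' l'' p q ih =>
    simp only [Code.hom, tensEps, Category.assoc, ← leftUnitor_inv_naturality_assoc]
    rw [reassoc_of% ih, ← ins_eps p]
    simp [tensEps]

theorem ins_natural {x y : ι → C} (f : ∀ i, x i ⟶ y i) {i : ι} {l l' : List ι} (p : Ins i l l') :
    p.hom x ≫ tensMap f l' = tensMap f (i :: l) ≫ p.hom y := by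
  induction p with
  | head => simp [Ins.hom]
  | @tail k l l' p ih =>
    simp only [Ins.hom, tensMap, Category.assoc] at ih ⊢
    rw [reassoc_of% sw_natural, ← id_tensorHom, ← id_tensorHom, tensorHom_comp_tensorHom,
      tensorHom_comp_tensorHom, ih]
    simp

theorem code_natural {x y : ι → C} (f : ∀ i, x i ⟶ y i) {l l' : List ι} (p : Code l l') :
    p.hom x ≫ tensMap f l' = tensMap f l ≫ p.hom y := by
  induction p with
  | nil => simp [Code.hom, tensMap]
  | cons p q ih =>
    simp only [Code.hom, Category.assoc, ins_natural]
    simp only [tensMap]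
    rw [← id_tensorHom, ← id_tensorHom, tensorHom_comp_tensorHom_assoc,
      tensorHom_comp_tensorHom_assoc, ih]
    simp

theorem appIso_mu (x y : ι → C) (a b : List ι) :
    tensMu x y (a ++ b) ≫ (appIso (fun i => x i ⊗ y i) a b).hom =
      ((appIso x a b).hom ⊗ₘ (appIso y a b).hom) ≫ tensorμ _ _ _ _ ≫
        (tensMu x y a ⊗ₘ tensMu x y b) := by
  induction a with
  | nil =>
    have h := leftUnitor_monoidal (tens x b) (tens y b)
    simp only [appIso, tens, tensMu, List.nil_append, Iso.symm_hom]
    have e : ((λ_ (tens x b)).hom ⊗ₘ (λ_ (tens y b)).hom) ≫ ((λ_ (tens x b)).inv ⊗ₘ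
        (λ_ (tens y b)).inv) = 𝟙 _ := by
      rw [tensorHom_comp_tensorHom, Iso.hom_inv_id, Iso.hom_inv_id, id_tensorHom_id]
    rw [← cancel_mono (λ_ _).hom, ← cancel_epi ((λ_ _).hom ⊗ₘ (λ_ _).hom)]
    simp only [Category.assoc]
    rw [reassoc_of% e, h]
    simp only [Category.assoc, MonoidalCategory.tensorHom_def, leftUnitor_naturality,
      Iso.inv_hom_id, Category.comp_id]
  | cons i a ih =>
    have h5 := assoc_inv_mu (x i) (tens x a) (tens x b) (y i) (tens y a) (tens y b)
    have e' := tensorμ_natural (𝟙 (x i)) (appIso x a b).hom (𝟙 (y i)) (appIso y a b).hom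
    have e2 := associator_inv_naturality (𝟙 (x i ⊗ y i)) (tensMu x y a) (tensMu x y b)
    simp only [id_tensorHom, tensorHom_id, id_whiskerRight] at e' e2
    simp only [appIso, List.cons_append, tensMu, Iso.trans_hom, whiskerLeftIso_hom, Iso.symm_hom,
      Category.assoc] at ih ⊢
    rw [← whiskerLeft_comp_assoc, ih]
    simp only [whiskerLeft_comp, Category.assoc, ← tensorHom_comp_tensorHom]
    rw [e2, ← reassoc_of% e', reassoc_of% h5]
    simp only [← tensorHom_id, tensorHom_comp_tensorHom, Category.id_comp]

theorem appIso_eps (a b : List ι) :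
    tensEps (a ++ b) ≫ (appIso (fun _ => 𝟙_ C) a b).hom =
      (λ_ (𝟙_ C)).inv ≫ (tensEps a ⊗ₘ tensEps b) := by
  induction a with
  | nil => simp [appIso, tensEps, MonoidalCategory.tensorHom_def]
  | cons i a ih =>
    simp only [appIso, List.cons_append, tensEps, Iso.trans_hom, whiskerLeftIso_hom, Iso.symm_hom,
      Category.assoc]
    rw [← leftUnitor_inv_naturality_assoc, reassoc_of% ih]
    change _ = (λ_ (𝟙_ C)).inv ≫ ((tensEps a ≫ (λ_ (tens (fun _ => 𝟙_ C) a)).inv) ⊗ₘ tensEps b)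
    have e := tensorHom_comp_tensorHom (tensEps (C := C) a) (tensEps b) (λ_ _).inv (𝟙 _)
    rw [Category.comp_id] at e
    rw [← e]
    monoidal

variable {κ : Type*}

theorem bindIso_mu (x y : ι → C) (f : κ → List ι) (l : List κ) :
    ((bindIso x f l).hom ⊗ₘ (bindIso y f l).hom) ≫ tensMu x y (flat f l) =
      tensMu (fun j => tens x (f j)) (fun j => tens y (f j)) l ≫
        tensMap (fun j => tensMu x y (f j)) l ≫ (bindIso (fun i => x i ⊗ y i) f l).hom := by
  induction l with
  | nil => simp [bindIso, tensMap, tensMu]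
  | cons j l ih =>
    have h1 : ∀ z : ι → C, (bindIso z f (j :: l)).hom =
      (𝟙 _ ⊗ₘ (bindIso z f l).hom) ≫ (appIso z (f j) (flat f l)).inv := fun z => by
        rw [id_tensorHom]; rfl
    have h := appIso_mu x y (f j) (flat f l)
    have e := tensorHom_comp_tensorHom (appIso x (f j) (flat f l)).inv (appIso y (f j) (flat f l)).inv
      (appIso x (f j) (flat f l)).hom (appIso y (f j) (flat f l)).hom
    rw [Iso.inv_hom_id, Iso.inv_hom_id, id_tensorHom_id] at e
    rw [h1, h1, h1, ← cancel_mono (appIso _ (f j) (flat f l)).hom]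
    simp only [Category.assoc, Iso.inv_hom_id, Category.comp_id, ← tensorHom_comp_tensorHom]
    erw [h]
    rw [reassoc_of% e, tensorμ_natural_assoc]
    simp only [tensMu, tensMap, Category.assoc, ← id_tensorHom, tensorHom_comp_tensorHom,
      id_tensorHom_id, Category.id_comp, Category.comp_id] at ih ⊢
    rw [ih]

theorem bindIso_eps (f : κ → List ι) (l : List κ) :
    tensEps l ≫ tensMap (fun j => tensEps (f j)) l ≫ (bindIso (fun _ => 𝟙_ C) f l).hom =
      tensEps (flat f l) := by
  induction l with
  | nil => simp [bindIso, tensMap, tensEps]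
  | cons j l ih =>
    have h1 : (bindIso (fun _ => 𝟙_ C) f (j :: l)).hom =
      (𝟙 _ ⊗ₘ (bindIso (fun _ => 𝟙_ C) f l).hom) ≫ (appIso _ (f j) (flat f l)).inv := by
        rw [id_tensorHom]; rfl
    have h := appIso_eps (C := C) (f j) (flat f l)
    rw [h1, ← cancel_mono (appIso _ (f j) (flat f l)).hom]
    simp only [Category.assoc, Iso.inv_hom_id, Category.comp_id]
    erw [h]
    rw [← ih]
    simp only [tensEps, tensMap, Category.assoc, tensorHom_comp_tensorHom, Category.comp_id]
    have e := tensorHom_comp_tensorHom (𝟙 (𝟙_ C)) (tensEps (C := C) l) (tensEps (f j))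
      (tensMap (fun j => tensEps (f j)) l ≫ (bindIso (fun _ => 𝟙_ C) f l).hom)
    rw [Category.id_comp, id_tensorHom] at e
    rw [← e, leftUnitor_inv_naturality_assoc]

end

section

/-- Strict monoidal categories, equivalently 2-categories with one object. With strong monoidal
functors and monoidal transformations they form a 2-category, which is the full sub-2-category on
the one-object 2-categories of the 2-category of 2-categories, pseudofunctors and icons. -/
structure StMonCat where
  carrier : Type u
  [cat : Category.{v} carrier]
  [mon : MonoidalCategory carrier]
  [strict : StrictMonoidal carrier]

namespace StMonCat

attribute [instance] StMonCat.cat StMonCat.mon StMonCat.strict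

/-- A strong monoidal functor. -/
structure Hom (A B : StMonCat.{v, u}) where
  functor : A.carrier ⥤ B.carrier
  [monoidal : functor.Monoidal]

attribute [instance] Hom.monoidal

/-- A monoidal natural transformation. -/
structure Hom₂ {A B : StMonCat.{v, u}} (F G : Hom A B) where
  nat : F.functor ⟶ G.functor
  [isMonoidal : NatTrans.IsMonoidal nat]

attribute [instance] Hom₂.isMonoidal

theorem Hom₂.ext' {A B : StMonCat.{v, u}} {F G : Hom A B} {s t : Hom₂ F G}
    (h : ∀ x, s.nat.app x = t.nat.app x) : s = t := by
  obtain ⟨s⟩ := s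
  obtain ⟨t⟩ := t
  obtain rfl : s = t := by ext x; exact h x
  rfl

instance (A B : StMonCat.{v, u}) : Category (Hom A B) where
  Hom F G := Hom₂ F G
  id F := ⟨𝟙 F.functor⟩
  comp s t := ⟨s.nat ≫ t.nat⟩
  id_comp s := Hom₂.ext' fun x => Category.id_comp _
  comp_id s := Hom₂.ext' fun x => Category.comp_id _
  assoc s t r := Hom₂.ext' fun x => Category.assoc _ _ _

/-- A monoidal natural isomorphism as an isomorphism of 1-cells. -/
def isoMk {A B : StMonCat.{v, u}} {F G : Hom A B} (e : F.functor ≅ G.functor)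
    (_ : NatTrans.IsMonoidal e.hom) : F ≅ G where
  hom := Hom₂.mk e.hom
  inv := Hom₂.mk e.inv
  hom_inv_id := Hom₂.ext' fun x => e.hom_inv_id_app x
  inv_hom_id := Hom₂.ext' fun x => e.inv_hom_id_app x

def Hom.id (A : StMonCat.{v, u}) : Hom A A := ⟨𝟭 A.carrier⟩

def Hom.comp {A B D : StMonCat.{v, u}} (F : Hom A B) (G : Hom B D) : Hom A D :=
  ⟨F.functor ⋙ G.functor⟩

def Hom₂.whiskerLeft {A B D : StMonCat.{v, u}} (F : Hom A B) {G H : Hom B D} (t : G ⟶ H) :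
    F.comp G ⟶ F.comp H :=
  Hom₂.mk (isMonoidal := by
    have := Hom₂.isMonoidal t
    exact inferInstanceAs (NatTrans.IsMonoidal (Functor.whiskerLeft F.functor (Hom₂.nat t))))
    (Functor.whiskerLeft F.functor (Hom₂.nat t))

def Hom₂.whiskerRight {A B D : StMonCat.{v, u}} {F G : Hom A B} (t : F ⟶ G) (H : Hom B D) :
    F.comp H ⟶ G.comp H :=
  Hom₂.mk (isMonoidal := by
    have := Hom₂.isMonoidal t
    exact inferInstanceAs (NatTrans.IsMonoidal (Functor.whiskerRight (Hom₂.nat t) H.functor)))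
    (Functor.whiskerRight (Hom₂.nat t) H.functor)

def associatorIso {A B D E : StMonCat.{v, u}} (F : Hom A B) (G : Hom B D) (H : Hom D E) :
    (F.comp G).comp H ≅ F.comp (G.comp H) :=
  isoMk (F := (F.comp G).comp H) (G := F.comp (G.comp H))
    (Functor.associator F.functor G.functor H.functor)
    (inferInstance : NatTrans.IsMonoidal (Functor.associator F.functor G.functor H.functor).hom)

def leftUnitorIso {A B : StMonCat.{v, u}} (F : Hom A B) : (Hom.id A).comp F ≅ F :=
  isoMk (F := (Hom.id A).comp F) (G := F) (Functor.leftUnitor F.functor)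
    (inferInstance : NatTrans.IsMonoidal (F₁ := 𝟭 A.carrier ⋙ F.functor)
      (Functor.leftUnitor F.functor).hom)

def rightUnitorIso {A B : StMonCat.{v, u}} (F : Hom A B) : F.comp (Hom.id B) ≅ F :=
  isoMk (F := F.comp (Hom.id B)) (G := F) (Functor.rightUnitor F.functor)
    (inferInstance : NatTrans.IsMonoidal (F₁ := F.functor ⋙ 𝟭 B.carrier)
      (Functor.rightUnitor F.functor).hom)

instance bicat : Bicategory StMonCat.{v, u} where
  Hom A B := Hom A B
  id A := Hom.id A
  comp F G := F.comp G
  whiskerLeft F _ _ t := Hom₂.whiskerLeft F t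
  whiskerRight t F := Hom₂.whiskerRight t F
  associator F G H := associatorIso F G H
  leftUnitor F := leftUnitorIso F
  rightUnitor F := rightUnitorIso F
  whiskerLeft_id _ _ := Hom₂.ext' fun x => rfl
  whiskerLeft_comp _ _ _ _ _ _ := Hom₂.ext' fun x => rfl
  id_whiskerLeft _ := Hom₂.ext' fun x => ((Category.id_comp _).trans (Category.comp_id _)).symm
  comp_whiskerLeft _ _ _ _ _ :=
    Hom₂.ext' fun x => ((Category.id_comp _).trans (Category.comp_id _)).symm
  id_whiskerRight F G := Hom₂.ext' fun x => G.functor.map_id _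
  comp_whiskerRight s t G := Hom₂.ext' fun x => G.functor.map_comp _ _
  whiskerRight_id s := Hom₂.ext' fun x => ((Category.id_comp _).trans (Category.comp_id _)).symm
  whiskerRight_comp _ _ _ :=
    Hom₂.ext' fun x => ((Category.id_comp _).trans (Category.comp_id _)).symm
  whisker_assoc _ _ _ _ _ :=
    Hom₂.ext' fun x => ((Category.id_comp _).trans (Category.comp_id _)).symm
  whisker_exchange s t := Hom₂.ext' fun x => ((Hom₂.nat t).naturality _).symm
  pentagon F G H K := by
    refine Hom₂.ext' fun x => ?_
    change K.functor.map (𝟙 _) ≫ 𝟙 _ ≫ 𝟙 _ = 𝟙 _ ≫ 𝟙 _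
    simp
  triangle F G := by
    refine Hom₂.ext' fun x => ?_
    change 𝟙 _ ≫ 𝟙 _ = G.functor.map (𝟙 _)
    simp

/-- Forgetting the monoidal structures. -/
def forget : Pseudofunctor StMonCat.{v, u} Cat.{v, u} where
  obj A := Cat.of A.carrier
  map F := F.functor.toCatHom
  map₂ t := (Hom₂.nat t).toCatHom₂
  mapId A := Iso.refl (𝟭 A.carrier).toCatHom
  mapComp F G := Iso.refl (F.functor ⋙ G.functor).toCatHom
  map₂_id _ := rfl
  map₂_comp _ _ := rfl
  map₂_whisker_left F G H t := by
    ext x; exact ((Category.id_comp _).trans (Category.comp_id _)).symm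
  map₂_whisker_right t F := by
    ext x; exact ((Category.id_comp _).trans (Category.comp_id _)).symm
  map₂_associator F G H := by
    ext x
    change 𝟙 _ = 𝟙 _ ≫ H.functor.map (𝟙 _) ≫ 𝟙 _ ≫ 𝟙 _ ≫ 𝟙 _
    simp
  map₂_left_unitor F := by
    ext x
    change 𝟙 _ = 𝟙 _ ≫ F.functor.map (𝟙 _) ≫ 𝟙 _
    rw [Category.id_comp, Category.comp_id]
    exact (F.functor.map_id x).symm
  map₂_right_unitor F := by
    ext x
    change 𝟙 _ = 𝟙 _ ≫ 𝟙 _ ≫ 𝟙 _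
    simp

end StMonCat

end

section

/-- The skeletal category of finite pointed sets `m₊ = {*, 1, …, m}`; the base point is `none`. -/
structure FinPt where
  size : ℕ

namespace FinPt

instance : Category FinPt where
  Hom m n := {f : Option (Fin m.size) → Option (Fin n.size) // f none = none}
  id m := ⟨id, rfl⟩
  comp f g := ⟨g.1 ∘ f.1, by rw [Function.comp_apply, f.2, g.2]⟩

/-- The fibre of `φ` over the non-basepoint element `j`, listed increasingly. -/
def fib {m n : FinPt} (φ : m ⟶ n) (j : Fin n.size) : List (Fin m.size) :=
  (List.finRange m.size).filter fun i => φ.1 (some i) = some j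

theorem mem_fib {m n : FinPt} (φ : m ⟶ n) (j : Fin n.size) (i : Fin m.size) :
    i ∈ fib φ j ↔ φ.1 (some i) = some j := by
  simp [fib]

theorem fib_nodup {m n : FinPt} (φ : m ⟶ n) (j : Fin n.size) : (fib φ j).Nodup :=
  (List.nodup_finRange _).filter _

end FinPt

open FinPt

theorem mem_flat {ι κ : Type*} (f : κ → List ι) (l : List κ) (i : ι) :
    i ∈ flat f l ↔ ∃ j ∈ l, i ∈ f j := by
  induction l with
  | nil => simp [flat]
  | cons j l ih => simp [flat, ih]

theorem flat_nodup {ι κ : Type*} (f : κ → List ι) (l : List κ) (hl : l.Nodup)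
    (hf : ∀ j, (f j).Nodup) (h : ∀ j j' i, i ∈ f j → i ∈ f j' → j = j') : (flat f l).Nodup := by
  induction l with
  | nil => simp [flat]
  | cons j l ih =>
    rw [List.nodup_cons] at hl
    refine List.nodup_append.2 ⟨hf j, ih hl.2, ?_⟩
    rintro i hi _ hi' rfl
    obtain ⟨j', hj', hi'⟩ := (mem_flat _ _ _).1 hi'
    exact hl.1 (h _ _ _ hi hi' ▸ hj')

theorem fib_comp_perm {m n p : FinPt} (φ : m ⟶ n) (ψ : n ⟶ p) (k : Fin p.size) :
    (fib (φ ≫ ψ) k).Perm (flat (fib φ) (fib ψ k)) := by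
  refine (List.perm_ext_iff_of_nodup (fib_nodup _ _) (flat_nodup _ _ (fib_nodup _ _)
    (fib_nodup _) ?_)).2 ?_
  · intro j j' i hj hj'
    rw [mem_fib] at hj hj'
    simpa using hj.symm.trans hj'
  · intro i
    simp only [mem_flat, mem_fib]
    change ψ.1 (φ.1 (some i)) = some k ↔ _
    constructor
    · intro h
      cases hj : φ.1 (some i) with
      | none => rw [hj, ψ.2] at h; cases h
      | some j => exact ⟨j, hj ▸ h, rfl⟩
    · rintro ⟨j, hj, hi⟩
      rw [hi, hj]

theorem fib_id_perm {m : FinPt} (j : Fin m.size) : (fib (𝟙 m) j).Perm [j] := by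
  refine (List.perm_ext_iff_of_nodup (fib_nodup _ _) (List.nodup_singleton j)).2 fun i => ?_
  rw [mem_fib]
  change some i = some j ↔ _
  simp

instance piStrict {ι : Type} (C : Type u) [Category.{v} C] [MonoidalCategory C]
    [StrictMonoidal C] : StrictMonoidal (ι → C) where
  tensor_assoc X Y Z := funext fun i => StrictMonoidal.tensor_assoc _ _ _
  unit_tensor X := funext fun i => StrictMonoidal.unit_tensor _
  tensor_unit X := funext fun i => StrictMonoidal.tensor_unit _
  associator_hom X Y Z := by
    ext i
    rw [Functor.eqToHom_proj]
    exact StrictMonoidal.associator_hom _ _ _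
  leftUnitor_hom X := by
    ext i
    rw [Functor.eqToHom_proj]
    exact StrictMonoidal.leftUnitor_hom _
  rightUnitor_hom X := by
    ext i
    rw [Functor.eqToHom_proj]
    exact StrictMonoidal.rightUnitor_hom _

section

variable {C : Type u} [Category.{v} C] [MonoidalCategory C] [SymmetricCategory C]
variable {ι κ : Type*}

theorem Code.perm {l l' : List ι} (p : Code l l') : l.Perm l' := by
  induction p with
  | nil => exact .refl _
  | cons p q ih => exact (ih.cons _).trans (ins_perm p)

theorem tensMap_congr {x y : ι → C} {f g : ∀ i, x i ⟶ y i} (h : ∀ i, f i = g i) (l : List ι) :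
    tensMap f l = tensMap g l := by
  rw [funext h]

theorem bindIso_inv_natural {x y : ι → C} (g : ∀ i, x i ⟶ y i) (f : κ → List ι) (l : List κ) :
    tensMap g (flat f l) ≫ (bindIso y f l).inv =
      (bindIso x f l).inv ≫ tensMap (fun j => tensMap g (f j)) l := by
  rw [Iso.comp_inv_eq, Category.assoc, bindIso_natural, Iso.inv_hom_id_assoc]

/-- The isomorphism that permutes the factors; it is determined by the symmetry. -/
noncomputable def permIso (x : ι → C) {l l' : List ι} (h : l.Perm l') (hl : l'.Nodup) :
    tens x l ≅ tens x l' where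
  hom := (Code.ofPerm h).hom x
  inv := (Code.ofPerm h.symm).hom x
  hom_inv_id := by
    obtain ⟨r, hr⟩ := code_comp (C := C) (Code.ofPerm h) (Code.ofPerm h.symm)
    rw [← hr, code_unique r (.refl l) (h.nodup_iff.2 hl), Code.refl_hom]
  inv_hom_id := by
    obtain ⟨r, hr⟩ := code_comp (C := C) (Code.ofPerm h.symm) (Code.ofPerm h)
    rw [← hr, code_unique r (.refl l') hl, Code.refl_hom]

theorem permIso_eq (x : ι → C) {l l' : List ι} (h : l.Perm l') (hl : l'.Nodup) (r : Code l l') :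
    (permIso x h hl).hom = r.hom x := by
  rw [code_unique r (Code.ofPerm h) hl]
  rfl

theorem permIso_eq_inv (x : ι → C) {l l' : List ι} (h : l.Perm l') (hl : l'.Nodup)
    (r : Code l' l) : (permIso x h hl).inv = r.hom x := by
  rw [code_unique r (Code.ofPerm h.symm) (h.nodup_iff.2 hl)]
  rfl

/-- The functor `C^m ⥤ C^n` induced by `φ`: the `j`-th coordinate of the image is the tensor
product of the coordinates in the fibre of `φ` over `j`, in increasing order. -/
abbrev pushF (C : Type u) [Category.{v} C] [MonoidalCategory C]
    {m n : FinPt} (φ : m ⟶ n) : (Fin m.size → C) ⥤ (Fin n.size → C) :=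
  Functor.pi' fun j => tensF C (fib φ j)

/-- The symmetry isomorphism `(φ ≫ ψ)_* ≅ φ_* ⋙ ψ_*`. -/
noncomputable def pushComp {m n p : FinPt} (φ : m ⟶ n) (ψ : n ⟶ p) :
    pushF C (φ ≫ ψ) ≅ pushF C φ ⋙ pushF C ψ :=
  NatIso.ofComponents (fun x => Pi.isoMk fun k =>
      permIso x (fib_comp_perm φ ψ k) ((fib_comp_perm φ ψ k).nodup_iff.1 (fib_nodup _ _)) ≪≫
        (bindIso x (fib φ) (fib ψ k)).symm) (by
    intro x y f
    ext k
    change tensMap f _ ≫ (Code.ofPerm (fib_comp_perm φ ψ k)).hom y ≫ (bindIso y _ _).inv =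
      ((Code.ofPerm (fib_comp_perm φ ψ k)).hom x ≫ (bindIso x _ _).inv) ≫
        tensMap (fun j => tensMap f (fib φ j)) (fib ψ k)
    rw [← reassoc_of% code_natural, Category.assoc, bindIso_inv_natural])

/-- The isomorphism `(𝟙 m)_* ≅ 𝟭`. -/
noncomputable def pushId (m : FinPt) : pushF C (𝟙 m) ≅ 𝟭 (Fin m.size → C) :=
  NatIso.ofComponents (fun x => Pi.isoMk fun j =>
      permIso x (fib_id_perm j) (List.nodup_singleton j) ≪≫ ρ_ (x j)) (by
    intro x y f
    ext j
    change tensMap f _ ≫ (Code.ofPerm (fib_id_perm j)).hom y ≫ (ρ_ _).hom =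
      ((Code.ofPerm (fib_id_perm j)).hom x ≫ (ρ_ _).hom) ≫ f j
    rw [← reassoc_of% code_natural]
    simp [tensMap])

instance pushComp_isMonoidal {m n p : FinPt} (φ : m ⟶ n) (ψ : n ⟶ p) :
    NatTrans.IsMonoidal (pushComp (C := C) φ ψ).hom where
  unit := by
    ext k
    change tensEps _ ≫ (Code.ofPerm (fib_comp_perm φ ψ k)).hom _ ≫ (bindIso _ _ _).inv =
      tensEps _ ≫ tensMap (fun j => tensEps (fib φ j)) (fib ψ k)
    rw [reassoc_of% code_eps, Iso.comp_inv_eq, Category.assoc]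
    exact (bindIso_eps (C := C) (fib φ) (fib ψ k)).symm
  tensor x y := by
    ext k
    change tensMu x y _ ≫ (Code.ofPerm (fib_comp_perm φ ψ k)).hom _ ≫ (bindIso _ _ _).inv =
      ((Code.ofPerm (fib_comp_perm φ ψ k)).hom x ≫ (bindIso _ _ _).inv ⊗ₘ
        (Code.ofPerm (fib_comp_perm φ ψ k)).hom y ≫ (bindIso _ _ _).inv) ≫
      tensMu (fun j => tens x (fib φ j)) (fun j => tens y (fib φ j)) (fib ψ k) ≫
        tensMap (fun j => tensMu x y (fib φ j)) (fib ψ k)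
    have h := bindIso_mu x y (fib φ) (fib ψ k)
    rw [← Category.assoc, Iso.comp_inv_eq]
    erw [← code_mu]
    simp only [Category.assoc]
    erw [← h]
    rw [tensorHom_comp_tensorHom_assoc]
    simp

instance pushId_isMonoidal (m : FinPt) : NatTrans.IsMonoidal (pushId (C := C) m).hom where
  unit := by
    ext j
    change tensEps _ ≫ (Code.ofPerm (fib_id_perm j)).hom _ ≫ (ρ_ _).hom = 𝟙 _
    rw [reassoc_of% code_eps]
    change (𝟙 _ ≫ (λ_ (𝟙_ C)).inv) ≫ (ρ_ (𝟙_ C)).hom = 𝟙 _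
    rw [Category.id_comp, ← unitors_equal, Iso.inv_hom_id]
  tensor x y := by
    ext j
    change tensMu x y _ ≫ (Code.ofPerm (fib_id_perm j)).hom _ ≫ (ρ_ _).hom =
      ((Code.ofPerm (fib_id_perm j)).hom x ≫ (ρ_ _).hom ⊗ₘ
        (Code.ofPerm (fib_id_perm j)).hom y ≫ (ρ_ _).hom) ≫ 𝟙 _
    have h := rightUnitor_monoidal (x j) (y j)
    erw [← reassoc_of% code_mu]
    rw [← tensorHom_comp_tensorHom, Category.assoc, h]
    simp [tensMu]

theorem pushComp_assoc {m n p q : FinPt} (φ : m ⟶ n) (ψ : n ⟶ p) (χ : p ⟶ q)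
    (x : Fin m.size → C) :
    (pushComp (φ ≫ ψ) χ).hom.app x ≫ (pushF C χ).map ((pushComp φ ψ).hom.app x) =
      (pushComp φ (ψ ≫ χ)).hom.app x ≫ (pushComp ψ χ).hom.app ((pushF C φ).obj x) := by
  ext k
  obtain ⟨r, hr⟩ := code_bind_map (C := C) (fun j => Code.ofPerm (fib_comp_perm φ ψ j)) (fib χ k)
  obtain ⟨r', hr'⟩ := code_of_eq (C := C) (flat_flat (fib φ) (fib ψ) (fib χ k)).symm
  obtain ⟨r'', hr''⟩ := code_comp (C := C) r r'
  obtain ⟨a, ha⟩ := code_comp (C := C) (Code.ofPerm (fib_comp_perm (φ ≫ ψ) χ k)) r''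
  obtain ⟨s, hs⟩ := code_bind (C := C) (fib φ) (Code.ofPerm (fib_comp_perm ψ χ k))
  obtain ⟨b, hb⟩ := code_comp (C := C) (Code.ofPerm (fib_comp_perm φ (ψ ≫ χ) k)) s
  have hab : a = b := by
    refine code_unique a b ((a.perm.nodup_iff).1 (fib_nodup _ _))
  have h := bindIso_assoc x (fib φ) (fib ψ) (fib χ k) (by rw [flat_flat])
  change ((Code.ofPerm (fib_comp_perm (φ ≫ ψ) χ k)).hom x ≫
    (bindIso x (fib (φ ≫ ψ)) (fib χ k)).inv) ≫ tensMap (fun j =>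
      (Code.ofPerm (fib_comp_perm φ ψ j)).hom x ≫ (bindIso x (fib φ) (fib ψ j)).inv) (fib χ k) =
    ((Code.ofPerm (fib_comp_perm φ (ψ ≫ χ) k)).hom x ≫
      (bindIso x (fib φ) (fib (ψ ≫ χ) k)).inv) ≫
      (Code.ofPerm (fib_comp_perm ψ χ k)).hom (fun j => tens x (fib φ j)) ≫
        (bindIso (fun j => tens x (fib φ j)) (fib ψ) (fib χ k)).inv
  rw [← cancel_mono (bindIso (fun j => tens x (fib φ j)) (fib ψ) (fib χ k)).hom,
    ← cancel_mono (bindIso x (fib φ) (flat (fib ψ) (fib χ k))).hom]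
  have e : tensMap (fun j => (Code.ofPerm (fib_comp_perm φ ψ j)).hom x ≫
      (bindIso x (fib φ) (fib ψ j)).inv) (fib χ k) ≫
        tensMap (fun j => (bindIso x (fib φ) (fib ψ j)).hom) (fib χ k) =
      tensMap (fun j => (Code.ofPerm (fib_comp_perm φ ψ j)).hom x) (fib χ k) := by
    rw [← tensMap_comp]
    simp
  refine Eq.trans (b := a.hom x) ?_ ?_
  · simp only [Category.assoc, h]
    rw [reassoc_of% e, ← reassoc_of% (hr x), Iso.inv_hom_id_assoc, ← hr' x, ← hr'' x, ← ha x]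
  · simp only [Category.assoc, Iso.inv_hom_id_assoc]
    rw [← hs x, Iso.inv_hom_id_assoc, hab, hb x]

theorem rightUnitor_tensor_mid (X Y : C) :
    (α_ X (𝟙_ C) Y).hom ≫ X ◁ (λ_ Y).hom = (ρ_ X).hom ▷ Y := by
  simp

theorem bindIso_singleton (x : ι → C) (l : List ι)
    (h : tens x l = tens x (flat (fun i => [i]) l)) :
    (bindIso x (fun i => [i]) l).hom = tensMap (fun i => (ρ_ (x i)).hom) l ≫ eqToHom h := by
  induction l with
  | nil => simp [bindIso, tensMap]
  | cons i l ih =>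
    have e : flat (fun i => [i]) l = l := by
      clear h ih
      induction l with
      | nil => rfl
      | cons j l ih => simp [flat, ih]
    have h1 : (bindIso x (fun i => [i]) (i :: l)).hom = (x i ⊗ 𝟙_ C) ◁ (bindIso x (fun i => [i]) l).hom ≫
      (α_ _ _ _).hom ≫ x i ◁ (λ_ _).hom := rfl
    have h2 : eqToHom h = x i ◁ eqToHom (by rw [e]; rfl) := (whiskerLeft_eqToHom' _ _).symm
    rw [h1, h2, ih (by rw [e]), rightUnitor_tensor_mid]
    simp only [tensMap, MonoidalCategory.tensorHom_def, whiskerLeft_comp, Category.assoc]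
    rw [whisker_exchange, whisker_exchange_assoc]

theorem pushComp_id_left {m n : FinPt} (φ : m ⟶ n) (x : Fin m.size → C) :
    (pushComp (𝟙 m) φ).hom.app x ≫ (pushF C φ).map ((pushId m).hom.app x) = 𝟙 _ := by
  ext k
  obtain ⟨r, hr⟩ := code_bind_map (C := C) (fun j => Code.ofPerm (fib_id_perm (m := m) j)) (fib φ k)
  have e : flat (fun i => [i]) (fib φ k) = fib φ k := by
    generalize fib φ k = l
    induction l with
    | nil => rfl
    | cons j l ih => simp [flat, ih]
  obtain ⟨r', hr'⟩ := code_of_eq (C := C) e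
  obtain ⟨r'', hr''⟩ := code_comp (C := C) r r'
  obtain ⟨a, ha⟩ := code_comp (C := C) (Code.ofPerm (fib_comp_perm (𝟙 m) φ k)) r''
  have hab : a = .refl _ := code_unique a (.refl _) (fib_nodup φ k)
  change ((Code.ofPerm (fib_comp_perm (𝟙 m) φ k)).hom x ≫
    (bindIso x (fib (𝟙 m)) (fib φ k)).inv) ≫ tensMap (fun j =>
      (Code.ofPerm (fib_id_perm j)).hom x ≫ (ρ_ (x j)).hom) (fib φ k) = 𝟙 _
  have h := bindIso_singleton x (fib φ k) (by rw [e])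
  have e' : tensMap (fun i => (ρ_ (x i)).hom) (fib φ k) =
      (bindIso x (fun i => [i]) (fib φ k)).hom ≫ r'.hom x := by
    rw [h, hr' x]
    simp
  rw [tensMap_comp, e', ← reassoc_of% (hr x), Category.assoc, Iso.inv_hom_id_assoc, ← hr'' x,
    ← ha x, hab, Code.refl_hom]

theorem pushComp_id_right {m n : FinPt} (φ : m ⟶ n) (x : Fin m.size → C) :
    (pushComp φ (𝟙 n)).hom.app x ≫ (pushId n).hom.app ((pushF C φ).obj x) = 𝟙 _ := by
  ext k
  obtain ⟨r, hr⟩ := code_bind (C := C) (fib φ) (Code.ofPerm (fib_id_perm k))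
  obtain ⟨r', hr'⟩ := code_of_eq (C := C) (List.append_nil (fib φ k))
  obtain ⟨r'', hr''⟩ := code_comp (C := C) r r'
  obtain ⟨a, ha⟩ := code_comp (C := C) (Code.ofPerm (fib_comp_perm φ (𝟙 n) k)) r''
  have hab : a = .refl _ := code_unique a (.refl _) (fib_nodup φ k)
  change ((Code.ofPerm (fib_comp_perm φ (𝟙 n) k)).hom x ≫
    (bindIso x (fib φ) (fib (𝟙 n) k)).inv) ≫
      (Code.ofPerm (fib_id_perm k)).hom (fun j => tens x (fib φ j)) ≫ (ρ_ _).hom = 𝟙 _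
  have h : (bindIso x (fib φ) [k]).hom = tens x (fib φ k) ◁ 𝟙 (𝟙_ C) ≫
    (appIso x (fib φ k) []).inv := rfl
  have e' : (ρ_ (tens x (fib φ k))).hom = (bindIso x (fib φ) [k]).hom ≫ r'.hom x := by
    rw [h, hr' x, whiskerLeft_id, Category.id_comp, Iso.eq_inv_comp, appIso_nil]
    simp
  erw [e', ← reassoc_of% (hr x)]
  rw [Category.assoc, Iso.inv_hom_id_assoc, ← hr'' x, ← ha x, hab, Code.refl_hom]

end

section

variable (C : Type u) [Category.{v} C] [MonoidalCategory C] [SymmetricCategory C]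
  [StrictMonoidal C]

/-- The pseudofunctor `C^{(-)}`, `m₊ ↦ C^m`, `φ ↦ φ_*`, with the symmetry isomorphisms as structure
2-cells. Here `C^m` is regarded with its coordinatewise strict monoidal structure, `φ_*` as a
strong monoidal functor through the symmetry of `C`, so this is also the pseudofunctor
`(ΣC)^{(-)}`, `m₊ ↦ (ΣC)^m = Σ(C^m)`, to 2-categories, pseudofunctors and icons. -/
noncomputable def powerMon : Pseudofunctor (LocallyDiscrete FinPt) StMonCat.{v, u} :=
  LocallyDiscrete.mkPseudofunctor
    (fun m => StMonCat.mk (Fin m.size → C))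
    (fun {m n} φ => (StMonCat.Hom.mk (A := StMonCat.mk (Fin m.size → C))
      (B := StMonCat.mk (Fin n.size → C)) (pushF C φ)))
    (fun m => StMonCat.isoMk (G := StMonCat.Hom.id (StMonCat.mk (Fin m.size → C)))
      (pushId m) (pushId_isMonoidal m))
    (fun φ ψ => StMonCat.isoMk (pushComp φ ψ) (pushComp_isMonoidal φ ψ))
    (by
      intro m n p q φ ψ χ
      refine StMonCat.Hom₂.ext' fun x => ?_
      change (pushComp (φ ≫ ψ) χ).hom.app x ≫ (pushF C χ).map ((pushComp φ ψ).hom.app x) ≫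
        𝟙 _ ≫ (pushComp ψ χ).inv.app ((pushF C φ).obj x) ≫ (pushComp φ (ψ ≫ χ)).inv.app x = 𝟙 _
      rw [Category.id_comp, reassoc_of% pushComp_assoc φ ψ χ x, Iso.hom_inv_id_app_assoc,
        Iso.hom_inv_id_app]
      rfl)
    (by
      intro m n φ
      refine StMonCat.Hom₂.ext' fun x => ?_
      change (pushComp (𝟙 m) φ).hom.app x ≫ (pushF C φ).map ((pushId m).hom.app x) ≫ 𝟙 _ = 𝟙 _
      exact (congrArg (_ ≫ ·) (Category.comp_id _)).trans (pushComp_id_left φ x))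
    (by
      intro m n φ
      refine StMonCat.Hom₂.ext' fun x => ?_
      change (pushComp φ (𝟙 n)).hom.app x ≫ (pushId n).hom.app ((pushF C φ).obj x) ≫ 𝟙 _ = 𝟙 _
      exact (congrArg (_ ≫ ·) (Category.comp_id _)).trans (pushComp_id_right φ x))

end

end

section

theorem conj_comp {D : Type*} [Category* D] {P P' Q Q' R R' T T' : D} (hP : P = P') (hQ : Q = Q')
    (a : P ≅ R) (b : Q ≅ R') (c : P' ≅ T) (d : Q' ≅ T') (e : R ⟶ T) (e' : R' ⟶ T') (n : R ⟶ R')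
    (n' : T ⟶ T') (h1 : c.hom = eqToHom hP.symm ≫ a.hom ≫ e)
    (h2 : d.hom = eqToHom hQ.symm ≫ b.hom ≫ e')
    (h3 : n ≫ e' = e ≫ n') :
    a.hom ≫ n ≫ b.inv = eqToHom hP ≫ (c.hom ≫ n' ≫ d.inv) ≫ eqToHom hQ.symm := by
  subst hP hQ
  simp only [eqToHom_refl, Category.id_comp, Category.comp_id] at h1 h2 ⊢
  rw [← Category.assoc, ← Category.assoc, Iso.eq_comp_inv, h2]
  simp [h3, h1]

theorem conj_id {D : Type*} [Category* D] {P P' Q Q' R R' : D} (hP : P = P') (hQ : Q = Q')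
    (a : P ≅ R) (b : Q ≅ R') (e : R ⟶ P') (e' : R' ⟶ Q') (n : R ⟶ R')
    (n' : P' ⟶ Q') (h1 : a.hom ≫ e = eqToHom hP) (h2 : b.hom ≫ e' = eqToHom hQ)
    (h3 : n ≫ e' = e ≫ n') :
    a.hom ≫ n ≫ b.inv = eqToHom hP ≫ n' ≫ eqToHom hQ.symm := by
  subst hP hQ
  simp only [eqToHom_refl, Category.id_comp, Category.comp_id] at h1 h2 ⊢
  rw [← Category.assoc, Iso.comp_inv_eq]
  have : b.hom = b.hom ≫ e' ≫ b.hom := by rw [reassoc_of% h2]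
  have h4 : e' = b.inv := by rw [← cancel_epi b.hom, h2, Iso.hom_inv_id]
  subst h4
  rw [Iso.comp_inv_eq] at h3
  rw [h3, Category.assoc, reassoc_of% h1]

section Strictify

variable {A : Type w} [Category.{w'} A]

theorem map₂_eq {B : Type*} [Bicategory B] (X : Pseudofunctor (LocallyDiscrete A) B)
    {a b : LocallyDiscrete A} {f g : a ⟶ b} (t : f ⟶ g) :
    X.map₂ t = eqToHom (congrArg X.map (LocallyDiscrete.eq_of_hom t)) := by
  obtain rfl := LocallyDiscrete.eq_of_hom t
  obtain rfl : t = 𝟙 f := Subsingleton.elim _ _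
  simp

/-- An object of `(Q_j X)(a)`: a formal image `f_* x` of an object `x` of `X b` under
an arrow `f : b ⟶ a`. -/
structure QjObj (X : Pseudofunctor (LocallyDiscrete A) Cat.{v, u}) (a : A) where
  base : A
  arr : base ⟶ a
  pt : X.obj ⟨base⟩

namespace QjObj

variable (X : Pseudofunctor (LocallyDiscrete A) Cat.{v, u})

/-- The functor `X(f)`. -/
abbrev act {a b : A} (f : a ⟶ b) : X.obj ⟨a⟩ ⥤ X.obj ⟨b⟩ := (X.map f.toLoc).toFunctor

/-- The structure isomorphism `X(f ≫ g) x ≅ X(g) (X(f) x)`. -/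
def cmp {a b c : A} (f : a ⟶ b) (g : b ⟶ c) (x : X.obj ⟨a⟩) :
    (act X (f ≫ g)).obj x ≅ (act X g).obj ((act X f).obj x) :=
  (Cat.Hom.toNatIso (X.mapComp f.toLoc g.toLoc)).app x

/-- The structure isomorphism `X(𝟙) x ≅ x`. -/
def unt {a : A} (x : X.obj ⟨a⟩) : (act X (𝟙 a)).obj x ≅ x :=
  (Cat.Hom.toNatIso (X.mapId ⟨a⟩)).app x

theorem cmp_natural {a b c : A} (f : a ⟶ b) (g : b ⟶ c) {x y : X.obj ⟨a⟩} (m : x ⟶ y) :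
    (act X (f ≫ g)).map m ≫ (cmp X f g y).hom =
      (cmp X f g x).hom ≫ (act X g).map ((act X f).map m) :=
  (X.mapComp f.toLoc g.toLoc).hom.toNatTrans.naturality m

theorem unt_natural {a : A} {x y : X.obj ⟨a⟩} (m : x ⟶ y) :
    (act X (𝟙 a)).map m ≫ (unt X y).hom = (unt X x).hom ≫ m :=
  (X.mapId ⟨a⟩).hom.toNatTrans.naturality m

theorem cmp_assoc {a b c d : A} (f : a ⟶ b) (g : b ⟶ c) (h : c ⟶ d) (x : X.obj ⟨a⟩) :
    (cmp X (f ≫ g) h x).hom ≫ (act X h).map (cmp X f g x).hom =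
      eqToHom (by rw [Category.assoc]) ≫ (cmp X f (g ≫ h) x).hom ≫
        (cmp X g h ((act X f).obj x)).hom := by
  have := congrArg (fun t => t.toNatTrans.app x)
    (X.mapComp_assoc_left_hom f.toLoc g.toLoc h.toLoc)
  refine this.trans ?_
  have e := congrArg (fun t => t.toNatTrans.app x)
    (map₂_eq X (Bicategory.associator f.toLoc g.toLoc h.toLoc).hom)
  refine (congrArg (fun t => t ≫ (cmp X f (g ≫ h) x).hom ≫
    (cmp X g h ((act X f).obj x)).hom ≫ 𝟙 _) e).trans ?_
  rw [Cat.Hom₂.eqToHom_toNatTrans, eqToHom_app, Category.comp_id]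
  rfl

theorem cmp_id {a b : A} (f : a ⟶ b) (x : X.obj ⟨a⟩) :
    (cmp X f (𝟙 b) x).hom ≫ (unt X ((act X f).obj x)).hom = eqToHom (by rw [Category.comp_id]) := by
  have := congrArg (fun t => t.toNatTrans.app x) (X.mapComp_id_right_hom f.toLoc)
  have e := congrArg (fun t => t.toNatTrans.app x)
    (map₂_eq X (Bicategory.rightUnitor f.toLoc).hom)
  rw [Cat.Hom₂.eqToHom_toNatTrans, eqToHom_app] at e
  rw [← Iso.eq_comp_inv]
  refine this.trans ((congrArg (fun t => t ≫ 𝟙 _ ≫ (unt X ((act X f).obj x)).inv) e).trans ?_)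
  rw [Category.id_comp]
  rfl

variable {X}

/-- The actual image `X(f) x` of a formal one. -/
abbrev ev {a : A} (q : QjObj X a) : X.obj ⟨a⟩ := (act X q.arr).obj q.pt

/-- Morphisms of `(Q_j X)(a)` are the morphisms between the actual images in `X a`. -/
instance (a : A) : Category.{v} (QjObj X a) where
  Hom q r := q.ev ⟶ r.ev
  id q := 𝟙 q.ev
  comp m n := CategoryStruct.comp (obj := X.obj ⟨a⟩) m n
  id_comp m := Category.id_comp (obj := X.obj ⟨a⟩) m
  comp_id m := Category.comp_id (obj := X.obj ⟨a⟩) m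
  assoc m n k := Category.assoc (obj := X.obj ⟨a⟩) m n k

theorem eqToHom_eq {a : A} {q r : QjObj X a} (h : q = r) :
    (eqToHom h : q ⟶ r) = (eqToHom (congrArg ev h) : q.ev ⟶ r.ev) := by
  subst h
  rfl

/-- The action of `h` on morphisms: `X(h)`, conjugated with the structure isomorphisms. -/
def pushMap {a b : A} (h : a ⟶ b) {q r : QjObj X a} (m : q.ev ⟶ r.ev) :
    (act X (q.arr ≫ h)).obj q.pt ⟶ (act X (r.arr ≫ h)).obj r.pt :=
  (cmp X q.arr h q.pt).hom ≫ (act X h).map m ≫ (cmp X r.arr h r.pt).inv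

/-- The action of `h : a ⟶ b` on `Q_j X`: on objects, `h_* (f_* x) = (h f)_* x`. -/
@[simps]
def push {a b : A} (h : a ⟶ b) : QjObj X a ⥤ QjObj X b where
  obj q := ⟨q.base, q.arr ≫ h, q.pt⟩
  map m := pushMap h m
  map_id q := by
    change (cmp X q.arr h q.pt).hom ≫ (act X h).map (𝟙 _) ≫ (cmp X q.arr h q.pt).inv = 𝟙 _
    simp
  map_comp {q r s} m n := by
    change (cmp X q.arr h q.pt).hom ≫ (act X h).map (CategoryStruct.comp (obj := X.obj ⟨a⟩) m n) ≫
      (cmp X s.arr h s.pt).inv = ((cmp X q.arr h q.pt).hom ≫ (act X h).map m ≫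
        (cmp X r.arr h r.pt).inv) ≫ (cmp X r.arr h r.pt).hom ≫ (act X h).map n ≫
          (cmp X s.arr h s.pt).inv
    simp

theorem push_obj_id {a : A} (q : QjObj X a) : (push (𝟙 a)).obj q = q := by
  obtain ⟨b, f, x⟩ := q
  change QjObj.mk b (f ≫ 𝟙 a) x = _
  rw [Category.comp_id]

theorem push_obj_comp {a b c : A} (h : a ⟶ b) (k : b ⟶ c) (q : QjObj X a) :
    (push (h ≫ k)).obj q = (push k).obj ((push h).obj q) := by
  obtain ⟨b, f, x⟩ := q
  change QjObj.mk b (f ≫ h ≫ k) x = QjObj.mk b ((f ≫ h) ≫ k) x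
  rw [Category.assoc]

theorem push_id (a : A) : push (X := X) (𝟙 a) = 𝟭 (QjObj X a) := by
  refine CategoryTheory.Functor.ext push_obj_id fun q r m => ?_
  rw [eqToHom_eq, eqToHom_eq]
  exact conj_id (congrArg ev (push_obj_id q)) (congrArg ev (push_obj_id r))
    (cmp X q.arr (𝟙 a) q.pt) (cmp X r.arr (𝟙 a) r.pt) (unt X q.ev).hom (unt X r.ev).hom
    ((act X (𝟙 a)).map (X := q.ev) (Y := r.ev) m) m (cmp_id X q.arr q.pt) (cmp_id X r.arr r.pt)
    (unt_natural X (x := q.ev) (y := r.ev) m)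

theorem push_comp {a b c : A} (h : a ⟶ b) (k : b ⟶ c) :
    push (X := X) (h ≫ k) = push h ⋙ push k := by
  refine CategoryTheory.Functor.ext (push_obj_comp h k) fun q r m => ?_
  rw [eqToHom_eq, eqToHom_eq]
  refine (conj_comp (congrArg ev (push_obj_comp h k q)) (congrArg ev (push_obj_comp h k r))
    (cmp X q.arr (h ≫ k) q.pt) (cmp X r.arr (h ≫ k) r.pt)
    (cmp X (q.arr ≫ h) k q.pt ≪≫ (act X k).mapIso (cmp X q.arr h q.pt))
    (cmp X (r.arr ≫ h) k r.pt ≪≫ (act X k).mapIso (cmp X r.arr h r.pt))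
    (cmp X h k q.ev).hom (cmp X h k r.ev).hom
    ((act X (h ≫ k)).map (X := q.ev) (Y := r.ev) m)
    ((act X k).map ((act X h).map (X := q.ev) (Y := r.ev) m)) (cmp_assoc X q.arr h k q.pt)
    (cmp_assoc X r.arr h k r.pt) (cmp_natural X h k (x := q.ev) (y := r.ev) m)).trans ?_
  change eqToHom _ ≫ _ ≫ eqToHom _ = eqToHom _ ≫ ((cmp X (q.arr ≫ h) k q.pt).hom ≫
    (act X k).map ((cmp X q.arr h q.pt).hom ≫
      (act X h).map (X := q.ev) (Y := r.ev) m ≫ (cmp X r.arr h r.pt).inv) ≫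
        (cmp X (r.arr ≫ h) k r.pt).inv) ≫ eqToHom _
  congr 2
  simp only [Functor.map_comp, Category.assoc]
  exact Category.assoc _ _ _

end QjObj

/-- The strictification `Q_j X` of a pseudofunctor `X : A → Cat`: the value at `X` of the
left 2-adjoint `Q_j` of the inclusion of (strict functors `A ⥤ Cat`, strict natural transformations)
into (pseudofunctors `A → Cat`, pseudonatural transformations).

It is the usual model: the free functor on the objects of the categories `X b` maps to `X`,
and this map is factored as one that is bijective on objects followed by a fully faithful one.
The unit `X → Q_j X` sends `x` in `X a` to `(𝟙 a)_* x`.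
A pseudonatural transformation `σ : X → Y` to a strict functor `Y` corresponds to the strict natural
transformation `Q_j X ⟶ Y` sending `f_* x` to `Y(f) (σ x)` and a morphism `m : X(f) x ⟶ X(g) y` to
the conjugate of `σ m` with the isomorphisms `Y(f) (σ x) ≅ σ (X(f) x)` and
`Y(g) (σ y) ≅ σ (X(g) y)`. -/
def Qj (X : Pseudofunctor (LocallyDiscrete A) Cat.{v, u}) : A ⥤ Cat.{v, max u w w'} where
  obj a := Cat.of (QjObj X a)
  map h := (QjObj.push h).toCatHom
  map_id a := Cat.ext (QjObj.push_id a)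
  map_comp h k := Cat.ext (QjObj.push_comp h k)

end Strictify

end

section

/-- Words (finite strings) in an alphabet `S` labelling objects of a monoidal category `D`. -/
@[ext]
structure Word {S : Type*} {D : Type u} (ev : S → D) where
  letters : List S

namespace Word

variable {S : Type*} {D : Type u} [Category.{v} D] [MonoidalCategory D] {ev : S → D}

/-- The value of a word: the tensor product of the values of its letters. -/
abbrev val (w : Word ev) : D := tens ev w.letters

/-- Morphisms of words are the morphisms between the values. -/
instance : Category.{v} (Word ev) where
  Hom w w' := w.val ⟶ w'.val
  id w := 𝟙 w.val
  comp m n := CategoryStruct.comp (obj := D) m n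
  id_comp m := Category.id_comp (obj := D) m
  comp_id m := Category.comp_id (obj := D) m
  assoc m n k := Category.assoc (obj := D) m n k

theorem eqToHom_eq {w w' : Word ev} (h : w = w') :
    (eqToHom h : w ⟶ w') = (eqToHom (congrArg val h) : w.val ⟶ w'.val) := by
  subst h
  rfl

/-- The value functor, the identity on morphisms. -/
@[simps]
def valF (ev : S → D) : Word ev ⥤ D where
  obj w := w.val
  map m := m

instance : (valF ev).Faithful where
  map_injective h := h

/-- Concatenation of words. -/
def app (w w' : Word ev) : Word ev := ⟨w.letters ++ w'.letters⟩

theorem app_assoc (w₁ w₂ w₃ : Word ev) : (w₁.app w₂).app w₃ = w₁.app (w₂.app w₃) :=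
  congrArg Word.mk (List.append_assoc _ _ _)

theorem nil_app (w : Word ev) : app ⟨[]⟩ w = w := rfl

theorem app_nil (w : Word ev) : app w ⟨[]⟩ = w := congrArg Word.mk (List.append_nil _)

/-- The value of a concatenation. -/
def appVal (w w' : Word ev) : (w.app w').val ≅ w.val ⊗ w'.val := appIso ev w.letters w'.letters

/-- Words form a strict monoidal category under concatenation. -/
instance : MonoidalCategoryStruct (Word ev) where
  tensorObj w w' := w.app w'
  whiskerLeft w {w₁ w₂} m :=
    ((w.appVal w₁).hom ≫ w.val ◁ (valF ev).map m ≫ (w.appVal w₂).inv : (w.app w₁).val ⟶ _)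
  whiskerRight {w₁ w₂} m w :=
    ((w₁.appVal w).hom ≫ (valF ev).map m ▷ w.val ≫ (w₂.appVal w).inv : (w₁.app w).val ⟶ _)
  tensorHom {w₁ w₂ w₃ w₄} m n :=
    ((w₁.appVal w₃).hom ≫ ((valF ev).map m ⊗ₘ (valF ev).map n) ≫ (w₂.appVal w₄).inv :
      (w₁.app w₃).val ⟶ _)
  tensorUnit := ⟨[]⟩
  associator w₁ w₂ w₃ := eqToIso (app_assoc w₁ w₂ w₃)
  leftUnitor w := eqToIso (nil_app w)
  rightUnitor w := eqToIso (app_nil w)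

theorem tensor_eq (w w' : Word ev) : w ⊗ w' = w.app w' := rfl

theorem whiskerLeft_eq (w : Word ev) {w₁ w₂ : Word ev} (m : w₁ ⟶ w₂) :
    (w ◁ m : w ⊗ w₁ ⟶ w ⊗ w₂) = ((w.appVal w₁).hom ≫ w.val ◁ (valF ev).map m ≫ (w.appVal w₂).inv :
      (w.app w₁).val ⟶ _) := rfl

theorem whiskerRight_eq {w₁ w₂ : Word ev} (m : w₁ ⟶ w₂) (w : Word ev) :
    (m ▷ w : w₁ ⊗ w ⟶ w₂ ⊗ w) =
      ((w₁.appVal w).hom ≫ (valF ev).map m ▷ w.val ≫ (w₂.appVal w).inv :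
        (w₁.app w).val ⟶ _) := rfl

instance : MonoidalCategory (Word ev) :=
  Monoidal.induced (valF ev)
    { μIso := fun w w' => (w.appVal w').symm
      εIso := Iso.refl _
      whiskerLeft_eq := fun w w₁ w₂ m => rfl
      whiskerRight_eq := fun m w => rfl
      tensorHom_eq := fun m n => rfl
      associator_eq := fun w₁ w₂ w₃ => by
        have h := appIso_assoc ev w₁.letters w₂.letters w₃.letters
        have e : (valF ev).map (α_ w₁ w₂ w₃).hom =
          (eqToHom (congrArg val (app_assoc w₁ w₂ w₃)) : ((w₁.app w₂).app w₃).val ⟶ _) :=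
            eqToHom_eq (app_assoc w₁ w₂ w₃)
        rw [e]
        change _ = ((appIso ev (w₁.letters ++ w₂.letters) w₃.letters).hom ≫
          ((appIso ev w₁.letters w₂.letters).hom ⊗ₘ 𝟙 _)) ≫ (α_ _ _ _).hom ≫
            (𝟙 _ ⊗ₘ (appIso ev w₂.letters w₃.letters).inv) ≫
              (appIso ev w₁.letters (w₂.letters ++ w₃.letters)).inv
        simp only [tensorHom_id, id_tensorHom, Category.assoc]
        rw [reassoc_of% h]
        simp
        rfl
      leftUnitor_eq := fun w => by
        have e : (valF ev).map (λ_ w).hom = 𝟙 w.val := rfl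
        rw [e]
        change _ = ((λ_ _).inv ≫ (𝟙 _ ⊗ₘ 𝟙 _)) ≫ (λ_ _).hom
        simp
      rightUnitor_eq := fun w => by
        have h := appIso_nil ev w.letters
        have e : (valF ev).map (ρ_ w).hom = (eqToHom (congrArg val (app_nil w)) :
          (w.app ⟨[]⟩).val ⟶ _) := eqToHom_eq (app_nil w)
        rw [e]
        change _ = ((appIso ev w.letters []).hom ≫ (𝟙 _ ⊗ₘ 𝟙 _)) ≫ (ρ_ _).hom
        rw [h]
        simp
        rfl }

instance : StrictMonoidal (Word ev) where
  tensor_assoc := app_assoc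
  unit_tensor := nil_app
  tensor_unit := app_nil
  associator_hom _ _ _ := rfl
  leftUnitor_hom _ := rfl
  rightUnitor_hom _ := rfl

end Word

end

section

open Functor.LaxMonoidal Functor.Monoidal

section Xi

variable {S S' S'' : Type*} {D D' D'' : Type u} [Category.{v} D] [MonoidalCategory D]
  [Category.{v} D'] [MonoidalCategory D'] [Category.{v} D''] [MonoidalCategory D'']

/-- The isomorphism comparing the value of a word after and before applying a monoidal functor,
built from letterwise isomorphisms and the structure isomorphisms of the monoidal functor. -/
noncomputable def xi {ev : S → D} {ev' : S' → D'} (G : D ⥤ D') [G.Monoidal] {p : S → S'}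
    (c : ∀ s, ev' (p s) ≅ G.obj (ev s)) : ∀ l : List S, tens ev' (l.map p) ≅ G.obj (tens ev l)
  | [] => εIso G
  | s :: l => (c s ⊗ᵢ xi G c l) ≪≫ μIso G (ev s) (tens ev l)

variable {ev : S → D} {ev' : S' → D'} {ev'' : S'' → D''}
  (G : D ⥤ D') [G.Monoidal] {p : S → S'} (c : ∀ s, ev' (p s) ≅ G.obj (ev s))

theorem tensor_eqToHom {X X' Y Y' : D} (h : X = X') (h' : Y = Y') :
    (eqToHom h ⊗ₘ eqToHom h') = eqToHom (by rw [h, h']) := by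
  subst h h'
  simp

theorem xi_cons (s : S) (l : List S) :
    (xi G c (s :: l)).hom = ((c s).hom ⊗ₘ (xi G c l).hom) ≫ μ G (ev s) (tens ev l) := rfl

theorem xi_append (a b : List S) (h : tens ev' ((a ++ b).map p) = tens ev' (a.map p ++ b.map p)) :
    (xi G c (a ++ b)).hom ≫ G.map (appIso ev a b).hom =
      eqToHom h ≫ (appIso ev' (a.map p) (b.map p)).hom ≫
        ((xi G c a).hom ⊗ₘ (xi G c b).hom) ≫ μ G _ _ := by
  induction a with
  | nil =>
    change (xi G c b).hom ≫ G.map (λ_ _).inv = 𝟙 _ ≫ (λ_ _).inv ≫ (ε G ⊗ₘ (xi G c b).hom) ≫ μ G _ _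
    rw [tensorHom_def', Category.id_comp, Category.assoc, ← leftUnitor_inv_naturality_assoc,
      left_unitality_inv]
  | cons s a ih =>
    have h' : tens ev' ((a ++ b).map p) = tens ev' (a.map p ++ b.map p) := by rw [List.map_append]
    have e : eqToHom h = ev' (p s) ◁ eqToHom h' := (whiskerLeft_eqToHom' _ _).symm
    have e1 : (appIso ev (s :: a) b).hom = ev s ◁ (appIso ev a b).hom ≫ (α_ _ _ _).inv := rfl
    have e2 : (appIso ev' ((s :: a).map p) (b.map p)).hom =
      ev' (p s) ◁ (appIso ev' (a.map p) (b.map p)).hom ≫ (α_ _ _ _).inv := rfl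
    have e3 : (xi G c (s :: a ++ b)).hom =
      ((c s).hom ⊗ₘ (xi G c (a ++ b)).hom) ≫ μ G (ev s) (tens ev (a ++ b)) := rfl
    rw [e, e1, e2, e3, xi_cons]
    have ih := ih h'
    have e4 : ((c s).hom ⊗ₘ (xi G c (a ++ b)).hom) ≫ μ G (ev s) (tens ev (a ++ b)) ≫
        G.map (ev s ◁ (appIso ev a b).hom) =
        ((c s).hom ⊗ₘ (xi G c (a ++ b)).hom ≫ G.map (appIso ev a b).hom) ≫ μ G _ _ := by
      rw [← μ_natural_right, ← id_tensorHom, tensorHom_comp_tensorHom_assoc, Category.comp_id]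
    have e5 := associativity_inv G (ev s) (tens ev a) (tens ev b)
    have e6 := associator_inv_naturality (c s).hom (xi G c a).hom (xi G c b).hom
    rw [Category.assoc, Functor.map_comp, reassoc_of% e4, ih]
    have e7 : ((c s).hom ⊗ₘ eqToHom h' ≫ (appIso ev' (a.map p) (b.map p)).hom ≫
        ((xi G c a).hom ⊗ₘ (xi G c b).hom) ≫ μ G (tens ev a) (tens ev b)) =
        ev' (p s) ◁ eqToHom h' ≫ ev' (p s) ◁ (appIso ev' (a.map p) (b.map p)).hom ≫
          ((c s).hom ⊗ₘ ((xi G c a).hom ⊗ₘ (xi G c b).hom)) ≫ G.obj (ev s) ◁ μ G _ _ := by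
      simp only [← id_tensorHom, tensorHom_comp_tensorHom, Category.id_comp, Category.comp_id]
    rw [e7]
    simp only [Category.assoc, e5]
    rw [reassoc_of% e6]
    simp only [← tensorHom_id, tensorHom_comp_tensorHom_assoc, Category.comp_id]

theorem xi_comp (G' : D' ⥤ D'') [G'.Monoidal] {p' : S' → S''} (c' : ∀ s, ev'' (p' s) ≅ G'.obj (ev' s))
    (G'' : D ⥤ D'') [G''.Monoidal] {p'' : S → S''} (c'' : ∀ s, ev'' (p'' s) ≅ G''.obj (ev s))
    (hp : ∀ s, p'' s = p' (p s)) (t : G'' ⟶ G ⋙ G') [NatTrans.IsMonoidal t]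
    (hc : ∀ s, (c' (p s)).hom ≫ G'.map (c s).hom =
      eqToHom (by rw [hp]) ≫ (c'' s).hom ≫ t.app (ev s)) (l : List S)
    (h : tens ev'' ((l.map p).map p') = tens ev'' (l.map p'')) :
    (xi G' c' (l.map p)).hom ≫ G'.map (xi G c l).hom =
      eqToHom h ≫ (xi G'' c'' l).hom ≫ t.app (tens ev l) := by
  induction l with
  | nil =>
    change ε G' ≫ G'.map (ε G) = 𝟙 _ ≫ ε G'' ≫ t.app (𝟙_ D)
    rw [NatTrans.IsMonoidal.unit]
    simp
  | cons s l ih =>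
    have h' : tens ev'' ((l.map p).map p') = tens ev'' (l.map p'') := by
      rw [List.map_map, funext hp]; rfl
    have e : eqToHom h = (eqToHom (by rw [hp]) ⊗ₘ eqToHom h' :
      ev'' (p' (p s)) ⊗ _ ⟶ ev'' (p'' s) ⊗ _) := (tensor_eqToHom _ _).symm
    have e1 : (xi G' c' ((s :: l).map p)).hom = ((c' (p s)).hom ⊗ₘ (xi G' c' (l.map p)).hom) ≫
      μ G' (ev' (p s)) (tens ev' (l.map p)) := rfl
    have e2 : t.app (tens ev (s :: l)) = t.app (ev s ⊗ tens ev l) := rfl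
    rw [e, e1, e2, xi_cons, xi_cons, Category.assoc, Category.assoc, NatTrans.IsMonoidal.tensor,
      Functor.map_comp, ← μ_natural_assoc, tensorHom_comp_tensorHom_assoc, hc, ih h',
      tensorHom_comp_tensorHom_assoc, tensorHom_comp_tensorHom_assoc, Category.assoc,
      Category.assoc]
    rfl

theorem xi_id (G : D ⥤ D) [G.Monoidal] {p : S → S} (c : ∀ s, ev (p s) ≅ G.obj (ev s))
    (hp : ∀ s, p s = s) (t : G ⟶ 𝟭 D) [NatTrans.IsMonoidal t]
    (hc : ∀ s, (c s).hom ≫ t.app (ev s) = eqToHom (congrArg ev (hp s))) (l : List S)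
    (h : tens ev (l.map p) = tens ev l) :
    (xi G c l).hom ≫ t.app (tens ev l) = eqToHom h := by
  induction l with
  | nil =>
    change ε G ≫ t.app (𝟙_ D) = 𝟙 _
    rw [NatTrans.IsMonoidal.unit]
    simp
  | cons s l ih =>
    have h' : tens ev (l.map p) = tens ev l := by
      rw [funext hp]; simp
    have e : eqToHom h = (eqToHom (by rw [hp]) ⊗ₘ eqToHom h' :
      ev (p s) ⊗ _ ⟶ ev s ⊗ _) := (tensor_eqToHom _ _).symm
    have e2 : t.app (tens ev (s :: l)) = t.app (ev s ⊗ tens ev l) := rfl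
    rw [e, e2, xi_cons, Category.assoc, NatTrans.IsMonoidal.tensor, tensorHom_comp_tensorHom_assoc]
    erw [hc, ih h']
    exact Category.comp_id _

end Xi

end

section

theorem conj_map {D E : Type*} [Category* D] [Category* E] (G : D ⥤ E) {x y z : D} {x' y' z' : E}
    (a : x' ≅ G.obj x) (b : y' ≅ G.obj y) (c : z' ≅ G.obj z) (m : x ⟶ y) (n : y ⟶ z) :
    a.hom ≫ G.map (m ≫ n) ≫ c.inv =
      (a.hom ≫ G.map m ≫ b.inv) ≫ b.hom ≫ G.map n ≫ c.inv := by
  simp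

theorem conj_map₂ {D E : Type*} [Category* D] [Category* E] (G : D ⥤ E) {x y z t : D} {x' t' : E}
    (a : x' ⟶ G.obj x) (b : G.obj t ⟶ t') (m : x ⟶ y) (n : y ⟶ z) (k : z ⟶ t) :
    (a ≫ G.map m) ≫ G.map n ≫ G.map k ≫ b = a ≫ G.map (m ≫ n ≫ k) ≫ b := by
  simp

theorem conj_iso {D : Type*} [Category* D] {P P' Q Q' R R' T T' : D} (hP : P = P') (hQ : Q = Q')
    (a : P ≅ R) (b : Q ≅ R') (c : P' ≅ T) (d : Q' ≅ T') (e : T ≅ R) (e' : T' ≅ R') (n : R ⟶ R')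
    (n' : T ⟶ T') (h1 : a.hom = eqToHom hP ≫ c.hom ≫ e.hom)
    (h2 : b.hom = eqToHom hQ ≫ d.hom ≫ e'.hom)
    (h3 : n' ≫ e'.hom = e.hom ≫ n) :
    a.hom ≫ n ≫ b.inv = eqToHom hP ≫ (c.hom ≫ n' ≫ d.inv) ≫ eqToHom hQ.symm := by
  subst hP hQ
  simp only [eqToHom_refl, Category.id_comp, Category.comp_id] at h1 h2 ⊢
  rw [← Category.assoc, Iso.comp_inv_eq, h2]
  simp [h3, h1]

theorem conj_whiskerLeft {D E : Type*} [Category* D] [MonoidalCategory D] [Category* E]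
    [MonoidalCategory E] (G : D ⥤ E) [G.Monoidal] {x y z : D} {x' y' z' : E}
    (a : x' ≅ G.obj x) (b : y' ≅ G.obj y) (c : z' ≅ G.obj z) (m : y ⟶ z) :
    x' ◁ (b.hom ≫ G.map m ≫ c.inv) ≫ ((a ⊗ᵢ c) ≪≫ Functor.Monoidal.μIso G x z).hom =
      ((a ⊗ᵢ b) ≪≫ Functor.Monoidal.μIso G x y).hom ≫ G.map (x ◁ m) := by
  simp only [Iso.trans_hom, tensorIso_hom, Functor.Monoidal.μIso_hom, Category.assoc,
    ← id_tensorHom, tensorHom_comp_tensorHom_assoc, Iso.inv_hom_id, Category.comp_id,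
    Category.id_comp]
  rw [id_tensorHom, ← Functor.LaxMonoidal.μ_natural_right, ← id_tensorHom,
    tensorHom_comp_tensorHom_assoc, Category.comp_id]

theorem conj_whiskerRight {D E : Type*} [Category* D] [MonoidalCategory D] [Category* E]
    [MonoidalCategory E] (G : D ⥤ E) [G.Monoidal] {x y z : D} {x' y' z' : E}
    (a : x' ≅ G.obj x) (b : y' ≅ G.obj y) (c : z' ≅ G.obj z) (m : y ⟶ z) :
    (b.hom ≫ G.map m ≫ c.inv) ▷ x' ≫ ((c ⊗ᵢ a) ≪≫ Functor.Monoidal.μIso G z x).hom =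
      ((b ⊗ᵢ a) ≪≫ Functor.Monoidal.μIso G y x).hom ≫ G.map (m ▷ x) := by
  simp only [Iso.trans_hom, tensorIso_hom, Functor.Monoidal.μIso_hom, Category.assoc,
    ← tensorHom_id, tensorHom_comp_tensorHom_assoc, Iso.inv_hom_id, Category.comp_id,
    Category.id_comp]
  rw [tensorHom_id, ← Functor.LaxMonoidal.μ_natural_left, ← tensorHom_id,
    tensorHom_comp_tensorHom_assoc, Category.comp_id]

theorem conj_conj {D E : Type*} [Category* D] [Category* E] (G : D ⥤ E) {x y x₁ y₁ : D} {x' y' : E}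
    (a : x' ≅ G.obj x) (b : y' ≅ G.obj y) (p : x ≅ x₁) (q : y ≅ y₁) (m : x₁ ⟶ y₁) :
    a.hom ≫ G.map (p.hom ≫ m ≫ q.inv) ≫ b.inv =
      (a ≪≫ G.mapIso p).hom ≫ G.map m ≫ (b ≪≫ G.mapIso q).inv := by
  simp

/-- 2-categories: bicategories whose associators and unitors are identities. -/
structure TwoCat where
  carrier : Type w
  [bicat : Bicategory.{v, u} carrier]
  [strict : Bicategory.Strict carrier]

namespace TwoCat

attribute [instance] TwoCat.bicat TwoCat.strict

/-- 2-functors: they preserve identities and composition of 1-cells and 2-cells strictly. -/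
abbrev Fun (A B : TwoCat.{v, u, w}) := StrictPseudofunctorPreCore A.carrier B.carrier

/-- The identity 2-functor. -/
def Fun.id (A : TwoCat.{v, u, w}) : Fun A A where
  obj a := a
  map f := f
  map₂ t := t
  map_id _ := rfl
  map_comp _ _ := rfl
  map₂_whisker_left _ _ _ _ := by simp
  map₂_whisker_right _ _ := by simp

/-- Composition of 2-functors. -/
def Fun.comp {A B D : TwoCat.{v, u, w}} (P : Fun A B) (R : Fun B D) : Fun A D where
  obj a := R.obj (P.obj a)
  map f := R.map (P.map f)
  map₂ t := R.map₂ (P.map₂ t)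
  map_id a := by rw [P.map_id, R.map_id]
  map_comp f g := by rw [P.map_comp, R.map_comp]
  map₂_whisker_left f g h t := by
    rw [P.map₂_whisker_left]
    simp [R.map₂_whisker_left, PrelaxFunctor.map₂_eqToHom]
  map₂_whisker_right t f := by
    rw [P.map₂_whisker_right]
    simp [R.map₂_whisker_right, PrelaxFunctor.map₂_eqToHom]

/-- The category of 2-categories and 2-functors. -/
instance : Category TwoCat.{v, u, w} where
  Hom A B := Fun A B
  id A := Fun.id A
  comp P R := P.comp R

end TwoCat

section

variable (D : Type u) [Category.{v} D] [MonoidalCategory D] [StrictMonoidal D]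

instance : Bicategory.Strict (MonoidalSingleObj D) where
  id_comp f := StrictMonoidal.unit_tensor (C := D) f
  comp_id f := StrictMonoidal.tensor_unit (C := D) f
  assoc f g h := StrictMonoidal.tensor_assoc (C := D) f g h
  leftUnitor_eqToIso f := Iso.ext (StrictMonoidal.leftUnitor_hom (C := D) f)
  rightUnitor_eqToIso f := Iso.ext (StrictMonoidal.rightUnitor_hom (C := D) f)
  associator_eqToIso f g h := Iso.ext (StrictMonoidal.associator_hom (C := D) f g h)

/-- The one-object 2-category `ΣD` of a strict monoidal category: 1-cells are the objects of `D`,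
2-cells the morphisms of `D`, and horizontal composition is the tensor product. -/
def susp : TwoCat.{v, u, 0} := ⟨MonoidalSingleObj D⟩

variable {D} {E : Type u} [Category.{v} E] [MonoidalCategory E] [StrictMonoidal E]

/-- A functor that preserves tensor products and unit strictly, as a 2-functor of
one-object 2-categories. -/
def suspMap (G : D ⥤ E) (h1 : G.obj (𝟙_ D) = 𝟙_ E) (h2 : ∀ X Y, G.obj (X ⊗ Y) = G.obj X ⊗ G.obj Y)
    (hl : ∀ (X : D) {Y Z : D} (f : Y ⟶ Z),
      G.map (X ◁ f) = eqToHom (h2 X Y) ≫ G.obj X ◁ G.map f ≫ eqToHom (h2 X Z).symm)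
    (hr : ∀ {X Y : D} (f : X ⟶ Y) (Z : D),
      G.map (f ▷ Z) = eqToHom (h2 X Z) ≫ G.map f ▷ G.obj Z ≫ eqToHom (h2 Y Z).symm) :
    susp D ⟶ susp E :=
  { obj := fun _ => MonoidalSingleObj.star E
    map := fun X => G.obj X
    map₂ := fun f => G.map f
    map₂_id := fun X => G.map_id X
    map₂_comp := fun f g => G.map_comp f g
    map_id := fun _ => h1
    map_comp := fun X Y => h2 X Y
    map₂_whisker_left := fun X _ _ f => hl X f
    map₂_whisker_right := fun f Z => hr f Z : TwoCat.Fun (susp D) (susp E) }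

theorem suspMap_id {G : D ⥤ D} (h : G = 𝟭 D) (h1 h2 hl hr) :
    suspMap G h1 h2 hl hr = 𝟙 (susp D) := by
  subst h
  rfl

theorem suspMap_comp {E' : Type u} [Category.{v} E'] [MonoidalCategory E'] [StrictMonoidal E']
    {G : D ⥤ E} {H : E ⥤ E'} {K : D ⥤ E'} (h : K = G ⋙ H) (h1 h2 hl hr h1' h2' hl' hr' k1 k2 kl kr) :
    suspMap K k1 k2 kl kr = suspMap G h1 h2 hl hr ≫ suspMap H h1' h2' hl' hr' := by
  subst h
  rfl

end

section Strictify

variable {A : Type w} [Category.{w'} A] (Z : Pseudofunctor (LocallyDiscrete A) StMonCat.{v, u})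

/-- A letter over `a`: a formal image `f_* x` of an object `x` of `Z b` under `f : b ⟶ a`. -/
structure QLet (a : A) where
  base : A
  arr : base ⟶ a
  pt : (Z.obj ⟨base⟩).carrier

namespace QLet

/-- The strong monoidal functor `Z(f)`. -/
abbrev act {a b : A} (f : a ⟶ b) : (Z.obj ⟨a⟩).carrier ⥤ (Z.obj ⟨b⟩).carrier :=
  (Z.map f.toLoc).functor

instance {a b : A} (f : a ⟶ b) : (act Z f).Monoidal := (Z.map f.toLoc).monoidal

/-- The structure isomorphism `Z(f ≫ g) ≅ Z(f) ⋙ Z(g)`. -/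
def cmpT {a b c : A} (f : a ⟶ b) (g : b ⟶ c) : act Z (f ≫ g) ≅ act Z f ⋙ act Z g where
  hom := StMonCat.Hom₂.nat (Z.mapComp f.toLoc g.toLoc).hom
  inv := StMonCat.Hom₂.nat (Z.mapComp f.toLoc g.toLoc).inv
  hom_inv_id := congrArg StMonCat.Hom₂.nat (Z.mapComp f.toLoc g.toLoc).hom_inv_id
  inv_hom_id := congrArg StMonCat.Hom₂.nat (Z.mapComp f.toLoc g.toLoc).inv_hom_id

instance {a b c : A} (f : a ⟶ b) (g : b ⟶ c) : NatTrans.IsMonoidal (cmpT Z f g).hom :=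
  StMonCat.Hom₂.isMonoidal (Z.mapComp f.toLoc g.toLoc).hom

/-- The structure isomorphism `Z(𝟙) ≅ 𝟭`. -/
def untT (a : A) : act Z (𝟙 a) ≅ 𝟭 _ where
  hom := StMonCat.Hom₂.nat (Z.mapId ⟨a⟩).hom
  inv := StMonCat.Hom₂.nat (Z.mapId ⟨a⟩).inv
  hom_inv_id := congrArg StMonCat.Hom₂.nat (Z.mapId ⟨a⟩).hom_inv_id
  inv_hom_id := congrArg StMonCat.Hom₂.nat (Z.mapId ⟨a⟩).inv_hom_id

instance (a : A) : NatTrans.IsMonoidal (untT Z a).hom :=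
  StMonCat.Hom₂.isMonoidal (Z.mapId ⟨a⟩).hom

theorem eqToHom_nat {M N : StMonCat.{v, u}} {F G : M ⟶ N} (h : F = G) (x : M.carrier) :
    (StMonCat.Hom₂.nat (eqToHom h)).app x = eqToHom (by rw [h]) := by
  subst h
  rfl

theorem cmp_assoc {a b c d : A} (f : a ⟶ b) (g : b ⟶ c) (h : c ⟶ d) (x : (Z.obj ⟨a⟩).carrier) :
    (cmpT Z (f ≫ g) h).hom.app x ≫ (act Z h).map ((cmpT Z f g).hom.app x) =
      eqToHom (by rw [Category.assoc]) ≫ (cmpT Z f (g ≫ h)).hom.app x ≫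
        (cmpT Z g h).hom.app ((act Z f).obj x) := by
  have := congrArg (fun t => (StMonCat.Hom₂.nat t).app x)
    (Z.mapComp_assoc_left_hom f.toLoc g.toLoc h.toLoc)
  refine this.trans ?_
  have e := congrArg (fun t => (StMonCat.Hom₂.nat t).app x)
    (map₂_eq Z (Bicategory.associator f.toLoc g.toLoc h.toLoc).hom)
  refine (congrArg (fun t => t ≫ (cmpT Z f (g ≫ h)).hom.app x ≫
    (cmpT Z g h).hom.app ((act Z f).obj x) ≫ 𝟙 _) e).trans ?_
  rw [eqToHom_nat, Category.comp_id]
  rfl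

theorem cmp_id {a b : A} (f : a ⟶ b) (x : (Z.obj ⟨a⟩).carrier) :
    (cmpT Z f (𝟙 b)).hom.app x ≫ (untT Z b).hom.app ((act Z f).obj x) =
      eqToHom (by rw [Category.comp_id]; rfl) := by
  have := congrArg (fun t => (StMonCat.Hom₂.nat t).app x) (Z.mapComp_id_right_hom f.toLoc)
  have e := congrArg (fun t => (StMonCat.Hom₂.nat t).app x)
    (map₂_eq Z (Bicategory.rightUnitor f.toLoc).hom)
  rw [eqToHom_nat] at e
  have e' : (untT Z b).hom.app ((act Z f).obj x) = ((untT Z b).app ((act Z f).obj x)).hom := rfl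
  rw [e', ← Iso.eq_comp_inv]
  refine this.trans ((congrArg (fun t => t ≫ 𝟙 _ ≫
    ((untT Z b).app ((act Z f).obj x)).inv) e).trans ?_)
  rw [Category.id_comp]
  rfl

variable {Z}

/-- The actual image `Z(f) x`. -/
abbrev ev {a : A} (q : QLet Z a) : (Z.obj ⟨a⟩).carrier := (act Z q.arr).obj q.pt

/-- The action of `h` on letters: `h_* (f_* x) = (h f)_* x`. -/
def push {a b : A} (h : a ⟶ b) (q : QLet Z a) : QLet Z b := ⟨q.base, q.arr ≫ h, q.pt⟩

theorem push_id {a : A} (q : QLet Z a) : push (𝟙 a) q = q := by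
  obtain ⟨b, f, x⟩ := q
  change QLet.mk b (f ≫ 𝟙 a) x = _
  rw [Category.comp_id]

theorem push_comp {a b c : A} (h : a ⟶ b) (k : b ⟶ c) (q : QLet Z a) :
    push (h ≫ k) q = push k (push h q) := by
  obtain ⟨b, f, x⟩ := q
  change QLet.mk b (f ≫ h ≫ k) x = QLet.mk b ((f ≫ h) ≫ k) x
  rw [Category.assoc]

/-- The comparison of actual images, `Z(f ≫ h) x ≅ Z(h) (Z(f) x)`. -/
def cmp {a b : A} (h : a ⟶ b) (q : QLet Z a) : (push h q).ev ≅ (act Z h).obj q.ev :=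
  (cmpT Z q.arr h).app q.pt

end QLet

/-- The strict monoidal category underlying `(Q Z)(a)`: objects are words of formal images, the
tensor product is concatenation, and morphisms are the morphisms between the actual values
in `Z a`. -/
abbrev QWord (a : A) := Word (QLet.ev (Z := Z) (a := a))

namespace QWord

variable {Z}

/-- The comparison of the actual value of `h_* w` with the image of the actual value of `w`. -/
noncomputable def xiW {a b : A} (h : a ⟶ b) (w : QWord Z a) :
    Word.val (ev := QLet.ev (Z := Z) (a := b)) ⟨w.letters.map (QLet.push h)⟩ ≅
      (QLet.act Z h).obj w.val :=
  xi (QLet.act Z h) (QLet.cmp h) w.letters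

/-- The action of `h` on morphisms: `Z(h)`, conjugated with `xiW`. -/
noncomputable def pushMap {a b : A} (h : a ⟶ b) {w w' : QWord Z a} (m : w.val ⟶ w'.val) :
    Word.val (ev := QLet.ev (Z := Z) (a := b)) ⟨w.letters.map (QLet.push h)⟩ ⟶
      Word.val (ev := QLet.ev (Z := Z) (a := b)) ⟨w'.letters.map (QLet.push h)⟩ :=
  (xiW h w).hom ≫ (QLet.act Z h).map m ≫ (xiW h w').inv

/-- The action of `h : a ⟶ b`, letter by letter. -/
noncomputable def push {a b : A} (h : a ⟶ b) : QWord Z a ⥤ QWord Z b where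
  obj w := ⟨w.letters.map (QLet.push h)⟩
  map m := pushMap h m
  map_id w := by
    change (xiW h w).hom ≫ (QLet.act Z h).map (𝟙 _) ≫ (xiW h w).inv = 𝟙 _
    simp
  map_comp {w w' w''} m n := by
    exact conj_map (QLet.act Z h) (xiW h w) (xiW h w') (xiW h w'') ((Word.valF _).map m)
      ((Word.valF _).map n)

theorem push_obj_id {a : A} (w : QWord Z a) : (push (𝟙 a)).obj w = w := by
  refine Word.ext ?_
  change w.letters.map (QLet.push (𝟙 a)) = _
  rw [funext QLet.push_id]
  simp

theorem push_obj_comp {a b c : A} (h : a ⟶ b) (k : b ⟶ c) (w : QWord Z a) :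
    (push (h ≫ k)).obj w = (push k).obj ((push h).obj w) := by
  refine Word.ext ?_
  change w.letters.map (QLet.push (h ≫ k)) = (w.letters.map (QLet.push h)).map (QLet.push k)
  rw [List.map_map, funext (QLet.push_comp h k)]
  rfl

theorem push_id (a : A) : push (Z := Z) (𝟙 a) = 𝟭 (QWord Z a) := by
  refine CategoryTheory.Functor.ext push_obj_id fun w w' m => ?_
  rw [Word.eqToHom_eq, Word.eqToHom_eq]
  have key := fun w : QWord Z a => xi_id (QLet.act Z (𝟙 a)) (QLet.cmp (𝟙 a)) QLet.push_id
    (QLet.untT Z a).hom (fun q => QLet.cmp_id Z q.arr q.pt) w.letters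
    (congrArg Word.val (push_obj_id w))
  exact conj_id (congrArg Word.val (push_obj_id w)) (congrArg Word.val (push_obj_id w'))
    (xiW (𝟙 a) w) (xiW (𝟙 a) w') ((QLet.untT Z a).hom.app w.val) ((QLet.untT Z a).hom.app w'.val)
    ((QLet.act Z (𝟙 a)).map ((Word.valF _).map m)) ((Word.valF _).map m) (key w) (key w')
    ((QLet.untT Z a).hom.naturality _)

theorem push_comp {a b c : A} (h : a ⟶ b) (k : b ⟶ c) :
    push (Z := Z) (h ≫ k) = push h ⋙ push k := by
  refine CategoryTheory.Functor.ext (push_obj_comp h k) fun w w' m => ?_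
  rw [Word.eqToHom_eq, Word.eqToHom_eq]
  have key := fun w : QWord Z a => xi_comp (QLet.act Z h) (QLet.cmp h) (QLet.act Z k) (QLet.cmp k)
    (QLet.act Z (h ≫ k)) (QLet.cmp (h ≫ k)) (QLet.push_comp h k)
    (QLet.cmpT Z h k).hom (fun q => QLet.cmp_assoc Z q.arr h k q.pt) w.letters
    (congrArg Word.val (push_obj_comp h k w).symm)
  refine (conj_comp (congrArg Word.val (push_obj_comp h k w))
    (congrArg Word.val (push_obj_comp h k w'))
    (xiW (h ≫ k) w) (xiW (h ≫ k) w')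
    (xiW k ((push h).obj w) ≪≫ (QLet.act Z k).mapIso (xiW h w))
    (xiW k ((push h).obj w') ≪≫ (QLet.act Z k).mapIso (xiW h w'))
    ((QLet.cmpT Z h k).hom.app w.val) ((QLet.cmpT Z h k).hom.app w'.val)
    ((QLet.act Z (h ≫ k)).map ((Word.valF _).map m))
    ((QLet.act Z k).map ((QLet.act Z h).map ((Word.valF _).map m))) (key w) (key w')
    ((QLet.cmpT Z h k).hom.naturality _)).trans ?_
  change eqToHom _ ≫ _ ≫ eqToHom _ = eqToHom _ ≫ ((xiW k ((push h).obj w)).hom ≫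
    (QLet.act Z k).map ((xiW h w).hom ≫ (QLet.act Z h).map ((Word.valF _).map m) ≫
      (xiW h w').inv) ≫ (xiW k ((push h).obj w')).inv) ≫ eqToHom _
  congr 2
  exact conj_map₂ (QLet.act Z k) (xiW k ((push h).obj w)).hom (xiW k ((push h).obj w')).inv
    (xiW h w).hom ((QLet.act Z h).map ((Word.valF _).map m)) (xiW h w').inv

theorem push_tensor {a b : A} (h : a ⟶ b) (w w' : QWord Z a) :
    (push h).obj (w ⊗ w') = (push h).obj w ⊗ (push h).obj w' :=
  congrArg Word.mk List.map_append

theorem xi_app {a b : A} (h : a ⟶ b) (w w' : QWord Z a) :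
    (xiW h (w.app w') ≪≫ (QLet.act Z h).mapIso (w.appVal w')).hom =
      eqToHom (congrArg Word.val (push_tensor h w w')) ≫
        (((push h).obj w).appVal ((push h).obj w')).hom ≫
          ((xiW h w ⊗ᵢ xiW h w') ≪≫ Functor.Monoidal.μIso (QLet.act Z h) w.val w'.val).hom :=
  xi_append (QLet.act Z h) (QLet.cmp h) w.letters w'.letters _

theorem push_whiskerLeft {a b : A} (h : a ⟶ b) (w : QWord Z a) {w₁ w₂ : QWord Z a} (m : w₁ ⟶ w₂) :
    (push h).map (w ◁ m) = eqToHom (push_tensor h w w₁) ≫ (push h).obj w ◁ (push h).map m ≫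
      eqToHom (push_tensor h w w₂).symm := by
  rw [Word.eqToHom_eq, Word.eqToHom_eq]
  refine (conj_conj (QLet.act Z h) (xiW h (w.app w₁)) (xiW h (w.app w₂)) (w.appVal w₁)
    (w.appVal w₂) (w.val ◁ (Word.valF _).map m)).trans ?_
  exact conj_iso (congrArg Word.val (push_tensor h w w₁)) (congrArg Word.val (push_tensor h w w₂))
    _ _ (((push h).obj w).appVal ((push h).obj w₁)) (((push h).obj w).appVal ((push h).obj w₂))
    ((xiW h w ⊗ᵢ xiW h w₁) ≪≫ Functor.Monoidal.μIso (QLet.act Z h) w.val w₁.val)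
    ((xiW h w ⊗ᵢ xiW h w₂) ≪≫ Functor.Monoidal.μIso (QLet.act Z h) w.val w₂.val) _
    (((push h).obj w).val ◁ (Word.valF _).map ((push h).map m)) (xi_app h w w₁) (xi_app h w w₂)
    (conj_whiskerLeft (QLet.act Z h) (xiW h w) (xiW h w₁) (xiW h w₂) ((Word.valF _).map m))

theorem push_whiskerRight {a b : A} (h : a ⟶ b) {w₁ w₂ : QWord Z a} (m : w₁ ⟶ w₂) (w : QWord Z a) :
    (push h).map (m ▷ w) = eqToHom (push_tensor h w₁ w) ≫ (push h).map m ▷ (push h).obj w ≫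
      eqToHom (push_tensor h w₂ w).symm := by
  rw [Word.eqToHom_eq, Word.eqToHom_eq]
  refine (conj_conj (QLet.act Z h) (xiW h (w₁.app w)) (xiW h (w₂.app w)) (w₁.appVal w)
    (w₂.appVal w) ((Word.valF _).map m ▷ w.val)).trans ?_
  exact conj_iso (congrArg Word.val (push_tensor h w₁ w)) (congrArg Word.val (push_tensor h w₂ w))
    _ _ (((push h).obj w₁).appVal ((push h).obj w)) (((push h).obj w₂).appVal ((push h).obj w))
    ((xiW h w₁ ⊗ᵢ xiW h w) ≪≫ Functor.Monoidal.μIso (QLet.act Z h) w₁.val w.val)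
    ((xiW h w₂ ⊗ᵢ xiW h w) ≪≫ Functor.Monoidal.μIso (QLet.act Z h) w₂.val w.val) _
    ((Word.valF _).map ((push h).map m) ▷ ((push h).obj w).val) (xi_app h w₁ w) (xi_app h w₂ w)
    (conj_whiskerRight (QLet.act Z h) (xiW h w) (xiW h w₁) (xiW h w₂) ((Word.valF _).map m))

end QWord

/-- The strictification `Q Z` of a pseudofunctor `Z` to 2-categories with one object: the value at
`Z` of the left 2-adjoint `Q` of the inclusion of (strict functors from `A` to 2-categories and
2-functors, strict natural transformations) into (pseudofunctors from `A` to 2-categories,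
pseudofunctors and icons, pseudonatural transformations).

As icons relate only pseudofunctors that agree on objects, `(Q Z)(a)` has the same
objects as `Z a`, namely one. Its 1-cells are freely generated by the formal images `f_* x`
of the 1-cells `x` of `Z b` under the arrows `f : b ⟶ a`, and its 2-cells are those of `Z a` between
the actual values of these words: the free object on the 1-cells of `Z` maps to `Z`, and this map
is factored as one that is bijective on objects and 1-cells followed by one that is locally
fully faithful. A pseudonatural transformation `σ : Z → Y` to a strict `Y` corresponds to the
strict natural transformation `Q Z ⟶ Y` sending the letter `f_* x` to `Y(f) (σ x)`. -/
noncomputable def Q : A ⥤ TwoCat.{v, max u w w', 0} where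
  obj a := susp (QWord Z a)
  map h := suspMap (QWord.push h) rfl (QWord.push_tensor h) (QWord.push_whiskerLeft h)
    (QWord.push_whiskerRight h)
  map_id a := suspMap_id (QWord.push_id a) _ _ _ _
  map_comp {a b c} h k := suspMap_comp (QWord.push_comp h k) _ _ _ _ _ _ _ _ _ _ _ _

end Strictify

end

section

section Nerve

open Bicategory

variable {J J' J'' : Type} [Category.{0} J] [Category.{0} J'] [Category.{0} J'']
  {A : Type w} [Bicategory.{v, u} A]

/-- The 1-cell part of a strict 2-functor from `J` (with only identity 2-cells) to `A`
with given values on objects. -/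
@[ext]
structure ChainOn (J : Type) [Category.{0} J] {A : Type w} [Bicategory.{v, u} A] (o : J → A) where
  map : ∀ {i j : J}, (i ⟶ j) → (o i ⟶ o j)
  map_id : ∀ i, map (𝟙 i) = 𝟙 (o i)
  map_comp : ∀ {i j k : J} (f : i ⟶ j) (g : j ⟶ k), map (f ≫ g) = map f ≫ map g

/-- An icon between two strict 2-functors that agree on objects: the components are 2-cells
`F f ⟶ G f`, compatible with identities and composition. -/
@[ext]
structure IconOn {o : J → A} (F G : ChainOn J o) where
  app : ∀ {i j : J} (f : i ⟶ j), F.map f ⟶ G.map f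
  app_id : ∀ i, app (𝟙 i) = eqToHom ((F.map_id i).trans (G.map_id i).symm)
  app_comp : ∀ {i j k : J} (f : i ⟶ j) (g : j ⟶ k), app (f ≫ g) =
    eqToHom (F.map_comp f g) ≫ (app f ▷ F.map g ≫ G.map f ◁ app g) ≫
      eqToHom (G.map_comp f g).symm

/-- Vertical composition of icons. -/
instance (o : J → A) : Category.{v} (ChainOn J o) where
  Hom F G := IconOn F G
  id F := { app := fun f => 𝟙 _, app_id := by simp, app_comp := by simp }
  comp s t :=
    { app := fun f => s.app f ≫ t.app f
      app_id := fun i => by rw [s.app_id, t.app_id, eqToHom_trans]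
      app_comp := fun f g => by
        rw [s.app_comp, t.app_comp]
        simp [Bicategory.whisker_exchange_assoc] }
  id_comp s := IconOn.ext (by ext; exact Category.id_comp _)
  comp_id s := IconOn.ext (by ext; exact Category.comp_id _)
  assoc s t r := IconOn.ext (by ext; exact Category.assoc _ _ _)

/-- An icon between strict 2-functors: they agree on objects, and there are 2-cells between their
values on 1-cells. -/
structure Icon {o o' : J → A} (F : ChainOn J o) (G : ChainOn J o') where
  eq : o = o'
  icon : (eq ▸ F) ⟶ G

namespace Icon

/-- An icon between 2-functors whose object functions are given as the same function. -/
def mk' {o : J → A} {F G : ChainOn J o} (s : F ⟶ G) : Icon F G := ⟨rfl, s⟩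

/-- Composition of icons. -/
def comp {o o' o'' : J → A} {F : ChainOn J o} {G : ChainOn J o'} {H : ChainOn J o''}
    (s : Icon F G) (t : Icon G H) : Icon F H := by
  obtain ⟨rfl, s⟩ := s
  obtain ⟨rfl, t⟩ := t
  exact mk' (s ≫ t)

end Icon

/-- A strict 2-functor from the category `J` to the 2-category `A`. -/
structure Chain (J : Type) [Category.{0} J] (A : Type w) [Bicategory.{v, u} A] where
  obj : J → A
  on : ChainOn J obj

/-- The category of strict 2-functors `J → A` and icons. -/
instance : Category.{v} (Chain J A) where
  Hom F G := Icon F.on G.on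
  id F := Icon.mk' (𝟙 F.on)
  comp s t := s.comp t
  id_comp := by
    rintro ⟨o, F⟩ ⟨o', G⟩ ⟨h, s⟩
    dsimp only at h s
    subst h
    exact congrArg Icon.mk' (Category.id_comp (X := F) s)
  comp_id := by
    rintro ⟨o, F⟩ ⟨o', G⟩ ⟨h, s⟩
    dsimp only at h s
    subst h
    exact congrArg Icon.mk' (Category.comp_id (X := F) s)
  assoc := by
    rintro ⟨o, F⟩ ⟨o', G⟩ ⟨o'', H⟩ ⟨o''', K⟩ ⟨h, s⟩ ⟨h', t⟩ ⟨h'', r⟩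
    dsimp only at h s h' t h'' r
    subst h
    subst h'
    subst h''
    exact congrArg Icon.mk' (Category.assoc (W := F) (X := G) (Y := H) (Z := K) s t r)

namespace ChainOn

/-- Restriction along a functor `J' ⥤ J`. -/
def pre (K : J' ⥤ J) (o : J → A) : ChainOn J o ⥤ ChainOn J' (fun j => o (K.obj j)) where
  obj F :=
    { map := fun f => F.map (K.map f)
      map_id := fun i => by rw [K.map_id, F.map_id]
      map_comp := fun f g => by rw [K.map_comp, F.map_comp] }
  map s :=
    { app := fun f => IconOn.app s (K.map f)
      app_id := fun i => by
        have : ∀ {i : J} (f : i ⟶ i) (h : f = 𝟙 i) e, IconOn.app s f = eqToHom e := by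
          rintro i f rfl e
          rw [s.app_id]
        exact this _ (K.map_id i) _
      app_comp := fun {i j k} f g => by
        have : ∀ (h : K.obj i ⟶ K.obj k) (e : h = K.map f ≫ K.map g) e1 e2, IconOn.app s h =
            eqToHom e1 ≫ (IconOn.app s (K.map f) ▷ _ ≫ _ ◁ IconOn.app s (K.map g)) ≫
              eqToHom e2 := by
          rintro h rfl e1 e2
          rw [s.app_comp]
        exact this _ (K.map_comp f g) _ _ }

/-- Postcomposition with a strict 2-functor. -/
def post {A B : TwoCat.{v, u, w}} (P : TwoCat.Fun A B) (o : J → A.carrier) :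
    ChainOn J o ⥤ ChainOn J (fun j => P.obj (o j)) where
  obj F :=
    { map := fun f => P.map (F.map f)
      map_id := fun i => by rw [F.map_id, P.map_id]
      map_comp := fun f g => by rw [F.map_comp, P.map_comp] }
  map s :=
    { app := fun f => P.map₂ (IconOn.app s f)
      app_id := fun i => by
        rw [IconOn.app_id s, PrelaxFunctor.map₂_eqToHom]
      app_comp := fun f g => by
        rw [IconOn.app_comp s]
        simp [P.map₂_whisker_left, P.map₂_whisker_right, PrelaxFunctor.map₂_eqToHom] }
  map_id F := IconOn.ext (by ext; exact P.map₂_id _)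
  map_comp s t := IconOn.ext (by ext; exact P.map₂_comp _ _)

end ChainOn

namespace Icon

def pre (K : J' ⥤ J) {o o' : J → A} {F : ChainOn J o} {G : ChainOn J o'} (s : Icon F G) :
    Icon ((ChainOn.pre K o).obj F) ((ChainOn.pre K o').obj G) := by
  obtain ⟨rfl, s⟩ := s
  exact mk' ((ChainOn.pre K o).map s)

def post {A B : TwoCat.{v, u, w}} (P : TwoCat.Fun A B) {o o' : J → A.carrier} {F : ChainOn J o}
    {G : ChainOn J o'} (s : Icon F G) :
    Icon ((ChainOn.post P o).obj F) ((ChainOn.post P o').obj G) := by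
  obtain ⟨rfl, s⟩ := s
  exact mk' ((ChainOn.post P o).map s)

end Icon

namespace Chain

def pre (K : J' ⥤ J) : Chain J A ⥤ Chain J' A where
  obj F := ⟨fun j => F.obj (K.obj j), (ChainOn.pre K F.obj).obj F.on⟩
  map s := Icon.pre K s
  map_id F := congrArg Icon.mk' ((ChainOn.pre K F.obj).map_id F.on)
  map_comp := by
    rintro ⟨o, F⟩ ⟨o', G⟩ ⟨o'', H⟩ ⟨h, s⟩ ⟨h', t⟩
    dsimp only at h s h' t
    subst h
    subst h'
    exact congrArg Icon.mk' ((ChainOn.pre K o).map_comp s t)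

def post {A B : TwoCat.{v, u, w}} (P : TwoCat.Fun A B) : Chain J A.carrier ⥤ Chain J B.carrier where
  obj F := ⟨fun j => P.obj (F.obj j), (ChainOn.post P F.obj).obj F.on⟩
  map s := Icon.post P s
  map_id F := congrArg Icon.mk' ((ChainOn.post P F.obj).map_id F.on)
  map_comp := by
    rintro ⟨o, F⟩ ⟨o', G⟩ ⟨o'', H⟩ ⟨h, s⟩ ⟨h', t⟩
    dsimp only at h s h' t
    subst h
    subst h'
    exact congrArg Icon.mk' ((ChainOn.post P o).map_comp s t)

theorem functor_ext {D : Type*} [Category* D] {S T : Chain J A ⥤ D} (hobj : ∀ F, S.obj F = T.obj F)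
    (hmap : ∀ (o : J → A) (F G : ChainOn J o) (s : F ⟶ G),
      S.map (X := ⟨o, F⟩) (Y := ⟨o, G⟩) (Icon.mk' s) ≍
        T.map (X := ⟨o, F⟩) (Y := ⟨o, G⟩) (Icon.mk' s)) : S = T := by
  refine Functor.hext hobj ?_
  rintro ⟨o, F⟩ ⟨o', G⟩ ⟨h, s⟩
  dsimp only at h s
  subst h
  exact hmap o F G s

theorem pre_id : pre (A := A) (𝟭 J) = 𝟭 (Chain J A) :=
  functor_ext (fun _ => rfl) fun _ _ _ _ => HEq.rfl

theorem pre_comp (K : J' ⥤ J) (K' : J'' ⥤ J') : pre (A := A) (K' ⋙ K) = pre K ⋙ pre K' :=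
  functor_ext (fun _ => rfl) fun _ _ _ _ => HEq.rfl

theorem post_id (A : TwoCat.{v, u, w}) : post (TwoCat.Fun.id A) = 𝟭 (Chain J A.carrier) :=
  functor_ext (fun _ => rfl) fun _ _ _ _ => HEq.rfl

theorem post_comp {A B D : TwoCat.{v, u, w}} (P : TwoCat.Fun A B) (R : TwoCat.Fun B D) :
    post (J := J) (P.comp R) = post P ⋙ post R :=
  functor_ext (fun _ => rfl) fun _ _ _ _ => HEq.rfl

theorem pre_post (K : J' ⥤ J) {A B : TwoCat.{v, u, w}} (P : TwoCat.Fun A B) :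
    pre K ⋙ post P = post P ⋙ pre K :=
  functor_ext (fun _ => rfl) fun _ _ _ _ => HEq.rfl

end Chain

end Nerve

/-- The monotone map underlying a morphism of the simplex category, as a functor. -/
abbrev simplexFun {p q : SimplexCategory} (α : p ⟶ q) : Fin (p.len + 1) ⥤ Fin (q.len + 1) :=
  α.toOrderHom.monotone.functor

/-- The nerve of 2-categories with values in simplicial categories: `(N A)_p` is the category of
strict 2-functors `[p] → A` and icons, where `[p] = {0 < ⋯ < p}`. -/
def nerve₂ : TwoCat.{v, u, w} ⥤ (SimplexCategoryᵒᵖ ⥤ Cat.{v, max u w}) where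
  obj A :=
    { obj := fun p => Cat.of (Chain (Fin (p.unop.len + 1)) A.carrier)
      map := fun α => (Chain.pre (simplexFun α.unop)).toCatHom
      map_id := fun p => Cat.ext Chain.pre_id
      map_comp := fun α β =>
        Cat.ext (Chain.pre_comp (simplexFun α.unop) (simplexFun β.unop)) }
  map P :=
    { app := fun p => (Chain.post P).toCatHom
      naturality := fun p q α => Cat.ext (Chain.pre_post _ P) }
  map_id A := by
    ext p
    exact Chain.post_id A
  map_comp P R := by
    ext p
    exact Chain.post_comp P R

end

section

namespace FinPt

/-- Pointed maps out of `m₊` given on the non-basepoint elements. -/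
def homMk {m n : FinPt} (f : Fin m.size → Option (Fin n.size)) : m ⟶ n :=
  ⟨fun x => x.bind f, rfl⟩

theorem hom_ext {m n : FinPt} {f g : m ⟶ n} (h : ∀ i, f.1 (some i) = g.1 (some i)) : f = g := by
  refine Subtype.ext (funext fun x => ?_)
  cases x with
  | none => exact f.2.trans g.2.symm
  | some i => exact h i

/-- The number of the element `(i, j)`, `i ∈ n`, `j ∈ p`, of the smash product: `p` consecutive
blocks, each a copy of `n`. -/
def pair {n p : ℕ} (i : Fin n) (j : Fin p) : Fin (p * n) := finProdFinEquiv (j, i)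

/-- `φ ∧ ψ` on the non-basepoint elements. -/
def smashFun {n n' p p' : FinPt} (φ : n ⟶ n') (ψ : p ⟶ p') (k : Fin (p.size * n.size)) :
    Option (Fin (p'.size * n'.size)) :=
  (φ.1 (some (finProdFinEquiv.symm k).2)).bind fun i =>
    (ψ.1 (some (finProdFinEquiv.symm k).1)).map fun j => pair i j

/-- The smash product `(n₊, p₊) ↦ (np)₊`. -/
def smash : FinPt × FinPt ⥤ FinPt where
  obj x := ⟨x.2.size * x.1.size⟩
  map f := homMk (smashFun f.1 f.2)
  map_id x := by
    refine hom_ext fun k => ?_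
    exact congrArg some (finProdFinEquiv.apply_symm_apply k)
  map_comp {x y z} f g := by
    refine hom_ext fun k => ?_
    change smashFun (f.1 ≫ g.1) (f.2 ≫ g.2) k = (smashFun f.1 f.2 k).bind (smashFun g.1 g.2)
    obtain ⟨⟨j, i⟩, rfl⟩ := finProdFinEquiv.surjective k
    simp only [smashFun, Equiv.symm_apply_apply]
    change (g.1.1 (f.1.1 (some i))).bind (fun i => (g.2.1 (f.2.1 (some j))).map fun j => pair i j) = _
    rcases h1 : f.1.1 (some i) with _ | i'
    · simp [g.1.2]
    rcases h2 : f.2.1 (some j) with _ | j'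
    · simp [g.2.2]
    change _ = smashFun g.1 g.2 (finProdFinEquiv (j', i'))
    simp only [smashFun, Equiv.symm_apply_apply]

/-- The map `p₊ → q₊` induced by `α : [q] → [p]`: `j` goes to `i` if
`α (i - 1) < j ≤ α i`, with `1 ≤ j ≤ p` and `1 ≤ i ≤ q`
(below, `j - 1` and `i - 1` are the elements of `Fin p` and `Fin q`). -/
def circleFun {q p : SimplexCategory} (α : q ⟶ p) (j : Fin p.len) : Option (Fin q.len) :=
  (List.finRange q.len).find? fun i =>
    (α.toOrderHom i.castSucc : ℕ) < j + 1 ∧ (j : ℕ) + 1 ≤ α.toOrderHom i.succ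

theorem circleFun_eq_some {q p : SimplexCategory} (α : q ⟶ p) (j : Fin p.len) (i : Fin q.len) :
    circleFun α j = some i ↔
      (α.toOrderHom i.castSucc : ℕ) < j + 1 ∧ (j : ℕ) + 1 ≤ α.toOrderHom i.succ := by
  constructor
  · intro h
    simpa using List.find?_some h
  · rintro ⟨h1, h2⟩
    rcases h : circleFun α j with _ | i'
    · have := List.find?_eq_none.1 h i (List.mem_finRange i)
      simp [h1, h2] at this
    · have h3 := List.find?_some h
      simp only [decide_eq_true_eq] at h3
      congr 1
      by_contra hne
      rcases lt_or_gt_of_ne hne with hlt | hlt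
      · have : α.toOrderHom i'.succ ≤ α.toOrderHom i.castSucc :=
          α.toOrderHom.monotone (by rw [Fin.le_def]; simp; omega)
        rw [Fin.le_def] at this
        omega
      · have : α.toOrderHom i.succ ≤ α.toOrderHom i'.castSucc :=
          α.toOrderHom.monotone (by rw [Fin.le_def]; simp; omega)
        rw [Fin.le_def] at this
        omega

theorem circle_aux {r q p : SimplexCategory} (β : r ⟶ q) (α : q ⟶ p) (j : Fin p.len)
    (k : Fin r.len) :
    (((β ≫ α).toOrderHom k.castSucc : ℕ) < j + 1 ∧ (j : ℕ) + 1 ≤ (β ≫ α).toOrderHom k.succ) ↔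
      ∃ i : Fin q.len,
        ((α.toOrderHom i.castSucc : ℕ) < j + 1 ∧ (j : ℕ) + 1 ≤ α.toOrderHom i.succ) ∧
          (β.toOrderHom k.castSucc : ℕ) < i + 1 ∧ (i : ℕ) + 1 ≤ β.toOrderHom k.succ := by
  change (((α.toOrderHom (β.toOrderHom k.castSucc) : Fin _) : ℕ) < j + 1 ∧
    (j : ℕ) + 1 ≤ (α.toOrderHom (β.toOrderHom k.succ) : Fin _)) ↔ _
  generalize β.toOrderHom k.castSucc = b
  generalize β.toOrderHom k.succ = b'
  constructor
  · rintro ⟨h1, h2⟩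
    induction b' using Fin.induction with
    | zero =>
      have : α.toOrderHom 0 ≤ α.toOrderHom b := α.toOrderHom.monotone (Fin.zero_le b)
      rw [Fin.le_def] at this
      omega
    | succ i ih =>
      by_cases h : (j : ℕ) + 1 ≤ α.toOrderHom i.castSucc
      · obtain ⟨i', h3, h4, h5⟩ := ih h
        refine ⟨i', h3, h4, h5.trans ?_⟩
        simp
      · refine ⟨i, ⟨by omega, h2⟩, ?_, by simp⟩
        by_contra hb
        have : α.toOrderHom i.succ ≤ α.toOrderHom b :=
          α.toOrderHom.monotone (by rw [Fin.le_def]; simp; omega)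
        rw [Fin.le_def] at this
        omega
  · rintro ⟨i, ⟨h1, h2⟩, h3, h4⟩
    have h5 : α.toOrderHom b ≤ α.toOrderHom i.castSucc :=
      α.toOrderHom.monotone (by rw [Fin.le_def]; simp; omega)
    have h6 : α.toOrderHom i.succ ≤ α.toOrderHom b' :=
      α.toOrderHom.monotone (by rw [Fin.le_def]; simp; omega)
    rw [Fin.le_def] at h5 h6
    omega

/-- The simplicial circle `Δᵒᵖ ⥤ F`, `[p] ↦ p₊`. -/
def circle : SimplexCategoryᵒᵖ ⥤ FinPt where
  obj p := ⟨p.unop.len⟩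
  map α := homMk (circleFun α.unop)
  map_id p := by
    refine hom_ext fun j => ?_
    change circleFun (𝟙 p.unop) j = some j
    rw [circleFun_eq_some]
    simp
  map_comp {p q r} α β := by
    refine hom_ext fun j => ?_
    change circleFun (β.unop ≫ α.unop) j = (circleFun α.unop j).bind (circleFun β.unop)
    refine Option.ext fun k => ?_
    rw [Option.bind_eq_some_iff]
    simp only [circleFun_eq_some]
    exact circle_aux β.unop α.unop j k

/-- `(n₊, [p]) ↦ n₊ ∧ p₊`. -/
def smashCircle : FinPt × SimplexCategoryᵒᵖ ⥤ FinPt := (𝟭 FinPt).prod circle ⋙ smash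

end FinPt

section

variable (C : Type u) [Category.{v} C] [MonoidalCategory C] [SymmetricCategory C]
  [StrictMonoidal C]

/-- The pseudofunctor `C^{(-)} : F → Cat`. -/
noncomputable def power : Pseudofunctor (LocallyDiscrete FinPt) Cat.{v, u} :=
  (powerMon C).comp StMonCat.forget

/-- The diagram `K_adj(ΣC)`, the functor of two variables `(n₊, [p]) ↦ N(Q((ΣC)^{(-)})(n₊))_p`. -/
noncomputable def Kadj : FinPt × SimplexCategoryᵒᵖ ⥤ Cat.{v, u} :=
  Functor.uncurry.obj (Q (powerMon C) ⋙ nerve₂)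

/-- The diagram `Q_j(C^{(-)}) ∘ ∧`, `(n₊, [p]) ↦ Q_j(C^{(-)})(n₊ ∧ p₊)`. -/
noncomputable def smashPower : FinPt × SimplexCategoryᵒᵖ ⥤ Cat.{v, u} :=
  FinPt.smashCircle ⋙ Qj (power C)

end

/-- There is a strict natural transformation from `X` to `Y` all of whose components are
equivalences of categories. -/
def LevelwiseEquiv {B : Type*} [Category* B] (X Y : B ⥤ Cat.{v, u}) : Prop :=
  ∃ f : X ⟶ Y, ∀ b, (f.app b).toFunctor.IsEquivalence

end

end SigmaK

/-! At a fixed `(n₊, [p])` both sides are models of `C^{np}`. An object of `Q_j(C^{(-)})(n₊ ∧ p₊)`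
is a formal image of a tuple under some pointed map into `n₊ ∧ p₊`, and its morphisms are those of
the actual images, that is, `np`-tuples of morphisms of `C`. An object of `K_adj(ΣC)` is a strict
functor from `[p]` to a one-object 2-category whose 1-cells are words; as `[p]` is free on its `p`
steps, it amounts to `p` words, each with a value in `C^n`, and an icon amounts to `p` morphisms
between these values. The difficulty is to compare the two models by strictly natural maps.

A formal image under an arbitrary map into `n₊ ∧ p₊` need not split into words. It does so under a
map `φ ∧ α`, where `φ : n₀ → n` is pointed and `α : [p] → [p₀]` is monotone. Let `x` be in
`C^{n₀p₀}`, with blocks `x_j` in `C^{n₀}`. Between positions `i ≤ i'` of `[p]` one takes the word of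
letters `φ_* x_j` with `α i ≤ j < α i'` (`Gen.chain`). This is strictly functorial in `i ≤ i'`
because segments concatenate (`seg_append`). It is strictly natural, since on both sides an arrow of
`F × Δᵒᵖ` acts by composition with the formal arrow (`Gen.chain_push`). The zigzag therefore passes
through the full subdiagram `(genSmash C).im` of `Q_j(C^{(-)}) ∘ ∧` on the formal images under
arrows `φ ∧ α`. Its inclusion is a levelwise equivalence because formal images under identities
already meet every isomorphism class (`genSmash_isEquivalence`).

On morphisms, a tuple `m` of morphisms of actual images goes to the icon whose component from `i` to
`i'` is the product of the `m_(k,l)` over the steps `l` from `i` to `i'`, conjugated by a symmetry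
`Gen.theta`. This symmetry exists because the simplicial circle distributes the steps of `[p₀]`
between `α i` and `α i'` over the steps of `[p]` between `i` and `i'` (`seg_mono_iff`,
`wordPres_perm`). On a single step nothing but `m_(-,l)` remains, which makes the functor fully
faithful. It is essentially surjective because every word is isomorphic to a one-letter word with
the same value (`chainF_isEquivalence`).

What remains is coherence. Every identity between structure isomorphisms compares two morphisms,
built from symmetries and associativities, between products of distinct variables. Such a morphism
is determined by its source and target. The principle is packaged as `Pres.IsCode.eq`: an
isomorphism is shown to permute factors by following its construction, and equality then follows
from `code_unique` and the absence of repetitions. Its main applications are `permIso_append`, by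
which the icons respect composition, and `wordComp_theta`, from which naturality on morphisms
(`cellMap_push`) follows. -/

namespace SigmaK

set_option linter.unusedSectionVars false

/-! ### Coherence: morphisms that permute the factors of a product of variables. -/

section Presentations

variable {ι κ : Type*} {C : Type u} [Category.{v} C] [MonoidalCategory C]

/-- An object of `C` depending on a family `x`, presented as a tensor product of members
of the family. -/
structure Pres (ι : Type*) (C : Type u) [Category.{v} C] [MonoidalCategory C] where
  obj : (ι → C) → C
  list : List ι
  iso : ∀ x, obj x ≅ tens x list

namespace Pres

/-- A single member of the family. -/
def var (i : ι) : Pres ι C := ⟨fun x => x i, [i], fun x => (ρ_ (x i)).symm⟩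

/-- The unit object. -/
def unit : Pres ι C := ⟨fun _ => 𝟙_ C, [], fun _ => Iso.refl _⟩

/-- The tensor product of two presented objects. -/
def tensor (A B : Pres ι C) : Pres ι C :=
  ⟨fun x => A.obj x ⊗ B.obj x, A.list ++ B.list,
    fun x => (A.iso x ⊗ᵢ B.iso x) ≪≫ (appIso x A.list B.list).symm⟩

/-- The presentation of an iterated tensor product. -/
def tensIso (A : κ → Pres ι C) (x : ι → C) :
    ∀ l : List κ, tens (fun k => (A k).obj x) l ≅ tens x (flat (fun k => (A k).list) l)
  | [] => Iso.refl _
  | k :: l => ((A k).iso x ⊗ᵢ tensIso A x l) ≪≫ (appIso x _ _).symm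

/-- The tensor product of a list of presented objects. -/
def tens (A : κ → Pres ι C) (l : List κ) : Pres ι C :=
  ⟨fun x => SigmaK.tens (fun k => (A k).obj x) l, flat (fun k => (A k).list) l,
    fun x => tensIso A x l⟩

/-- Reassociation moves no factor, so on lists it is the equality of the two bracketings of a
concatenation; the content is the coherence of `appIso` with associators. -/
theorem associator_comp_iso (A B D : Pres ι C) (x : ι → C) :
    (α_ (A.obj x) (B.obj x) (D.obj x)).hom ≫ ((A.tensor (B.tensor D)).iso x).hom =
      (((A.tensor B).tensor D).iso x).hom ≫
        eqToHom (congrArg (SigmaK.tens x) (List.append_assoc A.list B.list D.list)) := by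
  have h := appIso_inv_eqToHom x A.list B.list D.list (by rw [List.append_assoc])
  change (α_ (A.obj x) (B.obj x) (D.obj x)).hom ≫
    ((A.iso x).hom ⊗ₘ (((B.iso x).hom ⊗ₘ (D.iso x).hom) ≫ (appIso x B.list D.list).inv)) ≫
      (appIso x A.list (B.list ++ D.list)).inv =
    (((((A.iso x).hom ⊗ₘ (B.iso x).hom) ≫ (appIso x A.list B.list).inv) ⊗ₘ (D.iso x).hom) ≫
      (appIso x (A.list ++ B.list) D.list).inv) ≫ eqToHom _
  rw [Category.assoc, h]
  have e1 : ((((A.iso x).hom ⊗ₘ (B.iso x).hom) ≫ (appIso x A.list B.list).inv) ⊗ₘ (D.iso x).hom) ≫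
      (appIso x A.list B.list).hom ▷ SigmaK.tens x D.list =
      (((A.iso x).hom ⊗ₘ (B.iso x).hom) ⊗ₘ (D.iso x).hom) := by
    rw [← tensorHom_id, tensorHom_comp_tensorHom]
    simp
  rw [reassoc_of% e1, associator_naturality_assoc, ← id_tensorHom, tensorHom_comp_tensorHom_assoc,
    Category.comp_id]

/-- The lists `l ++ []` and `l` are equal but not definitionally so, hence the `eqToHom`; the left
unit needs none. -/
theorem rightUnitor_comp_iso (A : Pres ι C) (x : ι → C) :
    (ρ_ (A.obj x)).hom ≫ (A.iso x).hom =
      ((A.tensor unit).iso x).hom ≫ eqToHom (congrArg (SigmaK.tens x) (List.append_nil A.list)) := by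
  have h : (appIso x A.list []).inv =
      (ρ_ _).hom ≫ eqToHom (congrArg (SigmaK.tens x) (List.append_nil A.list).symm) := by
    rw [← cancel_epi (appIso x A.list []).hom, Iso.hom_inv_id, appIso_nil]
    simp
  change _ = (((A.iso x).hom ⊗ₘ 𝟙 (𝟙_ C)) ≫ (appIso x A.list []).inv) ≫
    eqToHom (congrArg (SigmaK.tens x) (List.append_nil A.list))
  rw [h, Category.assoc, Category.assoc, eqToHom_trans, eqToHom_refl, Category.comp_id]
  simp

variable [SymmetricCategory C]

/-- The family of morphisms `f` permutes the factors of the presented objects. -/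
def IsCode (A B : Pres ι C) (f : ∀ x, A.obj x ⟶ B.obj x) : Prop :=
  ∃ r : Code A.list B.list, ∀ x, f x ≫ (B.iso x).hom = (A.iso x).hom ≫ r.hom x

namespace IsCode

/-- The coherence principle. The presentations are isomorphisms, so `f` and `g` are determined by
their codes, and there is at most one code into a list without repetitions. The morphisms must be
given for all `x` at once: the variables are distinct even when the objects substituted for them are
not. -/
theorem eq {A B : Pres ι C} {f g : ∀ x, A.obj x ⟶ B.obj x} (hf : IsCode A B f)
    (hg : IsCode A B g) (h : A.list.Nodup) (x : ι → C) : f x = g x := by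
  obtain ⟨r, hr⟩ := hf
  obtain ⟨s, hs⟩ := hg
  rw [← cancel_mono (B.iso x).hom, hr, hs, code_unique r s (r.perm.nodup_iff.1 h)]

theorem id (A : Pres ι C) : IsCode A A fun _ => 𝟙 _ :=
  ⟨.refl _, fun x => by simp [Code.refl_hom]⟩

theorem comp {A B D : Pres ι C} {f : ∀ x, A.obj x ⟶ B.obj x} {g : ∀ x, B.obj x ⟶ D.obj x}
    (hf : IsCode A B f) (hg : IsCode B D g) : IsCode A D fun x => f x ≫ g x := by
  obtain ⟨r, hr⟩ := hf
  obtain ⟨s, hs⟩ := hg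
  obtain ⟨t, ht⟩ := code_comp (C := C) r s
  exact ⟨t, fun x => by rw [Category.assoc, hs, reassoc_of% hr, ht]⟩

theorem of_eq {A B : Pres ι C} {f g : ∀ x, A.obj x ⟶ B.obj x} (hf : IsCode A B f)
    (h : ∀ x, f x = g x) : IsCode A B g := by
  obtain rfl : f = g := funext h
  exact hf

/-- Codes are juxtaposed by `code_append`. With composition this gives the closure properties by
which all later isomorphisms are recognised as permutations. -/
theorem tensor {A B A' B' : Pres ι C} {f : ∀ x, A.obj x ⟶ A'.obj x}
    {g : ∀ x, B.obj x ⟶ B'.obj x} (hf : IsCode A A' f) (hg : IsCode B B' g) :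
    IsCode (A.tensor B) (A'.tensor B') fun x => f x ⊗ₘ g x := by
  obtain ⟨r, hr⟩ := hf
  obtain ⟨s, hs⟩ := hg
  obtain ⟨t, ht⟩ := code_append (C := C) r s
  refine ⟨t, fun x => ?_⟩
  have ht := ht x
  rw [← Iso.eq_comp_inv, Category.assoc] at ht
  change (f x ⊗ₘ g x) ≫ ((A'.iso x).hom ⊗ₘ (B'.iso x).hom) ≫ (appIso x A'.list B'.list).inv =
    (((A.iso x).hom ⊗ₘ (B.iso x).hom) ≫ (appIso x A.list B.list).inv) ≫
      (t.hom x : SigmaK.tens x (A.list ++ B.list) ⟶ SigmaK.tens x (A'.list ++ B'.list))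
  rw [ht, tensorHom_comp_tensorHom_assoc, hr, hs, ← tensorHom_comp_tensorHom_assoc,
    Category.assoc, Iso.inv_hom_id_assoc]

theorem whiskerLeft (A : Pres ι C) {B B' : Pres ι C} {g : ∀ x, B.obj x ⟶ B'.obj x}
    (hg : IsCode B B' g) : IsCode (A.tensor B) (A.tensor B') fun x => A.obj x ◁ g x :=
  ((id A).tensor hg).of_eq fun _ => id_tensorHom _ _

theorem whiskerRight {A A' : Pres ι C} {f : ∀ x, A.obj x ⟶ A'.obj x} (hf : IsCode A A' f)
    (B : Pres ι C) : IsCode (A.tensor B) (A'.tensor B) fun x => f x ▷ B.obj x :=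
  (hf.tensor (id B)).of_eq fun _ => tensorHom_id _ _

/-- Serves the structure isomorphisms that move no factor but whose lists agree only
propositionally; the code is the identity transported along the equality. -/
theorem of_list_eq {A B : Pres ι C} (h : A.list = B.list) {f : ∀ x, A.obj x ⟶ B.obj x}
    (hf : ∀ x, f x ≫ (B.iso x).hom = (A.iso x).hom ≫ eqToHom (by rw [h])) : IsCode A B f := by
  obtain ⟨r, hr⟩ := code_of_eq (C := C) h
  exact ⟨r, fun x => by rw [hf, hr]⟩

theorem associator (A B D : Pres ι C) :
    IsCode ((A.tensor B).tensor D) (A.tensor (B.tensor D)) fun _ => (α_ _ _ _).hom :=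
  of_list_eq (A := (A.tensor B).tensor D) (B := A.tensor (B.tensor D)) (List.append_assoc _ _ _)
    (associator_comp_iso A B D)

theorem inv_of_list_eq {A B : Pres ι C} (h : A.list = B.list) {f : ∀ x, A.obj x ≅ B.obj x}
    (hf : ∀ x, (f x).hom ≫ (B.iso x).hom = (A.iso x).hom ≫ eqToHom (by rw [h])) :
    IsCode B A fun x => (f x).inv := by
  refine of_list_eq h.symm fun x => ?_
  rw [Iso.inv_comp_eq, reassoc_of% hf]
  simp

theorem associator_inv (A B D : Pres ι C) :
    IsCode (A.tensor (B.tensor D)) ((A.tensor B).tensor D) fun _ => (α_ _ _ _).inv :=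
  inv_of_list_eq (A := (A.tensor B).tensor D) (B := A.tensor (B.tensor D))
    (f := fun x => α_ (A.obj x) (B.obj x) (D.obj x)) (List.append_assoc _ _ _)
    (associator_comp_iso A B D)

theorem leftUnitor (A : Pres ι C) : IsCode (unit.tensor A) A fun _ => (λ_ _).hom := by
  refine ⟨.refl _, fun x => ?_⟩
  change (λ_ (A.obj x)).hom ≫ (A.iso x).hom = ((𝟙 (𝟙_ C) ⊗ₘ (A.iso x).hom) ≫ (λ_ _).hom) ≫
    (Code.refl A.list).hom x
  rw [Code.refl_hom]
  simp

theorem leftUnitor_inv (A : Pres ι C) : IsCode A (unit.tensor A) fun _ => (λ_ _).inv := by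
  refine ⟨.refl _, fun x => ?_⟩
  change (λ_ (A.obj x)).inv ≫ (𝟙 (𝟙_ C) ⊗ₘ (A.iso x).hom) ≫ (λ_ _).hom =
    (A.iso x).hom ≫ (Code.refl A.list).hom x
  rw [Code.refl_hom]
  simp

theorem rightUnitor_inv (A : Pres ι C) : IsCode A (A.tensor unit) fun _ => (ρ_ _).inv :=
  inv_of_list_eq (A := A.tensor unit) (f := fun x => ρ_ (A.obj x)) (List.append_nil _)
    (rightUnitor_comp_iso A)

/-- The symmetry exchanges two blocks of variables, which is the code of `code_swap`; naturality of
the braiding carries it over to presented objects. -/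
theorem braiding (A B : Pres ι C) : IsCode (A.tensor B) (B.tensor A) fun _ => (β_ _ _).hom := by
  obtain ⟨r, hr⟩ := code_swap (C := C) A.list B.list
  refine ⟨r, fun x => ?_⟩
  have h := hr x
  rw [← Iso.eq_comp_inv, Category.assoc] at h
  change (β_ (A.obj x) (B.obj x)).hom ≫ ((B.iso x).hom ⊗ₘ (A.iso x).hom) ≫
    (appIso x B.list A.list).inv = (((A.iso x).hom ⊗ₘ (B.iso x).hom) ≫
      (appIso x A.list B.list).inv) ≫
        (r.hom x : SigmaK.tens x (A.list ++ B.list) ⟶ SigmaK.tens x (B.list ++ A.list))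
  rw [h, Category.assoc, Iso.inv_hom_id_assoc, BraidedCategory.braiding_naturality_assoc]

/-- The interchange is by definition a symmetry of the two middle factors between reassociations. -/
theorem tensorμ (A B A' B' : Pres ι C) :
    IsCode ((A.tensor B).tensor (A'.tensor B')) ((A.tensor A').tensor (B.tensor B'))
      fun x => MonoidalCategory.tensorμ (A.obj x) (B.obj x) (A'.obj x) (B'.obj x) :=
  (associator _ _ _).comp ((whiskerLeft A (associator_inv _ _ _)).comp
    ((whiskerLeft A ((braiding B A').whiskerRight B')).comp
      ((whiskerLeft A (associator _ _ _)).comp (associator_inv _ _ _))))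

theorem sw (A B D : Pres ι C) : IsCode (A.tensor (B.tensor D)) (B.tensor (A.tensor D))
    fun x => SigmaK.sw (A.obj x) (B.obj x) (D.obj x) :=
  (associator_inv _ _ _).comp (((braiding A B).whiskerRight D).comp (associator _ _ _))

variable {μ : Type*}

/-- A presented product over a list unfolds to iterated binary products. Here and below, the
induction over the list therefore repeats the recursive definition of the morphism and needs only
the closure properties. -/
theorem tensMap {A B : κ → Pres ι C} {f : ∀ k x, (A k).obj x ⟶ (B k).obj x}
    (hf : ∀ k, IsCode (A k) (B k) (f k)) (l : List κ) :
    IsCode (tens A l) (tens B l) fun x => SigmaK.tensMap (fun k => f k x) l := by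
  induction l with
  | nil => exact id unit
  | cons k l ih => exact (hf k).tensor ih

theorem appIso_hom (A : κ → Pres ι C) (a b : List κ) :
    IsCode (tens A (a ++ b)) ((tens A a).tensor (tens A b))
      fun x => (appIso (fun k => (A k).obj x) a b).hom := by
  induction a with
  | nil => exact leftUnitor_inv _
  | cons k a ih => exact (whiskerLeft (A k) ih).comp (associator_inv _ _ _)

theorem appIso_inv (A : κ → Pres ι C) (a b : List κ) :
    IsCode ((tens A a).tensor (tens A b)) (tens A (a ++ b))
      fun x => (appIso (fun k => (A k).obj x) a b).inv := by
  induction a with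
  | nil => exact leftUnitor _
  | cons k a ih => exact (associator _ _ _).comp (whiskerLeft (A k) ih)

theorem bindIso_hom (A : κ → Pres ι C) (f : μ → List κ) (l : List μ) :
    IsCode (tens (fun j => tens A (f j)) l) (tens A (flat f l))
      fun x => (bindIso (fun k => (A k).obj x) f l).hom := by
  induction l with
  | nil => exact id unit
  | cons j l ih => exact (whiskerLeft _ ih).comp (appIso_inv A _ _)

theorem bindIso_inv (A : κ → Pres ι C) (f : μ → List κ) (l : List μ) :
    IsCode (tens A (flat f l)) (tens (fun j => tens A (f j)) l)
      fun x => (bindIso (fun k => (A k).obj x) f l).inv := by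
  induction l with
  | nil => exact id unit
  | cons j l ih => exact (appIso_hom A _ _).comp (whiskerLeft _ ih)

theorem ins (A : κ → Pres ι C) {k : κ} {l l' : List κ} (p : Ins k l l') :
    IsCode ((A k).tensor (tens A l)) (tens A l') fun x => p.hom fun k => (A k).obj x := by
  induction p with
  | head l => exact id _
  | tail j p ih => exact (sw _ _ _).comp (whiskerLeft (A j) ih)

/-- A permutation of blocks permutes the variables inside them; this allows substitution of
presented objects for variables. -/
theorem code (A : κ → Pres ι C) {l l' : List κ} (p : Code l l') :
    IsCode (tens A l) (tens A l') fun x => p.hom fun k => (A k).obj x := by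
  induction p with
  | nil => exact id unit
  | cons p q ih => exact (whiskerLeft _ ih).comp (ins A p)

theorem tensMu (A B : κ → Pres ι C) (l : List κ) :
    IsCode ((tens A l).tensor (tens B l)) (tens (fun k => (A k).tensor (B k)) l)
      fun x => SigmaK.tensMu (fun k => (A k).obj x) (fun k => (B k).obj x) l := by
  induction l with
  | nil => exact leftUnitor _
  | cons k l ih => exact (tensorμ _ _ _ _).comp (whiskerLeft _ ih)

theorem tensEps (l : List κ) :
    IsCode unit (tens (fun _ => (unit : Pres ι C)) l) fun _ => SigmaK.tensEps l := by
  induction l with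
  | nil => exact id unit
  | cons k l ih => exact ih.comp (leftUnitor_inv _)

end IsCode

end Pres

end Presentations

/-! ### Values of words whose letters depend on a family of objects. -/

section Words

variable {ι κ S S' : Type*} {K : Type} {C : Type u} [Category.{v} C] [MonoidalCategory C]

namespace Pres

variable (ev : S → K → C) (g : (ι → C) → κ → S) (lst : κ → K → List ι)
  (e : ∀ j k x, ev (g x j) k ≅ SigmaK.tens x (lst j k))

/-- The components of the values of letters that depend on a family, presented as given. -/
def letter (j : κ) (k : K) : Pres ι C := ⟨fun x => ev (g x j) k, lst j k, e j k⟩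

/-- The presentation of the components of the value of a word. -/
def wordIso (k : K) (x : ι → C) : ∀ L : List κ,
    (SigmaK.tens ev (L.map (g x)) : K → C) k ≅ SigmaK.tens x (flat (fun j => lst j k) L)
  | [] => Iso.refl _
  | j :: L => (e j k x ⊗ᵢ wordIso k x L) ≪≫ (appIso x _ _).symm

/-- A component of the value of a word whose letters depend on a family. -/
def word (L : List κ) (k : K) : Pres ι C :=
  ⟨fun x => (SigmaK.tens ev (L.map (g x)) : K → C) k, flat (fun j => lst j k) L,
    fun x => wordIso ev g lst e k x L⟩

variable [SymmetricCategory C]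

/-- The comparison of the value of a concatenation with the product of the values. -/
theorem isCode_word_append (a b : List κ) (k : K)
    (h : ∀ x, SigmaK.tens ev ((a ++ b).map (g x)) = SigmaK.tens ev (a.map (g x) ++ b.map (g x))) :
    IsCode (word ev g lst e (a ++ b) k) ((word ev g lst e a k).tensor (word ev g lst e b k))
      fun x => (eqToHom (h x) ≫ (appIso ev (a.map (g x)) (b.map (g x))).hom) k := by
  induction a with
  | nil => exact (IsCode.leftUnitor_inv _).of_eq fun x => (Category.id_comp _).symm
  | cons j a ih =>
    have h' : ∀ x, SigmaK.tens ev ((a ++ b).map (g x)) =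
        SigmaK.tens ev (a.map (g x) ++ b.map (g x)) := fun x => by rw [List.map_append]
    refine ((IsCode.whiskerLeft (letter ev g lst e j k) (ih h')).comp
      (IsCode.associator_inv _ _ _)).of_eq fun x => ?_
    -- The two lists share their first letter, so the equality of values acts on the tail only.
    have e1 : eqToHom (h x) = ev (g x j) ◁ eqToHom (h' x) := (whiskerLeft_eqToHom' _ _).symm
    rw [e1]
    change _ = (ev (g x j) ◁ eqToHom (h' x) ≫ ev (g x j) ◁ (appIso ev (a.map (g x))
      (b.map (g x))).hom ≫ (α_ (ev (g x j)) (SigmaK.tens ev (a.map (g x)))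
        (SigmaK.tens ev (b.map (g x)))).inv) k
    rw [← whiskerLeft_comp_assoc]
    rfl

end Pres

open Pres Functor.LaxMonoidal Functor.Monoidal

variable [SymmetricCategory C] {m n : FinPt} (ψ : m ⟶ n)
  {ev : S → Fin m.size → C} {ev' : S' → Fin n.size → C} {p : S → S'}
  (c : ∀ s, ev' (p s) ≅ (pushF C ψ).obj (ev s))

/-- The comparison of the value of a word after and before the action of `ψ` permutes the factors
if this is so for letters. -/
theorem isCode_xi (g : (ι → C) → κ → S) (lst : κ → Fin m.size → List ι)
    (e : ∀ j k x, ev (g x j) k ≅ SigmaK.tens x (lst j k))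
    (lst' : κ → Fin n.size → List ι)
    (e' : ∀ j k x, ev' (p (g x j)) k ≅ SigmaK.tens x (lst' j k))
    (hc : ∀ j k, IsCode (letter ev' (fun x j => p (g x j)) lst' e' j k)
      (Pres.tens (letter ev g lst e j) (FinPt.fib ψ k)) fun x => (c (g x j)).hom k)
    (L : List κ) (k : Fin n.size)
    (h : ∀ x, SigmaK.tens ev' (L.map fun j => p (g x j)) =
      SigmaK.tens ev' ((L.map (g x)).map p)) :
    IsCode (word ev' (fun x j => p (g x j)) lst' e' L k)
      (Pres.tens (word ev g lst e L) (FinPt.fib ψ k))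
      fun x => (eqToHom (h x) ≫ (xi (pushF C ψ) c (L.map (g x))).hom) k := by
  induction L with
  | nil =>
    -- On the empty word the comparison is the unit constraint of `pushF C ψ`, which is `tensEps`
    -- over each fibre.
    exact (IsCode.tensEps (FinPt.fib ψ k)).of_eq fun x => (Category.id_comp _).symm
  | cons j L ih =>
    have h' : ∀ x, SigmaK.tens ev' (L.map fun j => p (g x j)) =
      SigmaK.tens ev' ((L.map (g x)).map p) := fun x => by rw [List.map_map]; rfl
    -- In coordinate `k` the tensor constraint of `pushF C ψ` is `tensMu` over the fibre of `ψ` over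
    -- `k`.
    refine ((hc j k).tensor (ih h')).comp (IsCode.tensMu (letter ev g lst e j)
      (word ev g lst e L) (FinPt.fib ψ k)) |>.of_eq fun x => ?_
    have e1 : eqToHom (h x) = ev' (p (g x j)) ◁ eqToHom (h' x) := (whiskerLeft_eqToHom' _ _).symm
    rw [e1]
    change _ = (ev' (p (g x j)) ◁ eqToHom (h' x) ≫ ((c (g x j)).hom ⊗ₘ
      (xi (pushF C ψ) c (L.map (g x))).hom) ≫ μ (pushF C ψ) (ev (g x j))
        (SigmaK.tens ev (L.map (g x)))) k
    rw [← id_tensorHom, tensorHom_comp_tensorHom_assoc, Category.id_comp]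
    rfl

end Words

/-! ### Chains and icons in a one-object 2-category. -/

section Cells

variable {J J' : Type} [Category.{0} J] [Category.{0} J']
  {D : Type u} [Category.{v} D] [MonoidalCategory D]

/-- The value of a chain in a one-object 2-category, as an object of the monoidal category. -/
abbrev Chain.val (F : Chain J (MonoidalSingleObj D)) {i j : J} (f : i ⟶ j) : D := F.on.map f

/-- A chain in a one-object 2-category. -/
def Chain.ofVal (M : ∀ {i j : J}, (i ⟶ j) → D) (h1 : ∀ i, M (𝟙 i) = 𝟙_ D)
    (h2 : ∀ {i j k : J} (f : i ⟶ j) (g : j ⟶ k), M (f ≫ g) = M f ⊗ M g) :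
    Chain J (MonoidalSingleObj D) :=
  ⟨fun _ => MonoidalSingleObj.star D, ⟨fun f => M f, h1, h2⟩⟩

/-- There is only one object, so the object functions agree automatically and only the 1-cells have
to be compared. -/
theorem Chain.ext_val {F G : Chain J (MonoidalSingleObj D)}
    (h : ∀ {i j : J} (f : i ⟶ j), F.val f = G.val f) : F = G := by
  obtain ⟨o, F⟩ := F
  obtain ⟨o', G⟩ := G
  obtain rfl : o = o' := funext fun _ => rfl
  congr 1
  exact ChainOn.ext (by funext i j f; exact h f)

theorem Chain.val_id (F : Chain J (MonoidalSingleObj D)) (i : J) : F.val (𝟙 i) = 𝟙_ D :=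
  F.on.map_id i

theorem Chain.val_comp (F : Chain J (MonoidalSingleObj D)) {i j k : J} (f : i ⟶ j) (g : j ⟶ k) :
    F.val (f ≫ g) = F.val f ⊗ F.val g :=
  F.on.map_comp f g

namespace Icon

/-- The components of an icon in a one-object 2-category, as morphisms of the monoidal category. -/
def cell {F G : Chain J (MonoidalSingleObj D)} (s : F ⟶ G) {i j : J} (f : i ⟶ j) :
    F.val f ⟶ G.val f := by
  obtain ⟨o, F⟩ := F
  obtain ⟨o', G⟩ := G
  obtain ⟨h, s⟩ := s
  dsimp only at h s
  subst h
  exact IconOn.app s f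

/-- An icon in a one-object 2-category. -/
def ofCell {F G : Chain J (MonoidalSingleObj D)}
    (c : ∀ {i j : J} (f : i ⟶ j), F.val f ⟶ G.val f)
    (h1 : ∀ i, c (𝟙 i) = eqToHom ((F.val_id i).trans (G.val_id i).symm))
    (h2 : ∀ {i j k : J} (f : i ⟶ j) (g : j ⟶ k), c (f ≫ g) =
      eqToHom (F.val_comp f g) ≫ (c f ⊗ₘ c g) ≫ eqToHom (G.val_comp f g).symm) : F ⟶ G := by
  obtain ⟨o, F⟩ := F
  obtain ⟨o', G⟩ := G
  obtain rfl : o = o' := funext fun _ => rfl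
  -- The axiom of an icon is phrased with two whiskerings, whose composite is the tensor product of
  -- the cells.
  exact mk' ⟨fun f => c f, h1, fun f g => (h2 f g).trans (by
    rw [MonoidalCategory.tensorHom_def]; rfl)⟩

variable {F G H : Chain J (MonoidalSingleObj D)}

/-- An icon carries an equality of object functions. Here and in the following lemmas this equality
is eliminated first, after which both icons live over the same object function. -/
theorem cell_ext {s t : F ⟶ G} (hst : ∀ {i j : J} (f : i ⟶ j), cell s f = cell t f) : s = t := by
  obtain ⟨o, F⟩ := F
  obtain ⟨o', G⟩ := G
  obtain ⟨h, s⟩ := s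
  obtain ⟨h', t⟩ := t
  dsimp only at h s
  subst h
  congr 1
  exact IconOn.ext (by funext i j f; exact hst f)

@[simp]
theorem cell_comp (s : F ⟶ G) (t : G ⟶ H) {i j : J} (f : i ⟶ j) :
    cell (s ≫ t) f = cell s f ≫ cell t f := by
  obtain ⟨o, F⟩ := F
  obtain ⟨o', G⟩ := G
  obtain ⟨o'', H⟩ := H
  obtain ⟨h, s⟩ := s
  obtain ⟨h', t⟩ := t
  dsimp only at h s h' t
  subst h
  subst h'
  rfl

theorem cell_eqToHom (h : F = G) {i j : J} (f : i ⟶ j) :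
    cell (eqToHom h) f = eqToHom (by rw [h]) := by
  subst h
  rfl

theorem cell_map_id (s : F ⟶ G) (i : J) :
    cell s (𝟙 i) = eqToHom ((F.val_id i).trans (G.val_id i).symm) := by
  obtain ⟨o, F⟩ := F
  obtain ⟨o', G⟩ := G
  obtain ⟨h, s⟩ := s
  dsimp only at h s
  subst h
  exact s.app_id i

theorem cell_map_comp (s : F ⟶ G) {i j k : J} (f : i ⟶ j) (g : j ⟶ k) :
    cell s (f ≫ g) =
      eqToHom (F.val_comp f g) ≫ (cell s f ⊗ₘ cell s g) ≫ eqToHom (G.val_comp f g).symm := by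
  obtain ⟨o, F⟩ := F
  obtain ⟨o', G⟩ := G
  obtain ⟨h, s⟩ := s
  dsimp only at h s
  subst h
  refine (s.app_comp f g).trans ?_
  rw [MonoidalCategory.tensorHom_def]
  rfl

theorem cell_pre (K : J' ⥤ J) (s : F ⟶ G) {i j : J'} (f : i ⟶ j) :
    cell ((Chain.pre K).map s) f = cell s (K.map f) := by
  obtain ⟨o, F⟩ := F
  obtain ⟨o', G⟩ := G
  obtain ⟨h, s⟩ := s
  dsimp only at h s
  subst h
  rfl

theorem cell_post {D E : Type u} [Category.{v} D] [MonoidalCategory D] [StrictMonoidal D]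
    [Category.{v} E] [MonoidalCategory E] [StrictMonoidal E] (T : D ⥤ E) (h1 h2 hl hr)
    {F G : Chain J (MonoidalSingleObj D)} (s : F ⟶ G) {i j : J} (f : i ⟶ j) :
    cell (F := (Chain.post (suspMap T h1 h2 hl hr)).obj F)
      (G := (Chain.post (suspMap T h1 h2 hl hr)).obj G)
      ((Chain.post (suspMap T h1 h2 hl hr)).map s) f = T.map (cell s f) := by
  obtain ⟨o, F⟩ := F
  obtain ⟨o', G⟩ := G
  obtain ⟨h, s⟩ := s
  dsimp only at h s
  subst h
  rfl

end Icon

end Cells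

/-! ### The category `[p]` is free on its steps. -/

section Steps

variable {p : ℕ} {D : Type u} [Category.{v} D] [MonoidalCategory D]

/-- The morphism from `l` to `l + 1` in `[p]`. -/
def stepHom (l : Fin p) : l.castSucc ⟶ l.succ := homOfLE l.castSucc_lt_succ.le

/-- A property of morphisms of `[p]` holds if it holds for identities and is inherited by
composition with steps. -/
theorem fin_hom_induction {P : ∀ {i j : Fin (p + 1)}, (i ⟶ j) → Prop} (hid : ∀ i, P (𝟙 i))
    (hstep : ∀ {i : Fin (p + 1)} (l : Fin p) (f : i ⟶ l.castSucc), P f → P (f ≫ stepHom l))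
    {i j : Fin (p + 1)} (f : i ⟶ j) : P f := by
  induction j using Fin.induction with
  | zero =>
    obtain rfl : i = 0 := le_antisymm (leOfHom f) (Fin.zero_le _)
    exact hid 0
  | succ l ih =>
    -- A morphism into `l + 1` is an identity or factors through the last step; that `f` equals the
    -- composite is automatic in a poset.
    rcases eq_or_lt_of_le (leOfHom f) with rfl | h
    · exact hid _
    · exact hstep l (homOfLE (Fin.le_castSucc_iff.2 h)) (ih _)

/-- Every morphism of `[p]` is a composite of steps, and a chain turns composites into tensor
products. -/
theorem Chain.ext_step {F G : Chain (Fin (p + 1)) (MonoidalSingleObj D)}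
    (h : ∀ l, F.val (stepHom l) = G.val (stepHom l)) : F = G := by
  refine Chain.ext_val fun f => ?_
  induction f using fin_hom_induction with
  | hid i => rw [F.val_id, G.val_id]
  | hstep l f ih => rw [F.val_comp, G.val_comp, ih, h]

/-- The icon axioms express the cell of a composite through the cells of its factors, so the cells
on steps determine all others. -/
theorem Icon.ext_step {F G : Chain (Fin (p + 1)) (MonoidalSingleObj D)} {s t : F ⟶ G}
    (h : ∀ l, cell s (stepHom l) = cell t (stepHom l)) : s = t := by
  refine Icon.cell_ext fun f => ?_
  induction f using fin_hom_induction with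
  | hid i => rw [cell_map_id, cell_map_id]
  | hstep l f ih => rw [cell_map_comp, cell_map_comp, ih, h]

/-- The elements `l` with `a ≤ l < b`, listed increasingly; they number the steps from
`a` to `b`. -/
def seg (a b : Fin (p + 1)) : List (Fin p) :=
  (List.finRange p).filter fun l => a ≤ l.castSucc ∧ l.castSucc < b

theorem mem_seg {a b : Fin (p + 1)} {l : Fin p} :
    l ∈ seg a b ↔ a ≤ l.castSucc ∧ l.castSucc < b := by
  simp [seg]

theorem seg_nodup (a b : Fin (p + 1)) : (seg a b).Nodup := (List.nodup_finRange _).filter _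

theorem seg_self (a : Fin (p + 1)) : seg a a = [] := by
  rw [List.eq_nil_iff_forall_not_mem]
  intro l hl
  rw [mem_seg] at hl
  exact absurd hl.1 (not_le.2 hl.2)

/-- Both lists are strictly increasing with the same members, and a strictly increasing list is
determined by its members. This additivity is what makes chains indexed by segments strictly
functorial. -/
theorem seg_append {a b c : Fin (p + 1)} (hab : a ≤ b) (hbc : b ≤ c) :
    seg a c = seg a b ++ seg b c := by
  have hs : (List.finRange p).Pairwise (· < ·) := List.pairwise_lt_finRange p
  have h1 : (seg a c).Pairwise (· < ·) := hs.filter _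
  have h2 : (seg a b ++ seg b c).Pairwise (· < ·) := by
    refine List.pairwise_append.2 ⟨hs.filter _, hs.filter _, fun l hl l' hl' => ?_⟩
    rw [mem_seg] at hl hl'
    exact Fin.castSucc_lt_castSucc_iff.1 (hl.2.trans_le hl'.1)
  refine List.Perm.eq_of_pairwise' (r := (· < ·)) h1 h2
    ((List.perm_ext_iff_of_nodup (seg_nodup _ _) (h2.imp ne_of_lt)).2 fun l => ?_)
  rw [List.mem_append, mem_seg, mem_seg, mem_seg]
  constructor
  · rintro ⟨h, h'⟩
    rcases lt_or_ge l.castSucc b with hl | hl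
    · exact .inl ⟨h, hl⟩
    · exact .inr ⟨hl, h'⟩
  · rintro (⟨h, h'⟩ | ⟨h, h'⟩)
    · exact ⟨h, h'.trans_le hbc⟩
    · exact ⟨hab.trans h, h'⟩

theorem seg_step (l : Fin p) : seg l.castSucc l.succ = [l] := by
  refine List.perm_singleton.1 ((List.perm_ext_iff_of_nodup (seg_nodup _ _)
    (List.nodup_singleton l)).2 fun i => ?_)
  rw [mem_seg, List.mem_singleton, Fin.castSucc_le_castSucc_iff, Fin.castSucc_lt_succ_iff]
  exact ⟨fun h => le_antisymm h.2 h.1, fun h => by simp [h]⟩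

end Steps

/-! ### Chains of words and icons between them, given on steps. -/

section ChainOfWords

variable {p : ℕ} {S : Type*} {D : Type u} [Category.{v} D] [MonoidalCategory D] {ev : S → D}

/-- The chain with given steps. -/
def chainOf (W : Fin p → Word ev) : Chain (Fin (p + 1)) (MonoidalSingleObj (Word ev)) :=
  Chain.ofVal (fun {i j} _ => ⟨flat (fun l => (W l).letters) (seg i j)⟩)
    (fun i => by rw [seg_self]; rfl)
    (fun f g => by rw [seg_append (leOfHom f) (leOfHom g), flat_append]; rfl)

theorem chainOf_step (W : Fin p → Word ev) (l : Fin p) :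
    (chainOf W).val (stepHom l) = W l := by
  change Word.mk (flat (fun l => (W l).letters) (seg l.castSucc l.succ)) = _
  rw [seg_step]
  -- Flattening over the one-element segment `[l]` leaves the letters of `W l` followed by an empty
  -- list.
  exact congrArg Word.mk (List.append_nil _)

/-- Chains of words are thus the same as tuples of words, which reduces isomorphisms of chains to
isomorphisms of steps. -/
theorem eq_chainOf (F : Chain (Fin (p + 1)) (MonoidalSingleObj (Word ev))) :
    F = chainOf fun l => F.val (stepHom l) :=
  Chain.ext_step fun l => (chainOf_step (fun l => F.val (stepHom l)) l).symm

variable {W W' W'' : Fin p → Word ev}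

/-- The components of the icon with given steps. -/
def chainOfCell (m : ∀ l, (W l).val ⟶ (W' l).val) (L : List (Fin p)) :
    tens ev (flat (fun l => (W l).letters) L) ⟶ tens ev (flat (fun l => (W' l).letters) L) :=
  (bindIso ev (fun l => (W l).letters) L).inv ≫ tensMap m L ≫
    (bindIso ev (fun l => (W' l).letters) L).hom

/-- The list is a variable with an equation, so that the equation can be substituted; `seg i i` is
empty only propositionally. The same device is used for concatenations. -/
theorem chainOfCell_nil (m : ∀ l, (W l).val ⟶ (W' l).val) {L : List (Fin p)} (h : L = [])
    (e : tens ev (flat (fun l => (W l).letters) L) = tens ev (flat (fun l => (W' l).letters) L)) :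
    chainOfCell m L = eqToHom e := by
  subst h
  simp [chainOfCell, tensMap, bindIso]

variable [SymmetricCategory D]

/-- The compatibility of an icon with composition: `bindIso_append` splits the regrouping
isomorphisms of source and target along the concatenation, and `appIso_natural` moves the morphisms
of steps past the splitting. -/
theorem chainOfCell_append (m : ∀ l, (W l).val ⟶ (W' l).val) {L a b : List (Fin p)}
    (h : L = a ++ b)
    (e : tens ev (flat (fun l => (W l).letters) L) =
      tens ev (flat (fun l => (W l).letters) a ++ flat (fun l => (W l).letters) b))
    (e' : tens ev (flat (fun l => (W' l).letters) a ++ flat (fun l => (W' l).letters) b) =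
      tens ev (flat (fun l => (W' l).letters) L)) :
    chainOfCell m L = eqToHom e ≫
      ((appIso ev _ _).hom ≫ (chainOfCell m a ⊗ₘ chainOfCell m b) ≫ (appIso ev _ _).inv) ≫
        eqToHom e' := by
  subst h
  have h := bindIso_append ev (fun l => (W l).letters) a b e
  have hW' := bindIso_append ev (fun l => (W' l).letters) a b e'.symm
  have hn := appIso_natural m a b
  rw [chainOfCell, Iso.inv_comp_eq]
  have e1 : ((bindIso ev (fun l => (W l).letters) a).hom ⊗ₘ
      (bindIso ev (fun l => (W l).letters) b).hom) ≫ (chainOfCell m a ⊗ₘ chainOfCell m b) =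
      (tensMap m a ⊗ₘ tensMap m b) ≫ ((bindIso ev (fun l => (W' l).letters) a).hom ⊗ₘ
      (bindIso ev (fun l => (W' l).letters) b).hom) := by
    simp [chainOfCell, tensorHom_comp_tensorHom]
  simp only [Category.assoc]
  rw [← reassoc_of% h, reassoc_of% e1, ← reassoc_of% hn, reassoc_of% hW']
  simp

/-- The icon with given steps. -/
def chainOfMap (m : ∀ l, (W l).val ⟶ (W' l).val) : chainOf W ⟶ chainOf W' :=
  Icon.ofCell (F := chainOf W) (G := chainOf W') (fun {i j} _ => chainOfCell m (seg i j))
    (fun i => (chainOfCell_nil m (seg_self i) _).trans (Word.eqToHom_eq _).symm)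
    (fun {i j k} f g => by
      rw [Word.eqToHom_eq, Word.eqToHom_eq]
      exact chainOfCell_append m (seg_append (leOfHom f) (leOfHom g)) _ _)

theorem chainOfMap_comp (m : ∀ l, (W l).val ⟶ (W' l).val) (m' : ∀ l, (W' l).val ⟶ (W'' l).val) :
    chainOfMap m ≫ chainOfMap m' = chainOfMap fun l => m l ≫ m' l := by
  refine Icon.cell_ext fun {i j} f => ?_
  rw [Icon.cell_comp]
  change CategoryStruct.comp (obj := D) (chainOfCell m (seg i j)) (chainOfCell m' (seg i j)) =
    chainOfCell (fun l => m l ≫ m' l) (seg i j)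
  simp [chainOfCell, tensMap_comp]

theorem chainOfMap_id (W : Fin p → Word ev) : chainOfMap (fun l => 𝟙 (W l).val) = 𝟙 _ := by
  refine Icon.cell_ext fun {i j} f => ?_
  change (bindIso ev (fun l => (W l).letters) (seg i j)).inv ≫ tensMap (fun l => 𝟙 (W l).val) _ ≫
    (bindIso ev (fun l => (W l).letters) _).hom = 𝟙 _
  rw [tensMap_id, Category.id_comp, Iso.inv_hom_id]

/-- Chains with isomorphic steps are isomorphic. -/
def chainOfIso (m : ∀ l, (W l).val ≅ (W' l).val) : chainOf W ≅ chainOf W' where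
  hom := chainOfMap fun l => (m l).hom
  inv := chainOfMap fun l => (m l).inv
  hom_inv_id := by simp [chainOfMap_comp, chainOfMap_id]
  inv_hom_id := by simp [chainOfMap_comp, chainOfMap_id]

end ChainOfWords

/-! ### Full subdiagrams of a diagram of categories. -/

section FullImage

/-- Absorbs the equalities of objects that arise when a conjugated morphism is mapped and conjugated
again, as in `imMap_comp`. All objects are variables, so that the equalities can be substituted. -/
theorem map_conj_eqToHom {D E : Type*} [Category* D] [Category* E] (T : D ⥤ E) {a a' b b' : D}
    {c c' d d' : E} (f : a' ⟶ b') (h₁ : c = c') (h₂ : c' = T.obj a) (h₃ : a = a') (h₄ : b' = b)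
    (h₅ : T.obj b = d') (h₆ : d' = d) (h₇ : c = T.obj a') (h₈ : T.obj b' = d) :
    eqToHom h₇ ≫ T.map f ≫ eqToHom h₈ = eqToHom h₁ ≫ (eqToHom h₂ ≫
      T.map (eqToHom h₃ ≫ f ≫ eqToHom h₄) ≫ eqToHom h₅) ≫ eqToHom h₆ := by
  subst h₁ h₂ h₃ h₄ h₅ h₆
  simp

variable {B : Type*} [Category* B] {X : B ⥤ Cat.{v, u}}

/-- A family of objects of the categories `X b`, indexed by sets on which `B` acts compatibly. -/
structure ObjFamily (X : B ⥤ Cat.{v, u}) where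
  idx : B → Type u
  act : ∀ {b b' : B}, (b ⟶ b') → idx b → idx b'
  act_id : ∀ {b : B} (o : idx b), act (𝟙 b) o = o
  act_comp : ∀ {b b' b'' : B} (k : b ⟶ b') (k' : b' ⟶ b'') (o : idx b),
    act (k ≫ k') o = act k' (act k o)
  obj : ∀ {b : B}, idx b → X.obj b
  natural : ∀ {b b' : B} (k : b ⟶ b') (o : idx b),
    obj (act k o) = (X.map k).toFunctor.obj (obj o)

namespace ObjFamily

variable (e : ObjFamily X)

/-- The full image at `b` of a family of objects. -/
abbrev Im (b : B) : Type u := InducedCategory (X.obj b) (e.obj (b := b))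

theorem Im.eqToHom_hom {b : B} {o o' : e.Im b} (h : o = o') :
    (eqToHom h).hom = eqToHom (congrArg e.obj h) := by
  subst h
  rfl

/-- The action of `B` on the full images. -/
def imMap {b b' : B} (k : b ⟶ b') : e.Im b ⥤ e.Im b' where
  obj o := e.act k o
  map {o o'} m := InducedCategory.homMk (eqToHom (e.natural k o) ≫ (X.map k).toFunctor.map m.hom ≫
    eqToHom (e.natural k o').symm)
  map_id o := by ext; simp
  map_comp f g := by ext; simp

theorem imMap_obj_id {b : B} (o : e.Im b) : (e.imMap (𝟙 b)).obj o = (𝟭 (e.Im b)).obj o :=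
  e.act_id o

theorem imMap_obj_comp {b b' b'' : B} (k : b ⟶ b') (k' : b' ⟶ b'') (o : e.Im b) :
    (e.imMap (k ≫ k')).obj o = (e.imMap k ⋙ e.imMap k').obj o :=
  e.act_comp k k' o

/-- The index sets carry a strict action, so objects agree on the nose; on morphisms the action of
`X` is conjugated by equalities that cancel. -/
theorem imMap_id (b : B) : e.imMap (𝟙 b) = 𝟭 (e.Im b) := by
  refine CategoryTheory.Functor.ext (e.imMap_obj_id) fun o o' m => ?_
  refine InducedCategory.hom_ext ?_
  have h := Functor.congr_hom (congrArg Cat.Hom.toFunctor (X.map_id b)) m.hom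
  rw [InducedCategory.comp_hom, InducedCategory.comp_hom, Im.eqToHom_hom, Im.eqToHom_hom]
  change eqToHom _ ≫ (X.map (𝟙 b)).toFunctor.map m.hom ≫ eqToHom _ = eqToHom _ ≫ m.hom ≫ eqToHom _
  rw [h]
  simp

theorem imMap_comp {b b' b'' : B} (k : b ⟶ b') (k' : b' ⟶ b'') :
    e.imMap (k ≫ k') = e.imMap k ⋙ e.imMap k' := by
  refine CategoryTheory.Functor.ext (e.imMap_obj_comp k k') fun o o' m => ?_
  refine InducedCategory.hom_ext ?_
  have h := Functor.congr_hom (congrArg Cat.Hom.toFunctor (X.map_comp k k')) m.hom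
  rw [InducedCategory.comp_hom, InducedCategory.comp_hom, Im.eqToHom_hom, Im.eqToHom_hom]
  change eqToHom _ ≫ (X.map (k ≫ k')).toFunctor.map m.hom ≫ eqToHom _ =
    eqToHom _ ≫ (eqToHom _ ≫ (X.map k').toFunctor.map
      (eqToHom _ ≫ (X.map k).toFunctor.map m.hom ≫ eqToHom _) ≫ eqToHom _) ≫ eqToHom _
  rw [h]
  refine Eq.trans ?_ (map_conj_eqToHom (X.map k').toFunctor ((X.map k).toFunctor.map m.hom)
    _ _ _ _ _ _ ((e.natural _ o).trans (by rw [X.map_comp]; rfl))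
    (((e.natural _ o').trans (by rw [X.map_comp]; rfl)).symm))
  simp

/-- The full images form a functor. -/
def im : B ⥤ Cat.{v, u} where
  obj b := Cat.of (e.Im b)
  map k := (e.imMap k).toCatHom
  map_id b := Cat.ext (e.imMap_id b)
  map_comp k k' := Cat.ext (ObjFamily.imMap_comp (k := k) (k' := k') (e := e))

/-- The inclusion of the full image. -/
def imι : e.im ⟶ X where
  app b := (inducedFunctor (e.obj (b := b))).toCatHom
  naturality b b' k := by
    refine Cat.ext (CategoryTheory.Functor.ext (fun o => e.natural k o) fun o o' m => ?_)
    -- The action on the full image was defined as precisely the conjugate that an equality of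
    -- functors asks for.
    rfl

/-- The inclusion is fully faithful by construction, so only essential surjectivity is at stake. -/
theorem imι_isEquivalence {b : B} (h : ∀ x : X.obj b, ∃ o : e.idx b, Nonempty (e.obj o ≅ x)) :
    (e.imι.app b).toFunctor.IsEquivalence := by
  have : (inducedFunctor (e.obj (b := b))).EssSurj := ⟨h⟩
  exact { faithful := inferInstanceAs (inducedFunctor (e.obj (b := b))).Faithful
          full := inferInstanceAs (inducedFunctor (e.obj (b := b))).Full
          essSurj := this }

end ObjFamily

end FullImage

/-! ### Formal images under arrows of the form `φ ∧ α`, and the combinatorics of their fibres. -/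

section Generators

/-- A formal image under `arr` of an object of `C^{n₀ ∧ p₀}`, where `base = (n₀, [p₀])`. -/
structure Gen (C : Type u) (b : FinPt × SimplexCategoryᵒᵖ) : Type u where
  base : FinPt × SimplexCategoryᵒᵖ
  arr : base ⟶ b
  pt : Fin (base.2.unop.len * base.1.size) → C

namespace Gen

variable {C : Type u} {b : FinPt × SimplexCategoryᵒᵖ} (o : Gen C b)

/-- The monotone map by which the second component of `arr` is given. -/
abbrev mono (i : Fin (b.2.unop.len + 1)) : Fin (o.base.2.unop.len + 1) :=
  o.arr.2.unop.toOrderHom i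

theorem mono_le {i j : Fin (b.2.unop.len + 1)} (h : i ≤ j) : o.mono i ≤ o.mono j :=
  o.arr.2.unop.toOrderHom.monotone h

/-- A smash product of maps collapses a pair as soon as one coordinate goes to the base point;
otherwise it acts coordinatewise, and the numbering of pairs is injective. -/
theorem smash_pair (i : Fin o.base.1.size) (j : Fin o.base.2.unop.len) (k : Fin b.1.size)
    (l : Fin b.2.unop.len) :
    (FinPt.smashCircle.map o.arr).1 (some (FinPt.pair i j)) = some (FinPt.pair k l) ↔
      o.arr.1.1 (some i) = some k ∧ FinPt.circleFun o.arr.2.unop j = some l := by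
  change FinPt.smashFun o.arr.1 (FinPt.circle.map o.arr.2) (finProdFinEquiv (j, i)) = _ ↔ _
  simp only [FinPt.smashFun, Equiv.symm_apply_apply]
  change (o.arr.1.1 (some i)).bind (fun i' =>
    (FinPt.circleFun o.arr.2.unop j).map fun j' => FinPt.pair i' j') = _ ↔ _
  have hp : ∀ (i' : Fin b.1.size) (j' : Fin b.2.unop.len),
      FinPt.pair i' j' = FinPt.pair k l ↔ i' = k ∧ j' = l := fun i' j' => by
    simp [FinPt.pair, and_comm]
  rcases o.arr.1.1 (some i) with _ | i' <;> rcases FinPt.circleFun o.arr.2.unop j with _ | j' <;>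
    simp [hp]

/-- The fibre of the map of smash products. -/
def fibS (q : Fin (b.2.unop.len * b.1.size)) : List (Fin (o.base.2.unop.len * o.base.1.size)) :=
  FinPt.fib (FinPt.smashCircle.map o.arr) q

theorem mem_fibS (q : Fin (b.2.unop.len * b.1.size))
    (r : Fin (o.base.2.unop.len * o.base.1.size)) :
    r ∈ o.fibS q ↔ (FinPt.smashCircle.map o.arr).1 (some r) = some q :=
  FinPt.mem_fib (FinPt.smashCircle.map o.arr) q r

theorem fibS_nodup (q : Fin (b.2.unop.len * b.1.size)) : (o.fibS q).Nodup := FinPt.fib_nodup _ _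

/-- The combinatorial core. Step `j` runs from `j` to `j + 1`, and the circle sends it to the step
`l` with `α l ≤ j < α (l + 1)`. The intervals `[α l, α (l + 1))`, for `i ≤ l < i'`, together fill
`[α i, α i')`. -/
theorem seg_mono_iff (i i' : Fin (b.2.unop.len + 1)) (j : Fin o.base.2.unop.len) :
    j ∈ seg (o.mono i) (o.mono i') ↔
      ∃ l ∈ seg i i', FinPt.circleFun o.arr.2.unop j = some l := by
  simp only [mem_seg, FinPt.circleFun_eq_some]
  change _ ↔ ∃ l : Fin b.2.unop.len, (i ≤ l.castSucc ∧ l.castSucc < i') ∧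
    (o.mono l.castSucc : ℕ) < j + 1 ∧ (j : ℕ) + 1 ≤ o.mono l.succ
  constructor
  · rintro ⟨h1, h2⟩
    -- The induction looks for the interval containing `j`: either `j` already lies below `α l`, or
    -- `l` is the step sought.
    induction i' using Fin.induction with
    | zero => exact absurd (h2.trans_le (o.mono_le (Fin.zero_le i))) (not_lt.2 h1)
    | succ l ih =>
      by_cases h : j.castSucc < o.mono l.castSucc
      · obtain ⟨l', h3, h4⟩ := ih h
        exact ⟨l', ⟨h3.1, h3.2.trans l.castSucc_lt_succ⟩, h4⟩
      · refine ⟨l, ⟨?_, l.castSucc_lt_succ⟩, ?_, ?_⟩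
        -- If `l < i`, then `j < α (l + 1) ≤ α i ≤ j`.
        · by_contra hi
          have := o.mono_le (Fin.castSucc_lt_iff_succ_le.1 (not_le.1 hi))
          exact absurd (h2.trans_le this) (not_lt.2 h1)
        · rw [not_lt, Fin.le_def, Fin.val_castSucc] at h
          omega
        · rw [Fin.lt_def, Fin.val_castSucc] at h2
          omega
  · rintro ⟨l, ⟨h1, h2⟩, h3, h4⟩
    have h5 := o.mono_le h1
    have h6 := o.mono_le (Fin.castSucc_lt_iff_succ_le.1 h2)
    rw [Fin.le_def] at h5 h6 ⊢
    rw [Fin.lt_def, Fin.val_castSucc]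
    omega

end Gen

variable (C : Type u) [Category.{v} C] [MonoidalCategory C] [SymmetricCategory C]
  [StrictMonoidal C]

/-- The family of objects of `Q_j(C^{(-)}) ∘ ∧` that are formal images under arrows of the form
`φ ∧ ψ`. -/
noncomputable def genSmash : ObjFamily (smashPower C) where
  idx := Gen C
  act k o := ⟨o.base, o.arr ≫ k, o.pt⟩
  act_id o := by
    obtain ⟨c, h, x⟩ := o
    change Gen.mk c (h ≫ 𝟙 _) x = _
    rw [Category.comp_id]
  act_comp k k' o := by
    obtain ⟨c, h, x⟩ := o
    change Gen.mk c (h ≫ k ≫ k') x = Gen.mk c ((h ≫ k) ≫ k') x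
    rw [Category.assoc]
  obj {b} o := (⟨FinPt.smashCircle.obj o.base, FinPt.smashCircle.map o.arr, o.pt⟩ :
    QjObj (power C) (FinPt.smashCircle.obj b))
  natural {b b'} k o := by
    change QjObj.mk (X := power C) _ (FinPt.smashCircle.map (o.arr ≫ k)) _ =
      QjObj.mk (X := power C) _ (FinPt.smashCircle.map o.arr ≫ FinPt.smashCircle.map k) _
    rw [Functor.map_comp]

/-- Isomorphisms of `(Q_j X)(a)` from isomorphisms of `X a`. -/
def QjObj.isoMk {A : Type w} [Category.{w'} A] {X : Pseudofunctor (LocallyDiscrete A) Cat.{v, u}}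
    {a : A} {q r : QjObj X a} (i : q.ev ≅ r.ev) : q ≅ r where
  hom := i.hom
  inv := i.inv
  hom_inv_id := i.hom_inv_id
  inv_hom_id := i.inv_hom_id

/-- Morphisms of `Q_j` only see actual images, so every object is isomorphic to the formal image of
its own actual value under an identity, and identities are of the form `φ ∧ α`. -/
theorem genSmash_isEquivalence (b : FinPt × SimplexCategoryᵒᵖ) :
    (((genSmash C).imι).app b).toFunctor.IsEquivalence := by
  refine ObjFamily.imι_isEquivalence _ fun (q : QjObj (power C) (FinPt.smashCircle.obj b)) => ?_
  refine ⟨⟨b, 𝟙 b, q.ev⟩, ⟨?_⟩⟩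
  refine QjObj.isoMk (X := power C)
    (q := ⟨FinPt.smashCircle.obj b, FinPt.smashCircle.map (𝟙 b), q.ev⟩) (r := q)
    -- The smash product of identities is only propositionally an identity, hence the equality
    -- before the unit isomorphism.
    (eqToIso ?_ ≪≫ QjObj.unt (power C) q.ev)
  change (QjObj.act (power C) (FinPt.smashCircle.map (𝟙 b))).obj q.ev = _
  rw [CategoryTheory.Functor.map_id]

variable {C} {b : FinPt × SimplexCategoryᵒᵖ}

namespace Gen

variable (o : Gen C b)

/-- The value of a letter of `Q(C^{(-)})` in `C^n`. -/
noncomputable abbrev evL {n : FinPt} (q : QLet (powerMon C) n) : Fin n.size → C := QLet.ev q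

/-- The `j`-th letter of the word associated with a formal image. -/
noncomputable def lett (x : Fin (o.base.2.unop.len * o.base.1.size) → C) (j : Fin o.base.2.unop.len) :
    QLet (powerMon C) b.1 :=
  ⟨o.base.1, o.arr.1, fun i => x (FinPt.pair i j)⟩

/-- The presentation of a component of the value of a letter. -/
def lettPres (j : Fin o.base.2.unop.len) (k : Fin b.1.size) :
    Pres (Fin (o.base.2.unop.len * o.base.1.size)) C :=
  Pres.tens (fun i => Pres.var (FinPt.pair i j)) (FinPt.fib o.arr.1 k)

/-- The presentation of a component of the value of a word. -/
noncomputable def wordPres (L : List (Fin o.base.2.unop.len)) (k : Fin b.1.size) :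
    Pres (Fin (o.base.2.unop.len * o.base.1.size)) C :=
  Pres.word evL o.lett (fun j k => (o.lettPres j k).list) (fun j k x => (o.lettPres j k).iso x) L k

/-- The presentation of the `q`-th coordinate of the actual image. -/
def imPres (q : Fin (b.2.unop.len * b.1.size)) :
    Pres (Fin (o.base.2.unop.len * o.base.1.size)) C :=
  Pres.tens Pres.var (o.fibS q)

/-- The presentation of a product of coordinates of the actual image. -/
def prodPres (L : List (Fin b.2.unop.len)) (k : Fin b.1.size) :
    Pres (Fin (o.base.2.unop.len * o.base.1.size)) C :=
  Pres.tens (fun l => o.imPres (FinPt.pair k l)) L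

/-- The variable at `(i, j)` can occur only in the letter `j`, and there only once. This is what the
coherence principle requires of words. -/
theorem wordPres_nodup {L : List (Fin o.base.2.unop.len)} (hL : L.Nodup) (k : Fin b.1.size) :
    (o.wordPres L k).list.Nodup := by
  refine flat_nodup _ _ hL (fun j => flat_nodup _ _ (FinPt.fib_nodup _ _)
    (fun i => List.nodup_singleton _) ?_) ?_
  · intro i i' q h h'
    have := (List.mem_singleton.1 h).symm.trans (List.mem_singleton.1 h')
    simpa [FinPt.pair] using this
  · intro j j' q h h'
    obtain ⟨i, -, h⟩ := (mem_flat _ _ _).1 h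
    obtain ⟨i', -, h'⟩ := (mem_flat _ _ _).1 h'
    have := (List.mem_singleton.1 h).symm.trans (List.mem_singleton.1 h')
    simp only [FinPt.pair, EmbeddingLike.apply_eq_iff_eq, Prod.mk.injEq] at this
    exact this.1

/-- Distinct coordinates of the actual image involve disjoint sets of variables, since fibres over
distinct points are disjoint. -/
theorem prodPres_nodup {L : List (Fin b.2.unop.len)} (hL : L.Nodup) (k : Fin b.1.size) :
    (o.prodPres L k).list.Nodup := by
  refine flat_nodup _ _ hL (fun l => flat_nodup _ _ (o.fibS_nodup _)
    (fun i => List.nodup_singleton _) ?_) ?_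
  · intro i i' q h h'
    exact (List.mem_singleton.1 h).symm.trans (List.mem_singleton.1 h')
  · intro j j' q h h'
    obtain ⟨i, hi, h⟩ := (mem_flat _ _ _).1 h
    obtain ⟨i', hi', h'⟩ := (mem_flat _ _ _).1 h'
    obtain rfl := List.mem_singleton.1 h
    obtain rfl := List.mem_singleton.1 h'
    rw [mem_fibS] at hi hi'
    have := Option.some.inj (hi.symm.trans hi')
    simp only [FinPt.pair, EmbeddingLike.apply_eq_iff_eq, Prod.mk.injEq] at this
    exact this.1

theorem mem_wordPres {L : List (Fin o.base.2.unop.len)} {k : Fin b.1.size}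
    {i : Fin o.base.1.size} {j : Fin o.base.2.unop.len} :
    FinPt.pair i j ∈ (o.wordPres L k).list ↔ j ∈ L ∧ o.arr.1.1 (some i) = some k := by
  change FinPt.pair i j ∈ flat (fun j => flat (fun i => [FinPt.pair i j]) (FinPt.fib o.arr.1 k)) L ↔ _
  simp only [mem_flat, FinPt.mem_fib, List.mem_singleton]
  constructor
  · rintro ⟨j', hj, i', hi, h⟩
    simp only [FinPt.pair, EmbeddingLike.apply_eq_iff_eq, Prod.mk.injEq] at h
    exact ⟨h.1 ▸ hj, h.2 ▸ hi⟩
  · rintro ⟨hj, hi⟩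
    exact ⟨j, hj, i, hi, rfl⟩

theorem mem_prodPres {L : List (Fin b.2.unop.len)} {k : Fin b.1.size}
    {i : Fin o.base.1.size} {j : Fin o.base.2.unop.len} :
    FinPt.pair i j ∈ (o.prodPres L k).list ↔
      ∃ l ∈ L, o.arr.1.1 (some i) = some k ∧ FinPt.circleFun o.arr.2.unop j = some l := by
  change FinPt.pair i j ∈ flat (fun l => flat (fun i => [i]) (o.fibS (FinPt.pair k l))) L ↔ _
  simp only [mem_flat, mem_fibS, List.mem_singleton, exists_eq_right']
  exact exists_congr fun l => and_congr_right fun _ => o.smash_pair i j k l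

/-- Neither list has repetitions, so only members matter: both consist of the pairs `(i', j')` with
`φ i' = k` and `j'` over a step between `i` and `j`, by `seg_mono_iff`. -/
theorem wordPres_perm (i j : Fin (b.2.unop.len + 1)) (k : Fin b.1.size) :
    (o.wordPres (seg (o.mono i) (o.mono j)) k).list.Perm (o.prodPres (seg i j) k).list := by
  refine (List.perm_ext_iff_of_nodup (o.wordPres_nodup (seg_nodup _ _) k)
    (o.prodPres_nodup (seg_nodup _ _) k)).2 fun q => ?_
  obtain ⟨⟨j', i'⟩, rfl⟩ := finProdFinEquiv.surjective q
  change FinPt.pair i' j' ∈ _ ↔ FinPt.pair i' j' ∈ _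
  rw [mem_wordPres, mem_prodPres, seg_mono_iff]
  constructor
  · rintro ⟨⟨l, hl, h⟩, h'⟩
    exact ⟨l, hl, h', h⟩
  · rintro ⟨l, hl, h', h⟩
    exact ⟨⟨l, hl, h⟩, h'⟩

end Gen

end Generators

/-! ### From morphisms of actual images to icons. -/

section Comparison

variable {C : Type u} [Category.{v} C] [MonoidalCategory C] [SymmetricCategory C]

/-- The isomorphism of presented objects that permutes the factors. -/
noncomputable def Pres.permIso {ι : Type*} (A B : Pres ι C) (h : A.list.Perm B.list)
    (hB : B.list.Nodup) (x : ι → C) : A.obj x ≅ B.obj x :=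
  A.iso x ≪≫ SigmaK.permIso x h hB ≪≫ (B.iso x).symm

theorem Pres.isCode_permIso {ι : Type*} (A B : Pres ι C) (h : A.list.Perm B.list)
    (hB : B.list.Nodup) : IsCode A B fun x => (permIso A B h hB x).hom :=
  ⟨Code.ofPerm h, fun x => by simp [permIso, SigmaK.permIso]⟩

variable [StrictMonoidal C] {b : FinPt × SimplexCategoryᵒᵖ}

namespace Gen

variable (o o' o'' : Gen C b)

/-- The chain associated with a formal image. -/
noncomputable def chain :
    Chain (Fin (b.2.unop.len + 1)) (MonoidalSingleObj (QWord (powerMon C) b.1)) :=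
  Chain.ofVal (fun {i j} _ => ⟨(seg (o.mono i) (o.mono j)).map (o.lett o.pt)⟩)
    (fun i => by rw [seg_self]; rfl)
    (fun f g => by
      rw [seg_append (o.mono_le (leOfHom f)) (o.mono_le (leOfHom g)), List.map_append]; rfl)

/-- The actual image of a formal one. -/
def img (q : Fin (b.2.unop.len * b.1.size)) : C := tens o.pt (o.fibS q)

/-- The comparison of the value of the word between `i` and `j` with the product of
coordinates of the actual image. -/
noncomputable def theta (i j : Fin (b.2.unop.len + 1)) (k : Fin b.1.size) :
    (tens evL ((seg (o.mono i) (o.mono j)).map (o.lett o.pt)) : Fin b.1.size → C) k ≅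
      tens (fun l => o.img (FinPt.pair k l)) (seg i j) :=
  Pres.permIso (o.wordPres (seg (o.mono i) (o.mono j)) k) (o.prodPres (seg i j) k)
    (o.wordPres_perm i j k) (o.prodPres_nodup (seg_nodup i j) k) o.pt

variable {o' o''}

variable {o}

/-- The components of the icon associated with a morphism between actual images. -/
noncomputable def cellMap (m : ∀ q, o.img q ⟶ o'.img q) (i j : Fin (b.2.unop.len + 1)) :
    (tens evL ((seg (o.mono i) (o.mono j)).map (o.lett o.pt)) : Fin b.1.size → C) ⟶
      tens evL ((seg (o'.mono i) (o'.mono j)).map (o'.lett o'.pt)) :=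
  fun k => (o.theta i j k).hom ≫ tensMap (fun l => m (FinPt.pair k l)) (seg i j) ≫
    (o'.theta i j k).inv

theorem cellMap_comp (m : ∀ q, o.img q ⟶ o'.img q) (m' : ∀ q, o'.img q ⟶ o''.img q)
    (i j : Fin (b.2.unop.len + 1)) :
    cellMap m i j ≫ cellMap m' i j = cellMap (fun q => m q ≫ m' q) i j := by
  funext k
  change ((o.theta i j k).hom ≫ tensMap (fun l => m (FinPt.pair k l)) (seg i j) ≫
    (o'.theta i j k).inv) ≫ (o'.theta i j k).hom ≫ tensMap (fun l => m' (FinPt.pair k l))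
      (seg i j) ≫ (o''.theta i j k).inv = (o.theta i j k).hom ≫
        tensMap (fun l => m (FinPt.pair k l) ≫ m' (FinPt.pair k l)) (seg i j) ≫
          (o''.theta i j k).inv
  rw [tensMap_comp]
  simp

theorem cellMap_id (i j : Fin (b.2.unop.len + 1)) :
    cellMap (fun q => 𝟙 (o.img q)) i j = 𝟙 _ := by
  funext k
  change (o.theta i j k).hom ≫ tensMap (fun l => 𝟙 (o.img (FinPt.pair k l))) (seg i j) ≫
    (o.theta i j k).inv = 𝟙 _
  rw [tensMap_id]
  simp

/-- Both sides are units presented by the empty list, where the coherence principle leaves only the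
identity. -/
theorem permIso_nil {L₀ : List (Fin o.base.2.unop.len)} {L : List (Fin b.2.unop.len)}
    (h₀ : L₀ = []) (h : L = []) (k : Fin b.1.size)
    (hp : (o.wordPres L₀ k).list.Perm (o.prodPres L k).list)
    (hn : (o.prodPres L k).list.Nodup) (e : (o.wordPres L₀ k).obj o.pt = (o.prodPres L k).obj o.pt) :
    (Pres.permIso (o.wordPres L₀ k) (o.prodPres L k) hp hn o.pt).hom = eqToHom e := by
  subst h₀ h
  exact (Pres.isCode_permIso _ _ hp hn).eq (Pres.IsCode.id Pres.unit) (hp.nodup_iff.2 hn) o.pt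

theorem tensMap_nil {ι : Type*} {x y : ι → C} (f : ∀ i, x i ⟶ y i) {L : List ι} (h : L = [])
    (e : tens x L = tens y L) : tensMap f L = eqToHom e := by
  subst h
  rfl

theorem theta_self (i : Fin (b.2.unop.len + 1)) (k : Fin b.1.size) (e) :
    (o.theta i i k).hom = eqToHom e :=
  permIso_nil (seg_self _) (seg_self _) k _ _ e

theorem cellMap_refl (m : ∀ q, o.img q ⟶ o'.img q) (i : Fin (b.2.unop.len + 1)) (h) :
    cellMap m i i = eqToHom h := by
  funext k
  rw [Functor.eqToHom_proj]
  have e : (tens evL ((seg (o.mono i) (o.mono i)).map (o.lett o.pt)) : Fin b.1.size → C) k =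
      tens (fun l => o.img (FinPt.pair k l)) (seg i i) := by rw [seg_self, seg_self]; rfl
  have e' : (tens evL ((seg (o'.mono i) (o'.mono i)).map (o'.lett o'.pt)) : Fin b.1.size → C) k =
      tens (fun l => o'.img (FinPt.pair k l)) (seg i i) := by rw [seg_self, seg_self]; rfl
  change (o.theta i i k).hom ≫ tensMap (fun l => m (FinPt.pair k l)) (seg i i) ≫
    (o'.theta i i k).inv = _
  rw [← Category.assoc, Iso.comp_inv_eq, theta_self i k e, theta_self i k e',
    tensMap_nil _ (seg_self i) (by rw [seg_self])]
  simp

/-- Additivity of `theta`, the reason why the cells respect composition. Splitting and then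
permuting, or permuting and then splitting, are two permutations of the same distinct variables. -/
theorem permIso_append {L₀ a₀ b₀ : List (Fin o.base.2.unop.len)}
    {L a c : List (Fin b.2.unop.len)} (h₀ : L₀ = a₀ ++ b₀) (h : L = a ++ c) (k : Fin b.1.size)
    (hp : (o.wordPres L₀ k).list.Perm (o.prodPres L k).list)
    (hn : (o.prodPres L k).list.Nodup)
    (hp₁ : (o.wordPres a₀ k).list.Perm (o.prodPres a k).list)
    (hn₁ : (o.prodPres a k).list.Nodup)
    (hp₂ : (o.wordPres b₀ k).list.Perm (o.prodPres c k).list)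
    (hn₂ : (o.prodPres c k).list.Nodup)
    (e : tens evL (L₀.map (o.lett o.pt)) =
      tens evL (a₀.map (o.lett o.pt) ++ b₀.map (o.lett o.pt)))
    (e' : tens (fun l => o.img (FinPt.pair k l)) L =
      tens (fun l => o.img (FinPt.pair k l)) (a ++ c)) :
    (eqToHom e ≫ (appIso evL (a₀.map (o.lett o.pt)) (b₀.map (o.lett o.pt))).hom) k ≫
      ((Pres.permIso (o.wordPres a₀ k) (o.prodPres a k) hp₁ hn₁ o.pt).hom ⊗ₘ
        (Pres.permIso (o.wordPres b₀ k) (o.prodPres c k) hp₂ hn₂ o.pt).hom) =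
    (Pres.permIso (o.wordPres L₀ k) (o.prodPres L k) hp hn o.pt).hom ≫
      eqToHom e' ≫ (appIso (fun l => o.img (FinPt.pair k l)) a c).hom := by
  subst h₀ h
  -- After the substitutions `e'` is an identity, which is removed before the coherence principle is
  -- applied.
  refine Eq.trans ?_ (congrArg (_ ≫ ·) (Category.id_comp _).symm)
  -- Both composites are stated for an arbitrary family `x` in place of `o.pt` and specialised at
  -- the end.
  refine Pres.IsCode.eq (A := o.wordPres (a₀ ++ b₀) k) (B := (o.prodPres a k).tensor (o.prodPres c k))
    (f := fun x => (eqToHom (by rw [List.map_append]) ≫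
      (appIso evL (a₀.map (o.lett x)) (b₀.map (o.lett x))).hom) k ≫
        ((Pres.permIso (o.wordPres a₀ k) (o.prodPres a k) hp₁ hn₁ x).hom ⊗ₘ
        (Pres.permIso (o.wordPres b₀ k) (o.prodPres c k) hp₂ hn₂ x).hom))
    (g := fun x => (Pres.permIso (o.wordPres (a₀ ++ b₀) k) (o.prodPres (a ++ c) k) hp hn x).hom ≫
      (appIso (fun l => (o.imPres (FinPt.pair k l)).obj x) a c).hom) ?_ ?_ (hp.nodup_iff.2 hn) o.pt
  · exact (Pres.isCode_word_append evL o.lett _ _ a₀ b₀ k _).comp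
      ((Pres.isCode_permIso _ _ hp₁ hn₁).tensor (Pres.isCode_permIso _ _ hp₂ hn₂))
  · exact (Pres.isCode_permIso _ _ hp hn).comp (Pres.IsCode.appIso_hom _ a c)

theorem tensMap_append {ι : Type*} {x y : ι → C} (f : ∀ i, x i ⟶ y i) {L a c : List ι}
    (h : L = a ++ c) (e : tens x L = tens x (a ++ c)) (e' : tens y L = tens y (a ++ c)) :
    tensMap f L ≫ eqToHom e' ≫ (appIso y a c).hom =
      eqToHom e ≫ (appIso x a c).hom ≫ (tensMap f a ⊗ₘ tensMap f c) := by
  subst h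
  simpa using appIso_natural f a c

/-- The diagram chase for `cellMap_trans`: if the conjugating isomorphisms and the inner morphism
are compatible with splittings into two factors, so is the conjugate. -/
theorem conj_tensor {P P' P₁ P₁' P₂ P₂' R R' R₁ R₁' R₂ R₂' : C} (t : P ≅ R) (t' : P' ≅ R')
    (t₁ : P₁ ≅ R₁) (t₁' : P₁' ≅ R₁') (t₂ : P₂ ≅ R₂) (t₂' : P₂' ≅ R₂') (f : R ⟶ R') (f₁ : R₁ ⟶ R₁')
    (f₂ : R₂ ⟶ R₂') (a : P ⟶ P₁ ⊗ P₂) (a' : P' ⟶ P₁' ⊗ P₂') (c : R ⟶ R₁ ⊗ R₂)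
    (c' : R' ⟶ R₁' ⊗ R₂') (h : a ≫ (t₁.hom ⊗ₘ t₂.hom) = t.hom ≫ c)
    (h' : a' ≫ (t₁'.hom ⊗ₘ t₂'.hom) = t'.hom ≫ c') (hf : f ≫ c' = c ≫ (f₁ ⊗ₘ f₂)) :
    (t.hom ≫ f ≫ t'.inv) ≫ a' =
      a ≫ ((t₁.hom ≫ f₁ ≫ t₁'.inv) ⊗ₘ (t₂.hom ≫ f₂ ≫ t₂'.inv)) := by
  have e : a' = t'.hom ≫ c' ≫ (t₁'.inv ⊗ₘ t₂'.inv) := by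
    rw [← reassoc_of% h', tensorHom_comp_tensorHom]
    simp
  rw [e, ← tensorHom_comp_tensorHom, ← tensorHom_comp_tensorHom, reassoc_of% h]
  simp [reassoc_of% hf]

/-- Checked in each coordinate: `theta` is additive for `o` and for `o'`, the product of the `m` is
additive by naturality of `appIso`, and `conj_tensor` glues the three squares. -/
theorem cellMap_trans (m : ∀ q, o.img q ⟶ o'.img q) {i j k : Fin (b.2.unop.len + 1)}
    (hij : i ≤ j) (hjk : j ≤ k) (h h') :
    cellMap m i k = eqToHom h ≫ ((appIso evL ((seg (o.mono i) (o.mono j)).map (o.lett o.pt))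
      ((seg (o.mono j) (o.mono k)).map (o.lett o.pt))).hom ≫ (cellMap m i j ⊗ₘ cellMap m j k) ≫
       (appIso evL _ _).inv) ≫ eqToHom h' := by
  have hs := seg_append hij hjk
  -- The splitting of the target word is an isomorphism and is moved to the left side, so that no
  -- inverses remain.
  suffices H : cellMap m i k ≫ eqToHom h'.symm ≫ (appIso evL _ _).hom =
      (eqToHom h ≫ (appIso evL _ _).hom) ≫ (cellMap m i j ⊗ₘ cellMap m j k) by
    rw [← cancel_mono (eqToHom h'.symm ≫ (appIso evL _ _).hom), H]
    simp
  funext r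
  have h₁ := permIso_append (o := o) (seg_append (o.mono_le hij) (o.mono_le hjk)) hs r
    (o.wordPres_perm i k r) (o.prodPres_nodup (seg_nodup _ _) r)
    (o.wordPres_perm i j r) (o.prodPres_nodup (seg_nodup _ _) r)
    (o.wordPres_perm j k r) (o.prodPres_nodup (seg_nodup _ _) r) h (by rw [hs])
  have h₂ := permIso_append (o := o') (seg_append (o'.mono_le hij) (o'.mono_le hjk)) hs r
    (o'.wordPres_perm i k r) (o'.prodPres_nodup (seg_nodup _ _) r)
    (o'.wordPres_perm i j r) (o'.prodPres_nodup (seg_nodup _ _) r)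
    (o'.wordPres_perm j k r) (o'.prodPres_nodup (seg_nodup _ _) r) h'.symm (by rw [hs])
  have h₃ := tensMap_append (fun l => m (FinPt.pair r l)) hs (by rw [hs]) (by rw [hs])
  exact conj_tensor (o.theta i k r) (o'.theta i k r) (o.theta i j r) (o'.theta i j r)
    (o.theta j k r) (o'.theta j k r) _ _ _ _ _ _ _ h₁ h₂ (h₃.trans (Category.assoc _ _ _).symm)

/-- The icon associated with a morphism between actual images. -/
noncomputable def chainMap (m : ∀ q, o.img q ⟶ o'.img q) : o.chain ⟶ o'.chain :=
  Icon.ofCell (F := o.chain) (G := o'.chain) (fun {i j} _ => cellMap m i j)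
    (fun i => (cellMap_refl m i _).trans (Word.eqToHom_eq _).symm)
    (fun {i j k} f g => by
      rw [Word.eqToHom_eq, Word.eqToHom_eq]
      exact cellMap_trans m (leOfHom f) (leOfHom g) _ _)

theorem chainMap_comp (m : ∀ q, o.img q ⟶ o'.img q) (m' : ∀ q, o'.img q ⟶ o''.img q) :
    chainMap m ≫ chainMap m' = chainMap fun q => m q ≫ m' q := by
  refine Icon.cell_ext fun {i j} f => ?_
  rw [Icon.cell_comp]
  exact cellMap_comp m m' i j

theorem chainMap_id : chainMap (fun q => 𝟙 (o.img q)) = 𝟙 _ :=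
  Icon.cell_ext fun {i j} _ => cellMap_id i j

end Gen

end Comparison

/-! ### Regrouping a double product by rows or by columns. -/

section Regroup

variable {C : Type u} [Category.{v} C] [MonoidalCategory C] [SymmetricCategory C]
  {κ μ ν ξ : Type*}

/-- The isomorphism between two ways to group the factors of a product. -/
noncomputable def regroup (p : μ → ν → κ) (F : List μ) (L : List ν) (f : ξ → List κ) (L' : List ξ)
    (H : (flat (fun r => flat (fun l => [p r l]) L) F).Perm (flat f L')) (z : κ → C) :
    tens (fun r => tens (fun l => z (p r l)) L) F ⟶ tens (fun l => tens z (f l)) L' :=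
  tensMap (fun r => tensMap (fun l => (ρ_ (z (p r l))).inv) L ≫
    (bindIso z (fun l => [p r l]) L).hom) F ≫
    (bindIso z (fun r => flat (fun l => [p r l]) L) F).hom ≫ (Code.ofPerm H).hom z ≫
      (bindIso z f L').inv

variable (p : μ → ν → κ) (F : List μ) (L : List ν) (f : ξ → List κ) (L' : List ξ)
    (H : (flat (fun r => flat (fun l => [p r l]) L) F).Perm (flat f L'))

/-- In `regroup` each factor is first viewed as a one-element product, so that a product of single
factors becomes a product over a flattened list; this is naturality of that first stage. -/
theorem bindIso_singleton_natural {z z' : κ → C} (g : ∀ k, z k ⟶ z' k) (p : ν → κ) (L : List ν) :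
    tensMap (fun l => g (p l)) L ≫ tensMap (fun l => (ρ_ (z' (p l))).inv) L ≫
      (bindIso z' (fun l => [p l]) L).hom =
    (tensMap (fun l => (ρ_ (z (p l))).inv) L ≫ (bindIso z (fun l => [p l]) L).hom) ≫
      tensMap g (flat (fun l => [p l]) L) := by
  rw [Category.assoc, ← bindIso_natural, ← Category.assoc, ← Category.assoc]
  refine congrArg (· ≫ _) ?_
  rw [← tensMap_comp]
  refine Eq.trans (tensMap_congr (fun l => ?_) L)
    (tensMap_comp (fun l => (ρ_ (z (p l))).inv) (fun l => tensMap g [p l]) L)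
  change _ = (ρ_ (z (p l))).inv ≫ (g (p l) ⊗ₘ 𝟙 (𝟙_ C))
  simp

theorem tensMap_comp₃ {x y z w : κ → C} (f : ∀ i, x i ⟶ y i) (g : ∀ i, y i ⟶ z i)
    (h : ∀ i, z i ⟶ w i) (l : List κ) :
    tensMap (fun i => f i ≫ g i ≫ h i) l = tensMap f l ≫ tensMap g l ≫ tensMap h l := by
  rw [tensMap_comp, tensMap_comp]

/-- Each stage is natural: insertion of units, flattening, permutation, and regrouping. -/
theorem regroup_natural {z z' : κ → C} (g : ∀ k, z k ⟶ z' k) :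
    tensMap (fun r => tensMap (fun l => g (p r l)) L) F ≫ regroup p F L f L' H z' =
      regroup p F L f L' H z ≫ tensMap (fun l => tensMap g (f l)) L' := by
  have h1 := (tensMap_comp _ _ F).symm.trans ((tensMap_congr
    (fun r => bindIso_singleton_natural g (p r) L) F).trans (tensMap_comp _ _ F))
  have h2 := bindIso_natural g (fun r => flat (fun l => [p r l]) L) F
  have h3 := code_natural g (Code.ofPerm H)
  have h4 := bindIso_inv_natural g f L'
  rw [regroup, regroup, reassoc_of% h1, reassoc_of% h2]
  simp only [Category.assoc]
  rw [← h4]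
  rw [reassoc_of% h3]

/-- The factors may themselves be products of variables: every stage then permutes whole blocks. -/
theorem Pres.isCode_regroup {ι : Type*} (A : κ → Pres ι C) :
    IsCode (tens (fun r => tens (fun l => A (p r l)) L) F) (tens (fun l => tens A (f l)) L')
      fun x => regroup p F L f L' H fun k => (A k).obj x :=
  (IsCode.tensMap (fun r => (IsCode.tensMap (fun l => IsCode.rightUnitor_inv (A (p r l))) L).comp
    (IsCode.bindIso_hom A (fun l => [p r l]) L)) F).comp
    ((IsCode.bindIso_hom A _ F).comp ((IsCode.code A _).comp (IsCode.bindIso_inv A f L')))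

end Regroup

/-! ### Compatibility of the cells with arrows of `F × Δᵒᵖ`. -/

section Naturality

variable {C : Type u} [Category.{v} C] [MonoidalCategory C] [SymmetricCategory C]
  [StrictMonoidal C] {b b' : FinPt × SimplexCategoryᵒᵖ} (k : b ⟶ b')

namespace Gen

variable (o o' : Gen C b)

/-- The action of `k` on formal images. -/
noncomputable abbrev push : Gen C b' := (genSmash C).act k o

/-- The arrow `k`, as the formal image of the actual image of `o`. -/
abbrev ofImg : Gen C b' := ⟨b, k, o.img⟩

/-- The comparison of the actual image under a composite with the iterated actual image. -/
noncomputable def imgComp : (o.push k).img ≅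
    ((pushF C (FinPt.smashCircle.map k)).obj o.img : Fin (b'.2.unop.len * b'.1.size) → C) :=
  eqToIso (by
    change ((pushF C (FinPt.smashCircle.map (o.arr ≫ k))).obj o.pt :
      Fin (FinPt.smashCircle.obj b').size → C) =
      (pushF C (FinPt.smashCircle.map o.arr ≫ FinPt.smashCircle.map k)).obj o.pt
    rw [CategoryTheory.Functor.map_comp]) ≪≫
    (pushComp (FinPt.smashCircle.map o.arr) (FinPt.smashCircle.map k)).app o.pt

/-- The smash of a composite equals the composite of the smashes only propositionally; with two
arbitrary equal maps the equality can be substituted. -/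
theorem isCode_eqToHom_fib {m n : FinPt} {f g : m ⟶ n} (h : f = g) (q : Fin n.size)
    (e : ∀ x : Fin m.size → C, (pushF C f).obj x = (pushF C g).obj x) :
    Pres.IsCode (Pres.tens Pres.var (FinPt.fib f q)) (Pres.tens Pres.var (FinPt.fib g q))
      fun x => (eqToHom (e x) : (pushF C f).obj x ⟶ (pushF C g).obj x) q := by
  subst h
  exact Pres.IsCode.id _

/-- The comparison is that equality followed by a structure isomorphism of `C^{(-)}`, which is
itself a permutation followed by a regrouping. The tuple of `o` is freed to a variable `x`. -/
theorem isCode_imgComp (q : Fin (b'.2.unop.len * b'.1.size)) :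
    Pres.IsCode ((o.push k).imPres q) (Pres.tens o.imPres ((o.ofImg k).fibS q))
      fun x => (Gen.imgComp k ⟨o.base, o.arr, x⟩).hom q := by
  refine (isCode_eqToHom_fib (CategoryTheory.Functor.map_comp FinPt.smashCircle o.arr k) q
    ?_).comp ?_
  · intro x
    rw [CategoryTheory.Functor.map_comp]
  · exact (Pres.IsCode.code Pres.var (Code.ofPerm (fib_comp_perm _ _ q))).comp
      (Pres.IsCode.bindIso_inv Pres.var _ _)

theorem cmp_power {m n p : FinPt} (f : m ⟶ n) (g : n ⟶ p) (x : Fin m.size → C) :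
    QjObj.cmp (power C) f g x = (pushComp f g).app x := by
  refine Iso.ext ?_
  -- Forgetting the monoidal structure contributes the identity.
  change (pushComp f g).hom.app x ≫ 𝟙 _ = _
  exact Category.comp_id _

theorem conj_eqToHom {D : Type*} [Category* D] {P P' Q R S S' : D} (e : P = P') (e' : S' = S)
    {c p : P' ≅ Q} {c' p' : S' ≅ R} (h : c = p) (h' : c' = p') (f : Q ⟶ R) :
    eqToHom e ≫ (c.hom ≫ f ≫ c'.inv) ≫ eqToHom e' =
      (eqToIso e ≪≫ p).hom ≫ f ≫ (eqToIso e'.symm ≪≫ p').inv := by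
  subst e e' h h'
  simp

/-- Puts the action of `Q_j` in usable form: the equalities coming from the full image and the
structure isomorphisms of `C^{(-)}` are collected into `imgComp`. -/
theorem push_hom (m : (genSmash C).obj o ⟶ (genSmash C).obj o') :
    (((genSmash C).imMap k).map (X := o) (Y := o') (InducedCategory.homMk m)).hom =
      ((o.imgComp k).hom ≫ (pushF C (FinPt.smashCircle.map k)).map (X := o.img) (Y := o'.img) m ≫
        (o'.imgComp k).inv : (o.push k).img ⟶ (o'.push k).img) := by
  refine (congrArg₂ (fun s t => s ≫ (QjObj.push (X := power C) (FinPt.smashCircle.map k)).map m ≫ t)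
    (QjObj.eqToHom_eq ((genSmash C).natural k o))
    (QjObj.eqToHom_eq ((genSmash C).natural k o').symm)).trans ?_
  exact conj_eqToHom (D := Fin (FinPt.smashCircle.obj b').size → C) _ _
    (cmp_power (FinPt.smashCircle.map o.arr) (FinPt.smashCircle.map k) o.pt)
    (cmp_power (FinPt.smashCircle.map o'.arr) (FinPt.smashCircle.map k) o'.pt)
    ((pushF C (FinPt.smashCircle.map k)).map (Y := o'.img) (X := o.img) m)

/-- The comparison of the value of the word of `o.push k` with the image of the value of the word
of `o`. -/
noncomputable def wordComp (L : List (Fin o.base.2.unop.len)) :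
    (tens evL (L.map ((o.push k).lett o.pt)) : Fin b'.1.size → C) ≅
      (pushF C k.1).obj (tens evL (L.map (o.lett o.pt))) :=
  eqToIso (by
    change tens evL (L.map fun j => QLet.push k.1 (o.lett o.pt j)) =
      tens evL ((L.map (o.lett o.pt)).map (QLet.push k.1))
    rw [List.map_map]; rfl) ≪≫
  xi (ev := evL) (ev' := evL) (pushF C k.1) (p := QLet.push k.1) (fun s => QLet.cmp k.1 s)
    (L.map (o.lett o.pt))

/-- By `isCode_xi` it is enough to treat one letter, where the comparison is the structure
isomorphism for `o.arr.1` and `k.1`, again a permutation followed by a regrouping. -/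
theorem isCode_wordComp (L : List (Fin o.base.2.unop.len)) (r : Fin b'.1.size) :
    Pres.IsCode ((o.push k).wordPres L r) (Pres.tens (o.wordPres L) (FinPt.fib k.1 r))
      fun x => (Gen.wordComp k ⟨o.base, o.arr, x⟩ L).hom r := by
  refine isCode_xi (ev := evL) (ev' := evL) k.1 (p := QLet.push k.1) (fun s => QLet.cmp k.1 s)
    o.lett _ _ (fun j r => ((o.push k).lettPres j r).list)
    (fun j r x => ((o.push k).lettPres j r).iso x) ?_ L r ?_
  · intro j r
    exact (Pres.IsCode.code (fun i => Pres.var (FinPt.pair i j))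
      (Code.ofPerm (fib_comp_perm o.arr.1 k.1 r))).comp
        (Pres.IsCode.bindIso_inv (fun i => Pres.var (FinPt.pair i j)) _ _)
  · intro x
    rw [List.map_map]
    rfl

/-- Both lists enumerate the pairs `(r, l)` with `r` over `r'` and `l` over a step between `i` and
`j`: the first with `r` as the outer index, the second grouped by the step below `l`. The match is
`smash_pair` with `seg_mono_iff` for the arrow `k`. -/
theorem regroup_perm (i j : Fin (b'.2.unop.len + 1)) (r' : Fin b'.1.size) :
    (flat (fun r => flat (fun l => [FinPt.pair r l])
      (seg ((o.ofImg k).mono i) ((o.ofImg k).mono j))) (FinPt.fib k.1 r')).Perm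
      (flat (fun l => (o.ofImg k).fibS (FinPt.pair r' l)) (seg i j)) := by
  refine (List.perm_ext_iff_of_nodup ?_ ?_).2 fun q => ?_
  · refine flat_nodup _ _ (FinPt.fib_nodup _ _) (fun r => flat_nodup _ _ (seg_nodup _ _)
      (fun _ => List.nodup_singleton _) ?_) ?_
    · intro l l' q h h'
      have := (List.mem_singleton.1 h).symm.trans (List.mem_singleton.1 h')
      simp only [FinPt.pair, EmbeddingLike.apply_eq_iff_eq, Prod.mk.injEq] at this
      exact this.1
    · intro r r₁ q h h'
      obtain ⟨l, -, h⟩ := (mem_flat _ _ _).1 h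
      obtain ⟨l', -, h'⟩ := (mem_flat _ _ _).1 h'
      have := (List.mem_singleton.1 h).symm.trans (List.mem_singleton.1 h')
      simp only [FinPt.pair, EmbeddingLike.apply_eq_iff_eq, Prod.mk.injEq] at this
      exact this.2
  · refine flat_nodup _ _ (seg_nodup _ _) (fun l => (o.ofImg k).fibS_nodup _) ?_
    intro l l' q h h'
    rw [mem_fibS] at h h'
    have := Option.some.inj (h.symm.trans h')
    simp only [FinPt.pair, EmbeddingLike.apply_eq_iff_eq, Prod.mk.injEq] at this
    exact this.1
  · obtain ⟨⟨l, r⟩, rfl⟩ := finProdFinEquiv.surjective q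
    change FinPt.pair r l ∈ _ ↔ FinPt.pair r l ∈ _
    simp only [mem_flat, List.mem_singleton]
    constructor
    · rintro ⟨r₁, hr, l₁, hl, h⟩
      simp only [FinPt.pair, EmbeddingLike.apply_eq_iff_eq, Prod.mk.injEq] at h
      obtain ⟨rfl, rfl⟩ := h
      obtain ⟨l', hl', h⟩ := (seg_mono_iff (o.ofImg k) i j l).1 hl
      exact ⟨l', hl', ((o.ofImg k).mem_fibS _ _).2
        (((o.ofImg k).smash_pair r l r' l').2 ⟨(FinPt.mem_fib _ _ _).1 hr, h⟩)⟩
    · rintro ⟨l', hl', h⟩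
      obtain ⟨h1, h2⟩ := ((o.ofImg k).smash_pair r l r' l').1 (((o.ofImg k).mem_fibS _ _).1 h)
      exact ⟨r, (FinPt.mem_fib _ _ _).2 h1, l,
        (seg_mono_iff (o.ofImg k) i j l).2 ⟨l', hl', h2⟩, rfl⟩

/-- The coherence behind naturality. Either one pulls `k.1` out of the word, permutes inside each
coordinate and regroups, or one applies `theta` for the composite arrow and splits each coordinate
of the actual image. Both permute the distinct variables of a word, so they agree. -/
theorem wordComp_theta (i j : Fin (b'.2.unop.len + 1)) (r' : Fin b'.1.size) :
    (o.wordComp k (seg ((o.push k).mono i) ((o.push k).mono j))).hom r' ≫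
      tensMap (fun r => (o.theta ((o.ofImg k).mono i) ((o.ofImg k).mono j) r).hom)
        (FinPt.fib k.1 r') ≫ regroup FinPt.pair _ _ _ _ (o.regroup_perm k i j r') o.img =
    ((o.push k).theta i j r').hom ≫
      tensMap (fun l => (o.imgComp k).hom (FinPt.pair r' l)) (seg i j) := by
  refine Pres.IsCode.eq
    (A := (o.push k).wordPres (seg ((o.push k).mono i) ((o.push k).mono j)) r')
    (B := Pres.tens (fun l => Pres.tens o.imPres ((o.ofImg k).fibS (FinPt.pair r' l))) (seg i j))
    ((o.isCode_wordComp k _ r').comp ((Pres.IsCode.tensMap (fun r => Pres.isCode_permIso _ _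
      (o.wordPres_perm _ _ r) (o.prodPres_nodup (seg_nodup _ _) r)) _).comp
        (Pres.isCode_regroup _ _ _ _ _ (o.regroup_perm k i j r') o.imPres)))
    ((Pres.isCode_permIso _ _ ((o.push k).wordPres_perm i j r')
      ((o.push k).prodPres_nodup (seg_nodup _ _) r')).comp
        (Pres.IsCode.tensMap (fun l => o.isCode_imgComp k (FinPt.pair r' l)) _))
    ((o.push k).wordPres_nodup (seg_nodup _ _) r') o.pt

/-- A diagram chase. `G'` is recovered from the second pentagon through the one-sided inverses `Ti`
and `Wi`, so neither `G` nor `G'` has to be inverted. -/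
theorem conj_square {D : Type*} [Category* D] {P P' Q Q' R R' S S' U U' : D} {W : P ⟶ Q}
    {T : Q ⟶ R} {G : R ⟶ S} {Θ : P ⟶ U} {I : U ⟶ S} {W' : P' ⟶ Q'} {T' : Q' ⟶ R'} {G' : R' ⟶ S'}
    {Θ' : P' ⟶ U'} {I' : U' ⟶ S'} {M : R ⟶ R'} {N : S ⟶ S'} {Wi : Q' ⟶ P'} {Ti : R' ⟶ Q'}
    {Θi : U' ⟶ P'} {Ii : S' ⟶ U'} (h : W ≫ T ≫ G = Θ ≫ I) (h' : W' ≫ T' ≫ G' = Θ' ≫ I')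
    (hN : M ≫ G' = G ≫ N) (hW : Wi ≫ W' = 𝟙 _) (hT : Ti ≫ T' = 𝟙 _) (hΘ : Θ' ≫ Θi = 𝟙 _)
    (hI : I' ≫ Ii = 𝟙 _) :
    Θ ≫ (I ≫ N ≫ Ii) ≫ Θi = W ≫ (T ≫ M ≫ Ti) ≫ Wi := by
  have e : G' = Ti ≫ Wi ≫ Θ' ≫ I' := by
    rw [← h', reassoc_of% hW, reassoc_of% hT]
  have e' : Θ ≫ I ≫ N = W ≫ T ≫ M ≫ G' := by rw [hN, reassoc_of% h]
  simp only [Category.assoc]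
  rw [reassoc_of% e', e]
  simp only [Category.assoc]
  rw [reassoc_of% hI, hΘ, Category.comp_id]

variable {o o'}

/-- The pentagons `wordComp_theta` for `o` and `o'` are glued along naturality of `regroup` in `m`.
-/
theorem cellMap_push (m : ∀ q, o.img q ⟶ o'.img q) (i j : Fin (b'.2.unop.len + 1)) :
    cellMap (o := o.push k) (o' := o'.push k) ((o.imgComp k).hom ≫
      (pushF C (FinPt.smashCircle.map k)).map (X := o.img) (Y := o'.img) m ≫
        (o'.imgComp k).inv) i j =
    (o.wordComp k _).hom ≫ (pushF C k.1).map
      (cellMap m ((o.ofImg k).mono i) ((o.ofImg k).mono j)) ≫ (o'.wordComp k _).inv := by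
  funext r'
  have h := o.wordComp_theta k i j r'
  have h' := o'.wordComp_theta k i j r'
  have hN := regroup_natural _ _ _ _ _ (o.regroup_perm k i j r') m
  have hW : (o'.wordComp k (seg ((o'.push k).mono i) ((o'.push k).mono j))).inv r' ≫
      (o'.wordComp k (seg ((o'.push k).mono i) ((o'.push k).mono j))).hom r' = 𝟙 _ :=
    congrFun (o'.wordComp k _).inv_hom_id r'
  -- The objects `o.ofImg k` and `o'.ofImg k` have the same arrow `k`, so they give the same
  -- segments.
  have hT : tensMap (fun r => (o'.theta ((o.ofImg k).mono i) ((o.ofImg k).mono j) r).inv)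
      (FinPt.fib k.1 r') ≫ tensMap (fun r => (o'.theta ((o.ofImg k).mono i)
        ((o.ofImg k).mono j) r).hom) (FinPt.fib k.1 r') = 𝟙 _ := by
    rw [← tensMap_comp]
    simp only [Iso.inv_hom_id, tensMap_id]
  have hI : tensMap (fun l => (o'.imgComp k).hom (FinPt.pair r' l)) (seg i j) ≫
      tensMap (fun l => (o'.imgComp k).inv (FinPt.pair r' l)) (seg i j) = 𝟙 _ := by
    rw [← tensMap_comp]
    refine (tensMap_congr (fun l => ?_) _).trans (tensMap_id _ _)
    exact congrFun (o'.imgComp k).hom_inv_id (FinPt.pair r' l)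
  refine Eq.trans ?_ ((conj_square h h' hN hW hT ((o'.push k).theta i j r').hom_inv_id hI).trans ?_)
  · exact congrArg (fun t => ((o.push k).theta i j r').hom ≫ t ≫ ((o'.push k).theta i j r').inv)
      (tensMap_comp₃ (fun l => (o.imgComp k).hom (FinPt.pair r' l))
        (fun l => tensMap m ((o.ofImg k).fibS (FinPt.pair r' l)))
        (fun l => (o'.imgComp k).inv (FinPt.pair r' l)) (seg i j))
  · exact congrArg (fun t => (o.wordComp k (seg ((o.push k).mono i) ((o.push k).mono j))).hom r' ≫
      t ≫ (o'.wordComp k (seg ((o'.push k).mono i) ((o'.push k).mono j))).inv r')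
      (tensMap_comp₃ _ _ _ _).symm

end Gen

end Naturality

/-! ### The strictly natural comparison of the full subdiagram with `K_adj`. -/

section Transformation

variable (C : Type u) [Category.{v} C] [MonoidalCategory C] [SymmetricCategory C]
  [StrictMonoidal C] {b b' : FinPt × SimplexCategoryᵒᵖ}

/-- The functor that sends a formal image to the associated chain of words. -/
noncomputable def chainF (b : FinPt × SimplexCategoryᵒᵖ) : (genSmash C).Im b ⥤
    Chain (Fin (b.2.unop.len + 1)) (MonoidalSingleObj (QWord (powerMon C) b.1)) where
  obj o := Gen.chain o
  map {o o'} m := Gen.chainMap (o := o) (o' := o') m.hom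
  map_id o := Gen.chainMap_id (o := o)
  map_comp {o o' o''} m n :=
    (Gen.chainMap_comp (o := o) (o' := o') (o'' := o'') m.hom n.hom).symm

/-- The action of `k` on chains of words. -/
noncomputable def chainAct (k : b ⟶ b') :
    Chain (Fin (b.2.unop.len + 1)) (MonoidalSingleObj (QWord (powerMon C) b.1)) ⥤
      Chain (Fin (b'.2.unop.len + 1)) (MonoidalSingleObj (QWord (powerMon C) b'.1)) :=
  Chain.post (suspMap (QWord.push (Z := powerMon C) k.1) rfl (QWord.push_tensor k.1)
    (QWord.push_whiskerLeft k.1) (QWord.push_whiskerRight k.1)) ⋙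
      Chain.pre (simplexFun k.2.unop)

variable {C}

/-- Strictness on objects: on either side each letter has its formal arrow composed with `k.1`, and
positions are reindexed along the monotone map of `k.2`. No structure isomorphism enters. -/
theorem Gen.chain_push (k : b ⟶ b') (o : Gen C b) :
    (o.push k).chain = (chainAct C k).obj o.chain := by
  refine Chain.ext_val fun {i j} f => ?_
  refine Word.ext ?_
  change (seg (o.mono (k.2.unop.toOrderHom i)) (o.mono (k.2.unop.toOrderHom j))).map
    (fun j => QLet.push k.1 (o.lett o.pt j)) =
      ((seg (o.mono (k.2.unop.toOrderHom i)) (o.mono (k.2.unop.toOrderHom j))).map (o.lett o.pt)).map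
        (QLet.push k.1)
  rw [List.map_map]
  rfl

theorem Icon.cell_chainAct (k : b ⟶ b')
    {F G : Chain (Fin (b.2.unop.len + 1)) (MonoidalSingleObj (QWord (powerMon C) b.1))}
    (s : F ⟶ G) {i j : Fin (b'.2.unop.len + 1)} (f : i ⟶ j) :
    Icon.cell (F := (chainAct C k).obj F) (G := (chainAct C k).obj G) ((chainAct C k).map s) f =
      (QWord.push k.1).map (Icon.cell s ((simplexFun k.2.unop).map f)) :=
  (Icon.cell_pre (simplexFun k.2.unop) _ f).trans (Icon.cell_post (QWord.push k.1) _ _ _ _ s _)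

/-- Icons are compared cell by cell, where the equality of chains becomes an equality of values and
`cellMap_push` applies. -/
theorem Gen.chainMap_push (k : b ⟶ b') {o o' : Gen C b} (m : ∀ q, o.img q ⟶ o'.img q) :
    Gen.chainMap (o := o.push k) (o' := o'.push k) ((o.imgComp k).hom ≫
      (pushF C (FinPt.smashCircle.map k)).map (X := o.img) (Y := o'.img) m ≫
        (o'.imgComp k).inv) =
    eqToHom (chain_push k o) ≫ (chainAct C k).map (chainMap m) ≫
      eqToHom (chain_push k o').symm := by
  refine Icon.cell_ext fun {i j} f => ?_
  rw [Icon.cell_comp, Icon.cell_comp, Icon.cell_eqToHom, Icon.cell_eqToHom, Word.eqToHom_eq,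
    Word.eqToHom_eq, Icon.cell_chainAct]
  refine (cellMap_push k m i j).trans ?_
  exact (conj_eqToHom (D := Fin b'.1.size → C) _ _ rfl rfl _).symm

theorem chainF_natural (k : b ⟶ b') :
    (genSmash C).imMap k ⋙ chainF C b' = chainF C b ⋙ chainAct C k := by
  refine CategoryTheory.Functor.ext (fun o => Gen.chain_push k o) fun o o' m => ?_
  exact (congrArg (Gen.chainMap (o := Gen.push k o) (o' := Gen.push k o'))
    (Gen.push_hom k o o' m.hom)).trans (Gen.chainMap_push k (o := o) (o' := o') m.hom)

variable (C) in
/-- The comparison of the two diagrams. -/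
noncomputable def chainTrans : (genSmash C).im ⟶ Kadj C where
  app b := (chainF C b).toCatHom
  naturality _ _ k := Cat.ext (chainF_natural k)

end Transformation

/-! ### The comparison is an equivalence at each `(n₊, [p])`. -/

section Equivalence

variable {C : Type u} [Category.{v} C] [MonoidalCategory C]

theorem tensMap_singleton_injective {ι : Type*} {x y : ι → C} {f g : ∀ i, x i ⟶ y i}
    {L : List ι} {l : ι} (hL : L = [l]) (h : tensMap f L = tensMap g L) : f l = g l := by
  subst hL
  change (f l ⊗ₘ 𝟙 (𝟙_ C)) = (g l ⊗ₘ 𝟙 (𝟙_ C)) at h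
  rw [tensorHom_id, tensorHom_id] at h
  exact (whiskerRight_iff _ _).1 h

/-- The conclusion is stated for every `f` with the right value at `l`, so that the values for
different `l` can be assembled into one family afterwards. -/
theorem exists_tensMap_singleton {ι : Type*} {x y : ι → C} {L : List ι} {l : ι} (hL : L = [l])
    (g : tens x L ⟶ tens y L) :
    ∃ h : x l ⟶ y l, ∀ f : ∀ i, x i ⟶ y i, f l = h → tensMap f L = g := by
  subst hL
  -- A one-element product is `x l ⊗ 𝟙_ C`, so the witness is `g` conjugated by right unitors.
  refine ⟨(ρ_ (x l)).inv ≫ g ≫ (ρ_ (y l)).hom, fun f hf => ?_⟩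
  change (f l ⊗ₘ 𝟙 (𝟙_ C)) = g
  rw [hf, tensorHom_id, ← cancel_mono (ρ_ (y l)).hom, rightUnitor_naturality]
  simp

theorem exists_forall_pair {n p : ℕ} {P : Fin (p * n) → Type*}
    (h : ∀ (k : Fin n) (l : Fin p), P (FinPt.pair k l)) :
    ∃ m : ∀ q, P q, ∀ k l, m (FinPt.pair k l) = h k l :=
  ⟨Equiv.piCongrLeft P finProdFinEquiv fun x => h x.2 x.1, fun k l =>
    Equiv.piCongrLeft_apply_apply P finProdFinEquiv (fun x => h x.2 x.1) (l, k)⟩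

variable [SymmetricCategory C] [StrictMonoidal C] {b : FinPt × SimplexCategoryᵒᵖ}

namespace Gen

variable {o o' : Gen C b}

/-- The segment of a single step `l` is `[l]`, so the cell there is `m_(k,l)` conjugated by
isomorphisms, and each `m_(k,l)` can be read off. -/
theorem chainMap_injective : Function.Injective (chainMap (o := o) (o' := o')) := by
  intro m m' h
  funext q
  obtain ⟨⟨l, k⟩, rfl⟩ := finProdFinEquiv.surjective q
  have e := congrFun (congrArg (fun s => Icon.cell s (stepHom l)) h) k
  have e' : (o.theta l.castSucc l.succ k).hom ≫ tensMap (fun l => m (FinPt.pair k l)) _ ≫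
      (o'.theta l.castSucc l.succ k).inv =
    (o.theta l.castSucc l.succ k).hom ≫ tensMap (fun l => m' (FinPt.pair k l)) _ ≫
      (o'.theta l.castSucc l.succ k).inv := e
  rw [cancel_epi, cancel_mono] at e'
  exact tensMap_singleton_injective (f := fun l => m (FinPt.pair k l))
    (g := fun l => m' (FinPt.pair k l)) (seg_step l) e'

/-- The components of `m` are read off from the cells of `s` on steps; the resulting icon agrees
with `s` on steps and hence everywhere. -/
theorem chainMap_surjective : Function.Surjective (chainMap (o := o) (o' := o')) := by
  intro s
  choose h hh using fun (k : Fin b.1.size) (l : Fin b.2.unop.len) =>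
    exists_tensMap_singleton (x := fun l => o.img (FinPt.pair k l))
      (y := fun l => o'.img (FinPt.pair k l)) (seg_step l)
      ((o.theta l.castSucc l.succ k).inv ≫ Icon.cell s (stepHom l) k ≫
        (o'.theta l.castSucc l.succ k).hom)
  obtain ⟨m, hm⟩ := exists_forall_pair (P := fun q => o.img q ⟶ o'.img q) h
  refine ⟨m, Icon.ext_step fun l => ?_⟩
  funext k
  change (o.theta l.castSucc l.succ k).hom ≫ tensMap (fun l => m (FinPt.pair k l)) _ ≫
    (o'.theta l.castSucc l.succ k).inv = _
  rw [hh k l (fun l => m (FinPt.pair k l)) (hm k l)]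
  exact ((o.theta l.castSucc l.succ k).symm.homCongr (o'.theta l.castSucc l.succ k).symm).right_inv
    (Icon.cell s (stepHom l) k)

/-- The value of a one-letter word at an identity. -/
noncomputable def stepIso (x : Fin (b.2.unop.len * b.1.size) → C) (l : Fin b.2.unop.len) :
    (Word.val (D := Fin b.1.size → C)
      ((⟨b, 𝟙 b, x⟩ : Gen C b).chain.val (stepHom l))) ≅ fun k => x (FinPt.pair k l) :=
  eqToIso (by
    -- A one-letter word has the value `letter ⊗ 𝟙_`; the right unitor and `pushId` then remove the
    -- unit and the action of the identity.
    change tens evL ((seg l.castSucc l.succ).map ((⟨b, 𝟙 b, x⟩ : Gen C b).lett x)) =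
      (pushF C (𝟙 b.1)).obj (fun k => x (FinPt.pair k l)) ⊗ 𝟙_ (Fin b.1.size → C)
    rw [seg_step]
    rfl) ≪≫ ρ_ _ ≪≫ (pushId b.1).app _

end Gen

/-- The values of the steps of `y` form a tuple in `C^{np}`. Its formal image under the identity
gives one-letter words with isomorphic values, and 2-cells between words are morphisms between
values. -/
theorem exists_chain_iso
    (y : Chain (Fin (b.2.unop.len + 1)) (MonoidalSingleObj (QWord (powerMon C) b.1))) :
    ∃ o : Gen C b, Nonempty (o.chain ≅ y) := by
  let V (l : Fin b.2.unop.len) : Fin b.1.size → C :=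
    Word.val (D := Fin b.1.size → C) (y.val (stepHom l))
  let x (q : Fin (b.2.unop.len * b.1.size)) : C :=
    V (finProdFinEquiv.symm q).1 (finProdFinEquiv.symm q).2
  have hx (l) : (fun k => x (FinPt.pair k l)) = V l := by
    funext k
    exact congrArg (fun z => V z.1 z.2) (finProdFinEquiv.symm_apply_apply (l, k))
  -- Both chains are rewritten as the chains given by their steps, and the steps are compared one at
  -- a time.
  refine ⟨⟨b, 𝟙 b, x⟩, ⟨eqToIso (eq_chainOf _) ≪≫ chainOfIso (D := Fin b.1.size → C)
    (fun l => ?_) ≪≫ eqToIso (eq_chainOf y).symm⟩⟩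
  exact Gen.stepIso x l ≪≫ eqToIso (hx l)

variable (C) in
theorem chainF_isEquivalence (b : FinPt × SimplexCategoryᵒᵖ) : (chainF C b).IsEquivalence where
  faithful := ⟨fun {o o'} _ _ h => InducedCategory.hom_ext
    (Gen.chainMap_injective (o := o) (o' := o') h)⟩
  full := ⟨fun {o o'} s =>
    have ⟨m, hm⟩ := Gen.chainMap_surjective (o := o) (o' := o') s
    ⟨InducedCategory.homMk m, hm⟩⟩
  essSurj := ⟨exists_chain_iso⟩

end Equivalence

end SigmaK

/-! ### The zigzag. -/

theorem theorem5p14 (C : Type u) [Category.{v} C] [MonoidalCategory C] [SymmetricCategory C]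
    [SigmaK.StrictMonoidal C] :
    Relation.EqvGen SigmaK.LevelwiseEquiv (SigmaK.smashPower C) (SigmaK.Kadj C) :=
  .trans _ _ _
    -- The inclusion of the full subdiagram points towards `smashPower C`, so this leg is traversed
    -- backwards.
    (.symm _ _ (.rel _ _ ⟨(SigmaK.genSmash C).imι, SigmaK.genSmash_isEquivalence C⟩))
    (.rel _ _ ⟨SigmaK.chainTrans C, SigmaK.chainF_isEquivalence C⟩)
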